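/- **Notation.** Let $n\ge 1$, $I=\{1,\dots,n-1\}$, $[a,b]=ab-ba$, $[a,b]_+=ab+ba$. A dominant cocharacter of the diagonal torus of $\mathrm{SL}_n$ is $\mu=(\epsilon_1(\mu),\dots,\epsilon_n(\mu))\in\mathbb Z^n$ with $\sum_i\epsilon_i(\mu)=0$ and $\epsilon_i(\mu)-\epsilon_{i+1}(\mu)\ge 0$ for $i\in I$. Let $\mu\le\lambda$ be dominant, i.e. $\lambda-\mu=\sum_{i\in I} m_i\alpha_i$ with $m_i\in\mathbb Z_{\ge 0}$, where $\alpha_i$ is the $i$-th simple coroot; put $\lambda_i=\epsilon_i(\lambda)-\epsilon_{i+1}(\lambda)$ and $m_0=m_n=0$. Let $R_i(u)=\prod_{k=1}^{\lambda_i}(u^2-r_{i,k}^2)$ with arbitrary $r_{i,k}\in\mathbb C$, and fix a square root $\sqrt{-1}\in\mathbb C$. **The shifted twisted Yangian.** ${}^{\mathsf{tw}}\widetilde Y_{\mu,\hbar}$ is the $\mathbb C[\hbar]$-algebra generated by $h_i^{(r)},\tilde h_i^{(s)}$ ($1\le i\le n$, $r\ge 2\epsilon_i(\mu)$, $s\ge-2\epsilon_i(\mu)$)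 and $b_j^{(t)}$ ($j\in I$, $t\ge 0$). Put $$h_i(u)=u^{-2\epsilon_i(\mu)}+\hbar\sum_{r} h_i^{(r)}u^{-r-1},\quad \tilde h_i(u)=u^{2\epsilon_i(\mu)}+\hbar\sum_{s}\tilde h_i^{(s)}u^{-s-1},\quad b_j(u)=\hbar\sum_{t} b_j^{(t)}u^{-t-1},$$ $z_i(u)=\tilde h_i(u-\tfrac12\hbar)h_{i+1}(u)$, let $b_i^{[0]}=\hbar b_i^{(0)}$ be the coefficient of $u^{-1}$ in $b_i(u)$, and let $\underline z_i(u)$ be the part of $z_i(u)$ with negative powers of $u$. The defining relations are the coefficients, after cancellation of common powers of $\hbar$, of \begin{align*} &h_i(u)\tilde h_i(u)=\tilde h_i(u)h_i(u)=1,\qquad z_i(u)=z_i(-u),\qquad [h_i(u),h_j(v)]=0,\\ &[h_i(u),b_j(v)]=\tfrac{\delta_{ij}\hbar}{u-v+\frac12\hbar}\big(b_i(u+\tfrac12\hbar)-b_i(v)\big)h_i(u)+\tfrac{\delta_{ij}\hbar}{u+v+\frac12\hbar}h_i(u)\big(b_i(v)-b_i(-u-\tfrac12\hbar)\big)\\ &\qquad\qquad+\tfrac{\delta_{i,j+1}\hbar}{u+v}h_i(u)\big(b_j(-u)-b_j(v)\big)+\tfrac{\delta_{i,j+1}\hbar}{u-v}\big(b_j(v)-b_j(u)\big)h_i(u),\\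 &[b_i(u),b_j(v)]=0\quad(|i-j|>1),\\ &[b_i(u),b_i(v)]=\tfrac{\hbar}{v-u}\big(b_i(v)-b_i(u)\big)^2+\tfrac{\hbar}{u+v}\big(\underline z_i(v)-\underline z_i(u)\big),\\ &(u-v)[b_i(u),b_{i+1}(v)]=-\tfrac12\hbar\,[b_i(u),b_{i+1}(v)]_++[b_i^{[0]},b_{i+1}(v)]+[b_{i+1}^{[0]},b_i(u)],\\ &(u_1+u_2)\Big(\big[b_i(u_1),[b_i(u_2),b_j(t)]\big]+\big[b_i(u_2),[b_i(u_1),b_j(t)]\big]\Big)=G_{ij}(u_1,t)+G_{ij}(u_2,t)\quad(|i-j|=1), \end{align*} where $G_{ij}(u,t)$ is the part with negative powers of both $u$ and $t$ of $$4\hbar\,\frac{u(t-\hbar)z_i(u)b_j(t)-u(t+\hbar)b_j(t)z_i(u)}{4u^2-\hbar^2}$$ (expanded in $u^{-1}$). **The algebra of difference operators.** $\breve D$ is the $\mathbb C[\hbar]$-algebra generated by * $\gamma_{i,k},\beta_{i,k}^{\pm1}$ ($i\in I$, $1\le k\le m_i$); * $((\gamma_{i,k}+r\hbar)^2-(\gamma_{i,l}+s\hbar)^2)^{-1}$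 ($k\ne l$, $r,s\in\mathbb Z$) and $(\gamma_{i,k}+\frac r2\hbar)^{-1}$ ($r\in\mathbb Z$); * $(\gamma_{i,k}\pm\gamma_{j,l}+\frac r2\hbar)^{1/2}$ ($|i-j|=1$, $r\in\mathbb Z$) and $R_i(\gamma_{i,k}+r\hbar)^{1/2}$ ($r\in\mathbb Z$), subject to: all generators other than the $\beta^{\pm1}_{i,k}$ commute; $[\beta_{i,k}^{\pm1},\gamma_{j,l}]=\pm\delta_{ij}\delta_{kl}\hbar\beta_{i,k}^{\pm1}$, $[\beta_{i,k},\beta_{j,l}]=0$, $\beta_{i,k}^{\pm1}\beta_{i,k}^{\mp1}=1$; the listed inverses are inverses; the listed square roots square to the indicated elements; conjugation by $\beta_{i,k}$ replaces $\gamma_{i,k}$ by $\gamma_{i,k}+\hbar$ inside square roots; $(\gamma_{i,k}+\gamma_{j,l}+\frac r2\hbar)^{1/2}$ is symmetric in $(i,k),(j,l)$; and $(\gamma_{i,k}-\gamma_{i+1,l}+\frac r2\hbar)^{1/2}=\sqrt{-1}\,(\gamma_{i+1,l}-\gamma_{i,k}-\frac r2\hbar)^{1/2}$. Let $\breve D[\hbar^{-1}]=\mathbb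 C[\hbar^{\pm1}]\otimes_{\mathbb C[\hbar]}\breve D$. With $\xi_{i,k}=\gamma_{i,k}+\hbar$ and $(x^2-y^2)^{1/2}:=(x-y)^{1/2}(x+y)^{1/2}$, put $$\breve\varkappa_{i,k}=R_i(\gamma_{i,k})^{\frac12}\frac{\prod_{j\in I,\,|i-j|=1}\prod_{l=1}^{m_j}\big(\gamma_{i,k}^2-(\gamma_{j,l}+\frac12\hbar)^2\big)^{\frac12}}{2(\gamma_{i,k}-\frac12\hbar)\prod_{l\ne k}(\gamma_{i,k}^2-\gamma_{i,l}^2)}\,\beta_{i,k}^{-1},$$ $$\breve\varkappa'_{i,k}=R_i(\xi_{i,k})^{\frac12}\frac{\prod_{j\in I,\,|i-j|=1}\prod_{l=1}^{m_j}\big(\xi_{i,k}^2-(\gamma_{j,l}+\frac12\hbar)^2\big)^{\frac12}}{2(\gamma_{i,k}+\frac32\hbar)\prod_{l\ne k}(\xi_{i,k}^2-\xi_{i,l}^2)}\,\beta_{i,k}.$$ **Statement.** There is a unique $\mathbb C[\hbar]$-algebra homomorphism $\breve\Phi^\lambda_\mu\colon{}^{\mathsf{tw}}\widetilde Y_{\mu,\hbar}\to\breve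 D[\hbar^{-1}]$ such that, for $i\in I$ resp. $1\le i\le n$ (right hand sides expanded in $u^{-1}$; their coefficients are images of elements of $\breve D$), $$b_i(u)\mapsto\sum_{k=1}^{m_i}\Big(\frac1{u-\gamma_{i,k}}\breve\varkappa_{i,k}+\frac1{u+\gamma_{i,k}+\hbar}\breve\varkappa'_{i,k}\Big),$$ $$h_i(u)\mapsto\big(u-\tfrac{i-1}2\hbar\big)^{-2\epsilon_1(\lambda)}\prod_{j=1}^{i-1}R_j\big(u-\tfrac{i-1-j}2\hbar\big)\,\frac{\prod_{k=1}^{m_i}\big(u^2-(\gamma_{i,k}+\frac12\hbar)^2\big)}{\prod_{l=1}^{m_{i-1}}(u-\gamma_{i-1,l})(u+\gamma_{i-1,l}+\hbar)}.$$ -/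

import Mathlib

noncomputable section

namespace TwistedGKLO

/-! ## The base ring and formal Laurent series in inverse variables -/

/-- The base ring `ℂ[ħ]`. -/
abbrev Base : Type := Polynomial ℂ

/-- The deformation parameter `ħ`. -/
def hbar : Base := Polynomial.X

/-- The element `(r / 2) ħ` of `ℂ[ħ]`, for an integer `r`. -/
def halfHbar (r : ℤ) : Base := Polynomial.C ((r : ℂ) / 2) * Polynomial.X

/-- `Ser A` is the ring `A((u⁻¹))`: the coefficient with index `s` is that of `u ^ (-s)`. -/
abbrev Ser (A : Type*) [Zero A] : Type _ := HahnSeries ℤ A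

/-- `Ser₂ A` is the ring `A((u⁻¹))((v⁻¹))`; the inner variable is `u`, the outer one is `v`. -/
abbrev Ser₂ (A : Type*) [Zero A] : Type _ := Ser (Ser A)

/-- `Ser₃ A` is the ring `A((u₁⁻¹))((u₂⁻¹))((t⁻¹))`. -/
abbrev Ser₃ (A : Type*) [Zero A] : Type _ := Ser (Ser (Ser A))

section Series

variable {A : Type*} [Ring A]

/-- The (outermost) formal variable, as an element of `A((u⁻¹))`. -/
def X : Ser A := HahnSeries.single (-1) 1

theorem bddBelow_support {A : Type*} [Zero A] (f : Ser A) :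
    BddBelow (Function.support f.coeff) :=
  ⟨f.order, fun _ hs => HahnSeries.order_le_of_coeff_ne_zero hs⟩

/-- `f(u) ↦ f(-u)`. -/
def reflect (f : Ser A) : Ser A :=
  HahnSeries.ofSuppBddBelow (fun s => ((Int.negOnePow s : ℤˣ) : ℤ) • f.coeff s) <| by
    refine (bddBelow_support f).mono fun s hs => ?_
    intro h
    apply hs
    simp [h]

/-- The principal part of a series: the sum of its terms with negative powers of `u`. -/
def principal (f : Ser A) : Ser A :=
  HahnSeries.ofSuppBddBelow (fun s => if 1 ≤ s then f.coeff s else 0) <| by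
    refine (bddBelow_support f).mono fun s hs => ?_
    intro h
    apply hs
    simp [h]

/-- The part of a two-variable series that has negative powers of both variables. -/
def principal₂ (F : Ser₂ A) : Ser₂ A :=
  HahnSeries.ofSuppBddBelow (fun s => if 1 ≤ s then principal (F.coeff s) else 0) <| by
    refine (bddBelow_support F).mono fun s hs => ?_
    intro h
    apply hs
    have h0 : principal (0 : Ser A) = 0 := by
      ext s
      simp [principal]
    simp [h, h0]

/-- `1 / (u - a) = ∑_{r ≥ 0} a ^ r u ^ (-r-1)`. -/
def recip (a : A) : Ser A :=
  HahnSeries.ofSuppBddBelow (fun s : ℤ => if 1 ≤ s then a ^ (s - 1).toNat else 0) <| by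
    refine ⟨1, fun s hs => ?_⟩
    by_contra h
    apply hs
    simp [h]

/-- `f(u) ↦ f(u + c)` for a scalar `c`, expanded in `u⁻¹` by the binomial series
`(u + c) ^ (-r) = ∑_{k ≥ 0} (-r choose k) c ^ k u ^ (-r-k)`. -/
def shift [Algebra Base A] (c : Base) (f : Ser A) : Ser A :=
  HahnSeries.ofSuppBddBelow
    (fun s : ℤ => ∑ᶠ k : ℕ,
      (Ring.choose (-(s - (k : ℤ))) k : ℤ) • (c ^ k • f.coeff (s - (k : ℤ)))) <| by
    obtain ⟨L, hL⟩ := bddBelow_support f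
    refine ⟨L, fun s hs => ?_⟩
    by_contra h
    apply hs
    have hz : ∀ k : ℕ, f.coeff (s - (k : ℤ)) = 0 := by
      intro k
      by_contra hk
      have := hL hk
      omega
    simp [hz]

/-- `f(u)` as a two-variable series. -/
def inU (f : Ser A) : Ser₂ A := HahnSeries.C f

/-- `f(v)` as a two-variable series. -/
def inV (f : Ser A) : Ser₂ A := f.map (HahnSeries.C : A →+* Ser A)

/-- `f ↦ f(v)` as a zero-preserving map, used to substitute variables coefficientwise. -/
def inVHom : ZeroHom (Ser A) (Ser₂ A) where
  toFun := inV
  map_zero' := by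
    ext s
    simp [inV]

/-- `f(u₁)`, `f(u₂)`, `f(t)` as three-variable series. -/
def inU₁ (f : Ser A) : Ser₃ A := HahnSeries.C (inU f)

/-- See `inU₁`. -/
def inU₂ (f : Ser A) : Ser₃ A := HahnSeries.C (inV f)

/-- See `inU₁`. -/
def inT (f : Ser A) : Ser₃ A := inV (inV f)

/-- For a series `F(u, t)` (inner variable `u`, outer variable `t`): the series `F(u₁, t)`. -/
def inU₁T (F : Ser₂ A) : Ser₃ A := F.map (HahnSeries.C : Ser A →+* Ser₂ A)

/-- For a series `F(u, t)` (inner variable `u`, outer variable `t`): the series `F(u₂, t)`. -/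
def inU₂T (F : Ser₂ A) : Ser₃ A := F.map (inVHom : ZeroHom (Ser A) (Ser₂ A))

/-- The commutator `[a, b]`. -/
def comm {S : Type*} [Ring S] (a b : S) : S := a * b - b * a

/-- The anticommutator `[a, b]₊`. -/
def acomm {S : Type*} [Ring S] (a b : S) : S := a * b + b * a

end Series

/-! ## The shifted twisted Yangian of split type associated to `𝔤𝔩_{n+1}`

Cocharacters of the diagonal torus of `GL_{n+1}` are functions `μ : Fin (n+1) → ℤ`, where `μ i` is
the pairing of `μ` with the `i`-th coordinate character. The index sets are `Fin (n+1)` for the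
series `h_i(u)`, and `Fin n` for the nodes of the Dynkin diagram; node `i` corresponds to the
simple root `ε_i - ε_{i+1}`, where `i = i.castSucc` and `i + 1 = i.succ` in `Fin (n+1)`. -/

/-- The pairing of a cocharacter with the `i`-th simple root. -/
def rootPairing {n : ℕ} (mu : Fin (n + 1) → ℤ) (i : Fin n) : ℤ := mu i.castSucc - mu i.succ

/-- `mu` is a dominant cocharacter of the diagonal torus of `SL_{n+1}`. -/
structure IsDominant {n : ℕ} (mu : Fin (n + 1) → ℤ) : Prop where
  sum_eq_zero : ∑ i, mu i = 0
  nonneg : ∀ i, 0 ≤ rootPairing mu i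

/-- The simple coroot `α_i`, as a cocharacter. -/
def simpleCoroot {n : ℕ} (i : Fin n) : Fin (n + 1) → ℤ :=
  Pi.single i.castSucc 1 - Pi.single i.succ 1

/-- The generators of the shifted twisted Yangian: `h_i^{(r)}` for `r ≥ 2 ε_i(μ)`, `h̃_i^{(s)}` for
`s ≥ -2 ε_i(μ)`, and `b_j^{(t)}` for `t ≥ 0`. -/
inductive Gen {n : ℕ} (mu : Fin (n + 1) → ℤ) : Type
  | h (i : Fin (n + 1)) (r : ℤ) (hr : 2 * mu i ≤ r) : Gen mu
  | th (i : Fin (n + 1)) (s : ℤ) (hs : -(2 * mu i) ≤ s) : Gen mu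
  | b (j : Fin n) (t : ℕ) : Gen mu

/-- Triples of families of series over an algebra `A`, in the roles of `h_i(u)`, `h̃_i(u)` and
`b_j(u)`. -/
structure Currents (n : ℕ) (A : Type*) [Ring A] where
  h : Fin (n + 1) → Ser A
  th : Fin (n + 1) → Ser A
  b : Fin n → Ser A

namespace Currents

variable {n : ℕ} {A : Type*} [Ring A] [Algebra Base A] (D : Currents n A)

/-- `z_i(u) = h̃_i(u - ħ/2) h_{i+1}(u)`. -/
def z (i : Fin n) : Ser A := shift (halfHbar (-1)) (D.th i.castSucc) * D.h i.succ

/-- `b_i^{[0]}`, the coefficient of `u⁻¹` in `b_i(u)`, which is `ħ b_i^{(0)}`. -/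
def bZero (i : Fin n) : A := (D.b i).coeff 1

/-- Left minus right hand side of
`[h_i(u), b_i(v)] = ħ (u - v + ħ/2)⁻¹ (b_i(u + ħ/2) - b_i(v)) h_i(u)
  + ħ (u + v + ħ/2)⁻¹ h_i(u) (b_i(v) - b_i(-u - ħ/2))`
after multiplication by both denominators. -/
def relHBSame (i : Fin n) : Ser₂ A :=
  let u : Ser₂ A := inU X
  let v : Ser₂ A := X
  let c : Ser₂ A := algebraMap Base (Ser₂ A) (halfHbar 1)
  let h : Ser₂ A := inU (D.h i.castSucc)
  let bv : Ser₂ A := inV (D.b i)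
  (u - v + c) * (u + v + c) * comm h bv -
    (hbar • ((u + v + c) * ((inU (shift (halfHbar 1) (D.b i)) - bv) * h)) +
      hbar • ((u - v + c) *
        (h * (bv - inU (shift (halfHbar 1) (reflect (D.b i)))))))

/-- Left minus right hand side of
`[h_{j+1}(u), b_j(v)] = ħ (u + v)⁻¹ h_{j+1}(u) (b_j(-u) - b_j(v))
  + ħ (u - v)⁻¹ (b_j(v) - b_j(u)) h_{j+1}(u)`
after multiplication by both denominators. -/
def relHBNext (j : Fin n) : Ser₂ A :=
  let u : Ser₂ A := inU X
  let v : Ser₂ A := X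
  let h : Ser₂ A := inU (D.h j.succ)
  let bv : Ser₂ A := inV (D.b j)
  (u - v) * (u + v) * comm h bv -
    (hbar • ((u - v) * (h * (inU (reflect (D.b j)) - bv))) +
      hbar • ((u + v) * ((bv - inU (D.b j)) * h)))

/-- Left minus right hand side of
`[b_i(u), b_i(v)] = ħ (v - u)⁻¹ (b_i(v) - b_i(u))² + ħ (u + v)⁻¹ (z̲_i(v) - z̲_i(u))`
after multiplication by both denominators; `z̲_i` is the principal part of `z_i`. -/
def relBBSame (i : Fin n) : Ser₂ A :=
  let u : Ser₂ A := inU X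
  let v : Ser₂ A := X
  let bu : Ser₂ A := inU (D.b i)
  let bv : Ser₂ A := inV (D.b i)
  (v - u) * (u + v) * comm bu bv -
    (hbar • ((u + v) * (bv - bu) ^ 2) +
      hbar • ((v - u) * (inV (principal (D.z i)) - inU (principal (D.z i)))))

/-- Left minus right hand side of
`(u - v) [b_i(u), b_j(v)] = -(ħ/2) [b_i(u), b_j(v)]₊ + [b_i^{[0]}, b_j(v)] + [b_j^{[0]}, b_i(u)]`;
used for `j = i + 1`. -/
def relBBNext (i j : Fin n) : Ser₂ A :=
  let u : Ser₂ A := inU X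
  let v : Ser₂ A := X
  let bu : Ser₂ A := inU (D.b i)
  let bv : Ser₂ A := inV (D.b j)
  (u - v) * comm bu bv -
    (-(halfHbar 1 • acomm bu bv) + comm (inU (HahnSeries.C (D.bZero i))) bv +
      comm (inU (HahnSeries.C (D.bZero j))) bu)

/-- The part with negative powers of both `u` and `t` of
`4 ħ (u (t - ħ) z_i(u) b_j(t) - u (t + ħ) b_j(t) z_i(u)) / (4 u² - ħ²)`,
where `4 / (4 u² - ħ²) = 1 / ((u - ħ/2) (u + ħ/2))` is expanded in `u⁻¹`. -/
def serreRHS (i j : Fin n) : Ser₂ A :=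
  let u : Ser₂ A := inU X
  let t : Ser₂ A := X
  let c : Ser₂ A := algebraMap Base (Ser₂ A) hbar
  let zu : Ser₂ A := inU (D.z i)
  let bt : Ser₂ A := inV (D.b j)
  principal₂ (hbar • (inU (recip (algebraMap Base A (halfHbar 1)) *
      recip (algebraMap Base A (halfHbar (-1)))) *
    (u * (t - c) * (zu * bt) - u * (t + c) * (bt * zu))))

/-- Left minus right hand side of the Serre relation
`(u₁ + u₂) Sym_{u₁,u₂} [b_i(u₁), [b_i(u₂), b_j(t)]] = G(u₁, t) + G(u₂, t)`,
where `G` is `serreRHS`; used for `|i - j| = 1`. -/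
def relSerre (i j : Fin n) : Ser₃ A :=
  let u₁ : Ser₃ A := inU₁ X
  let u₂ : Ser₃ A := inU₂ X
  let b₁ : Ser₃ A := inU₁ (D.b i)
  let b₂ : Ser₃ A := inU₂ (D.b i)
  let bt : Ser₃ A := inT (D.b j)
  (u₁ + u₂) * (comm b₁ (comm b₂ bt) + comm b₂ (comm b₁ bt)) -
    (inU₁T (D.serreRHS i j) + inU₂T (D.serreRHS i j))

/-- The elements of `A` that the defining relations of the shifted twisted Yangian set to zero:
all coefficients of the differences of the two sides of the relations. -/
inductive Relator : A → Prop
  | h_th (i : Fin (n + 1)) (s : ℤ) : Relator ((D.h i * D.th i - 1).coeff s)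
  | th_h (i : Fin (n + 1)) (s : ℤ) : Relator ((D.th i * D.h i - 1).coeff s)
  | z_even (i : Fin n) (s : ℤ) : Relator ((D.z i - reflect (D.z i)).coeff s)
  | hh (i j : Fin (n + 1)) (s t : ℤ) :
      Relator (((comm (inU (D.h i)) (inV (D.h j))).coeff t).coeff s)
  | hb_same (i : Fin n) (s t : ℤ) : Relator (((D.relHBSame i).coeff t).coeff s)
  | hb_next (j : Fin n) (s t : ℤ) : Relator (((D.relHBNext j).coeff t).coeff s)
  | hb_far (i : Fin (n + 1)) (j : Fin n) (h₁ : i ≠ j.castSucc) (h₂ : i ≠ j.succ) (s t : ℤ) :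
      Relator (((comm (inU (D.h i)) (inV (D.b j))).coeff t).coeff s)
  | bb_far (i j : Fin n) (hij : 1 < |(i : ℤ) - (j : ℤ)|) (s t : ℤ) :
      Relator (((comm (inU (D.b i)) (inV (D.b j))).coeff t).coeff s)
  | bb_same (i : Fin n) (s t : ℤ) : Relator (((D.relBBSame i).coeff t).coeff s)
  | bb_next (i j : Fin n) (hij : (i : ℕ) + 1 = (j : ℕ)) (s t : ℤ) :
      Relator (((D.relBBNext i j).coeff t).coeff s)
  | serre (i j : Fin n) (hij : |(i : ℤ) - (j : ℤ)| = 1) (s₁ s₂ t : ℤ) :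
      Relator ((((D.relSerre i j).coeff t).coeff s₂).coeff s₁)

end Currents

section Yangian

variable {n : ℕ} (mu : Fin (n + 1) → ℤ)

/-- The series `u ^ (-e) + ħ ∑_{r ≥ e} x_r u ^ (-r-1)`. -/
def monicSeries {A : Type*} [Ring A] [Algebra Base A] (e : ℤ) (x : ∀ r : ℤ, e ≤ r → A) : Ser A :=
  HahnSeries.single e 1 + hbar • HahnSeries.ofSuppBddBelow
    (fun s : ℤ => if hs : e ≤ s - 1 then x (s - 1) hs else 0) (by
      refine ⟨e, fun s hs => ?_⟩
      by_contra h
      apply hs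
      have : ¬ e ≤ s - 1 := by omega
      simp [this])

/-- The series `ħ ∑_{r ≥ 0} x_r u ^ (-r-1)`. -/
def lowSeries {A : Type*} [Ring A] [Algebra Base A] (x : ℕ → A) : Ser A :=
  hbar • HahnSeries.ofSuppBddBelow
    (fun s : ℤ => if 1 ≤ s then x (s - 1).toNat else 0) (by
      refine ⟨1, fun s hs => ?_⟩
      by_contra h
      apply hs
      simp [h])

/-- The generating currents
`h_i(u) = u ^ (-2 ε_i(μ)) + ħ ∑ h_i^{(r)} u ^ (-r-1)`,
`h̃_i(u) = u ^ (2 ε_i(μ)) + ħ ∑ h̃_i^{(s)} u ^ (-s-1)` and `b_j(u) = ħ ∑ b_j^{(t)} u ^ (-t-1)`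
formed from elements of an algebra indexed by the generators. -/
def currents {A : Type*} [Ring A] [Algebra Base A] (g : Gen mu → A) : Currents n A where
  h i := monicSeries (2 * mu i) fun r hr => g (.h i r hr)
  th i := monicSeries (-(2 * mu i)) fun s hs => g (.th i s hs)
  b j := lowSeries fun t => g (.b j t)

/-- The defining relations: the coefficients of the relations between the currents, after
cancellation of common powers of `ħ`. -/
def YangianRel (x y : FreeAlgebra Base (Gen mu)) : Prop :=
  y = 0 ∧ ∃ k : ℕ, (currents mu (FreeAlgebra.ι Base)).Relator (hbar ^ k • x)

/-- The `μ`-shifted twisted Yangian of split type associated to `𝔤𝔩_{n+1}`, a `ℂ[ħ]`-algebra. -/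
def ShiftedTwistedYangian : Type := RingQuot (YangianRel mu)

instance : Ring (ShiftedTwistedYangian mu) := inferInstanceAs (Ring (RingQuot (YangianRel mu)))

instance : Algebra Base (ShiftedTwistedYangian mu) :=
  inferInstanceAs (Algebra Base (RingQuot (YangianRel mu)))

/-- The generators of the shifted twisted Yangian. -/
def ShiftedTwistedYangian.gen (x : Gen mu) : ShiftedTwistedYangian mu :=
  RingQuot.mkAlgHom Base (YangianRel mu) (FreeAlgebra.ι Base x)

/-- The generating currents `h_i(u)`, `h̃_i(u)`, `b_j(u)` of the shifted twisted Yangian. -/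
def ShiftedTwistedYangian.cur : Currents n (ShiftedTwistedYangian mu) :=
  currents mu (ShiftedTwistedYangian.gen mu)

end Yangian

/-! ## The extended algebra of difference operators -/

section Difference

variable {n : ℕ}

/-- The pairs `(i, k)` with `i` a node and `1 ≤ k ≤ m_i`. -/
abbrev Idx (m : Fin n → ℕ) : Type := Σ i : Fin n, Fin (m i)

/-- `R_i(x) = ∏_k (x² - r_{i,k}²)`, as a polynomial with coefficients in `ℂ[ħ]`. -/
def Rpoly {d : Fin n → ℕ} (r : ∀ i, Fin (d i) → ℂ) (i : Fin n) : Polynomial Base :=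
  ∏ k, (Polynomial.X ^ 2 - Polynomial.C (Polynomial.C (r i k ^ 2)))

/-- Generators of the extended algebra of difference operators. With `p = (i,k)` and `q = (j,l)`:
* `gam p` is `γ_{i,k}`, `bet p` is `β_{i,k}` and `betInv p` is `β_{i,k}⁻¹`;
* `invQuad p q _ _ a c` (with `i = j`, `k ≠ l`) is `((γ_{i,k} + a ħ)² - (γ_{i,l} + c ħ)²)⁻¹`;
* `invLin p a` is `(γ_{i,k} + (a/2) ħ)⁻¹`;
* `sqrtSub p q _ a` (with `j = i + 1`) is `(γ_{i,k} - γ_{j,l} + (a/2) ħ)^{1/2}`;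
* `sqrtAdd p q _ a` (with `j = i + 1`) is `(γ_{i,k} + γ_{j,l} + (a/2) ħ)^{1/2}`;
* `sqrtR p a` is `R_i(γ_{i,k} + a ħ)^{1/2}`. -/
inductive DGen (m : Fin n → ℕ) : Type
  | gam (p : Idx m) : DGen m
  | bet (p : Idx m) : DGen m
  | betInv (p : Idx m) : DGen m
  | invQuad (p q : Idx m) (h : p.1 = q.1) (hne : p ≠ q) (a c : ℤ) : DGen m
  | invLin (p : Idx m) (a : ℤ) : DGen m
  | sqrtSub (p q : Idx m) (h : (p.1 : ℕ) + 1 = q.1) (a : ℤ) : DGen m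
  | sqrtAdd (p q : Idx m) (h : (p.1 : ℕ) + 1 = q.1) (a : ℤ) : DGen m
  | sqrtR (p : Idx m) (a : ℤ) : DGen m

/-- The generators that are functions of the variables `γ_{i,k}` (that is, not shifts). -/
def DGen.IsFunction {m : Fin n → ℕ} : DGen m → Prop
  | .bet _ => False
  | .betInv _ => False
  | _ => True

/-- `1` if `x = p` and `0` otherwise. -/
def dlt {m : Fin n → ℕ} (x p : Idx m) : ℤ := if x = p then 1 else 0

open FreeAlgebra in
/-- Defining relations of the extended algebra of difference operators: functions of the `γ`'s
commute, `β_{i,k}` shifts `γ_{i,k}` by `ħ` (also under the square roots), and the symbols for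
inverses and square roots are what they are called. -/
inductive DRel (m : Fin n → ℕ) (R : Fin n → Polynomial Base) :
    FreeAlgebra Base (DGen m) → FreeAlgebra Base (DGen m) → Prop
  | function_comm (x y : DGen m) (hx : x.IsFunction) (hy : y.IsFunction) :
      DRel m R (ι Base x * ι Base y) (ι Base y * ι Base x)
  | bet_gam (p q : Idx m) :
      DRel m R (comm (ι Base (.bet p)) (ι Base (.gam q)))
        (if p = q then hbar • ι Base (.bet p) else 0)
  | betInv_gam (p q : Idx m) :
      DRel m R (comm (ι Base (.betInv p)) (ι Base (.gam q)))
        (if p = q then -(hbar • ι Base (.betInv p)) else 0)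
  | bet_bet (p q : Idx m) : DRel m R (comm (ι Base (.bet p)) (ι Base (.bet q))) 0
  | bet_betInv (p : Idx m) : DRel m R (ι Base (.bet p) * ι Base (.betInv p)) 1
  | betInv_bet (p : Idx m) : DRel m R (ι Base (.betInv p) * ι Base (.bet p)) 1
  | invQuad_mul (p q : Idx m) (h : p.1 = q.1) (hne : p ≠ q) (a c : ℤ) :
      DRel m R (ι Base (.invQuad p q h hne a c) *
        ((ι Base (.gam p) + algebraMap Base _ (halfHbar (2 * a))) ^ 2 -
          (ι Base (.gam q) + algebraMap Base _ (halfHbar (2 * c))) ^ 2)) 1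
  | invLin_mul (p : Idx m) (a : ℤ) :
      DRel m R (ι Base (.invLin p a) *
        (ι Base (.gam p) + algebraMap Base _ (halfHbar a))) 1
  | sqrtSub_sq (p q : Idx m) (h : (p.1 : ℕ) + 1 = q.1) (a : ℤ) :
      DRel m R (ι Base (.sqrtSub p q h a) ^ 2)
        (ι Base (.gam p) - ι Base (.gam q) + algebraMap Base _ (halfHbar a))
  | sqrtAdd_sq (p q : Idx m) (h : (p.1 : ℕ) + 1 = q.1) (a : ℤ) :
      DRel m R (ι Base (.sqrtAdd p q h a) ^ 2)
        (ι Base (.gam p) + ι Base (.gam q) + algebraMap Base _ (halfHbar a))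
  | sqrtR_sq (p : Idx m) (a : ℤ) :
      DRel m R (ι Base (.sqrtR p a) ^ 2)
        (Polynomial.aeval (ι Base (.gam p) + algebraMap Base _ (halfHbar (2 * a))) (R p.1))
  | bet_sqrtSub (x p q : Idx m) (h : (p.1 : ℕ) + 1 = q.1) (a : ℤ) :
      DRel m R (ι Base (.bet x) * ι Base (.sqrtSub p q h a))
        (ι Base (.sqrtSub p q h (a + 2 * dlt x p - 2 * dlt x q)) * ι Base (.bet x))
  | bet_sqrtAdd (x p q : Idx m) (h : (p.1 : ℕ) + 1 = q.1) (a : ℤ) :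
      DRel m R (ι Base (.bet x) * ι Base (.sqrtAdd p q h a))
        (ι Base (.sqrtAdd p q h (a + 2 * dlt x p + 2 * dlt x q)) * ι Base (.bet x))
  | bet_sqrtR (x p : Idx m) (a : ℤ) :
      DRel m R (ι Base (.bet x) * ι Base (.sqrtR p a))
        (ι Base (.sqrtR p (a + dlt x p)) * ι Base (.bet x))

/-- The extended algebra of difference operators, over `ℂ[ħ]`. -/
def DiffAlg (m : Fin n → ℕ) (R : Fin n → Polynomial Base) : Type := RingQuot (DRel m R)

variable (m : Fin n → ℕ) (R : Fin n → Polynomial Base)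

instance : Ring (DiffAlg m R) := inferInstanceAs (Ring (RingQuot (DRel m R)))

instance : Algebra Base (DiffAlg m R) := inferInstanceAs (Algebra Base (RingQuot (DRel m R)))

/-- The extended algebra of difference operators with `ħ` inverted. -/
abbrev DiffAlgLoc : Type := TensorProduct Base (Localization.Away hbar) (DiffAlg m R)

/-- The canonical map from the algebra of difference operators to its localization. -/
def toLoc : DiffAlg m R →ₐ[Base] DiffAlgLoc m R := Algebra.TensorProduct.includeRight

namespace DiffAlg

/-- The generators of the algebra of difference operators. -/
def gen (x : DGen m) : DiffAlg m R := RingQuot.mkAlgHom Base (DRel m R) (FreeAlgebra.ι Base x)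

variable {m}

/-- `γ_{i,k}`. -/
def gam (p : Idx m) : DiffAlg m R := gen m R (.gam p)

/-- The scalar `(a/2) ħ`. -/
def sc (a : ℤ) : DiffAlg m R := algebraMap Base (DiffAlg m R) (halfHbar a)

/-- `(γ_{i,k} - γ_{j,l} + (a/2) ħ)^{1/2}` for adjacent nodes `i`, `j`, where the root for
`i = j + 1` is determined by the convention `x^{1/2} = √-1 (-x)^{1/2}` for
`x = γ_{j,l} - γ_{i,k} - (a/2) ħ`. The element `I` is the chosen `√-1`. -/
def rootSub (I : ℂ) (p q : Idx m) (a : ℤ) : DiffAlg m R :=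
  if h : (p.1 : ℕ) + 1 = q.1 then gen m R (.sqrtSub p q h a)
  else if h : (q.1 : ℕ) + 1 = p.1 then
    (Polynomial.C (-I) : Base) • gen m R (.sqrtSub q p h (-a))
  else 1

/-- `(γ_{i,k} + γ_{j,l} + (a/2) ħ)^{1/2}` for adjacent nodes `i`, `j`. -/
def rootAdd (p q : Idx m) (a : ℤ) : DiffAlg m R :=
  if h : (p.1 : ℕ) + 1 = q.1 then gen m R (.sqrtAdd p q h a)
  else if h : (q.1 : ℕ) + 1 = p.1 then gen m R (.sqrtAdd q p h a)
  else 1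

end DiffAlg

variable {m}

/-- `∏_{j : P j} ∏_{l=1}^{m_j} f (j, l)`; the factors are multiplied in increasing order. -/
def nodeProd {S : Type*} [Ring S] (P : Fin n → Prop) [DecidablePred P] (f : Idx m → S) : S :=
  (List.ofFn fun j : Fin n =>
    if P j then (List.ofFn fun l : Fin (m j) => f ⟨j, l⟩).prod else 1).prod

open DiffAlg

/-- `∏_{l ≠ k} ((γ_{i,k} + a ħ)² - (γ_{i,l} + a ħ)²)⁻¹` for `p = (i, k)`. -/
def invProd (p : Idx m) (a : ℤ) : DiffAlg m R :=
  (List.ofFn fun l : Fin (m p.1) =>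
    if h : p ≠ ⟨p.1, l⟩ then gen m R (.invQuad p ⟨p.1, l⟩ rfl h a a) else 1).prod

/-- The operator
`R_i(γ_{i,k})^{1/2} ∏_{j = i ± 1} ∏_l (γ_{i,k}² - (γ_{j,l} + ħ/2)²)^{1/2} /
  (2 (γ_{i,k} - ħ/2) ∏_{l ≠ k} (γ_{i,k}² - γ_{i,l}²)) β_{i,k}⁻¹` for `p = (i, k)`,
where `(γ_{i,k}² - (γ_{j,l} + ħ/2)²)^{1/2}` is the product of
`(γ_{i,k} - γ_{j,l} - ħ/2)^{1/2}` and `(γ_{i,k} + γ_{j,l} + ħ/2)^{1/2}`. -/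
def kap (I : ℂ) (p : Idx m) : DiffAlg m R :=
  gen m R (.sqrtR p 0) *
    nodeProd (fun j => |(p.1 : ℤ) - (j : ℤ)| = 1)
      (fun q => rootSub R I p q (-1) * rootAdd R p q 1) *
    ((Polynomial.C (1 / 2) : Base) • gen m R (.invLin p (-1))) *
    invProd R p 0 * gen m R (.betInv p)

/-- The operator, with `ξ_{i,k} = γ_{i,k} + ħ`,
`R_i(ξ_{i,k})^{1/2} ∏_{j = i ± 1} ∏_l (ξ_{i,k}² - (γ_{j,l} + ħ/2)²)^{1/2} /
  (2 (γ_{i,k} + 3ħ/2) ∏_{l ≠ k} (ξ_{i,k}² - ξ_{i,l}²)) β_{i,k}` for `p = (i, k)`. -/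
def kapPrime (I : ℂ) (p : Idx m) : DiffAlg m R :=
  gen m R (.sqrtR p 1) *
    nodeProd (fun j => |(p.1 : ℤ) - (j : ℤ)| = 1)
      (fun q => rootSub R I p q 1 * rootAdd R p q 3) *
    ((Polynomial.C (1 / 2) : Base) • gen m R (.invLin p 3)) *
    invProd R p 1 * gen m R (.bet p)

/-- `∑_k 1/(u - γ_{i,k}) ϰ_{i,k} + 1/(u + γ_{i,k} + ħ) ϰ'_{i,k}`. -/
def bImage (I : ℂ) (i : Fin n) : Ser (DiffAlg m R) :=
  ∑ k : Fin (m i),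
    (recip (gam R ⟨i, k⟩) * HahnSeries.C (kap R I ⟨i, k⟩) +
      recip (-(gam R ⟨i, k⟩) - sc R 2) * HahnSeries.C (kapPrime R I ⟨i, k⟩))

/-- With one-based `i = 1, …, n+1` and `e = ε_1(λ)`:
`(u - (i-1)ħ/2) ^ (-2e) ∏_{j=1}^{i-1} R_j(u - (i-1-j)ħ/2)
  ∏_{k=1}^{m_i} (u² - (γ_{i,k} + ħ/2)²)
  / ∏_{l=1}^{m_{i-1}} (u - γ_{i-1,l}) (u + γ_{i-1,l} + ħ)`.
In the code indices start at zero, so that `i - 1` becomes `i` and `i - 1 - j` becomes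
`i - j - 1`. -/
def hImage (e : ℕ) (i : Fin (n + 1)) : Ser (DiffAlg m R) :=
  recip (sc R (i : ℤ)) ^ (2 * e) *
    (List.ofFn fun j : Fin n =>
      if j.castSucc < i then
        Polynomial.aeval (X - HahnSeries.C (sc R ((i : ℤ) - (j : ℤ) - 1)) : Ser (DiffAlg m R)) (R j)
      else 1).prod *
    nodeProd (m := m) (fun j => j.castSucc = i)
      (fun p => X ^ 2 - HahnSeries.C ((gam R p + sc R 1) ^ 2)) *
    nodeProd (m := m) (fun j => j.succ = i)
      (fun p => recip (gam R p) * recip (-(gam R p) - sc R 2))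

end Difference

end TwistedGKLO

end

noncomputable section

namespace TwistedGKLO

open scoped BigOperators

/-! ## Series -/

section SeriesBasics

variable {A : Type*} [Ring A]

/-! Put η = ħ/2 and treat β⁻¹ and β on the same footing. Each p = (i,k) gives two signed indices:
`(p, true)` carries the shift β_p⁻¹ and the pole x = γ_p, while `(p, false)` carries β_p and x =
-γ_p - ħ. The image of b_i(u) becomes one sum of f_a T_a / (u - x_a) over the signed indices a at
node i. Conjugation by T_a sends x_a to x_a - ħ. The opposite index bar a has T_{bar a} = T_a⁻¹, and
its pole is sent to -x_a by T_a. Each relation then splits into identities between commuting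
functions of the γ's, read off as coefficients of products of the T's; these reductions are the
`..._op` lemmas of `ShiftSystem`.

For the relations with h_i(u) only the quotient sh_a(h)/h matters, an explicit rational function of
u (`sh_hUnit_same`, `sh_hUnit_next`). In [b_i(u), b_i(v)] the coefficient of T_a T_b, after the
square term is subtracted, contains x_a - sh_a(x_b) - ħ. It vanishes for b = a. For a and b over
different points the coefficients of T_a T_b and T_b T_a cancel (`coef_star`). What survives is b =
bar a, where T_a T_b = 1, and the resulting function is the partial fraction expansion in u² of the
principal part of z_i (`exists_zUnit_eq`).

For adjacent nodes, f_a sh_a(f_c) and f_c sh_c(f_a) are x_a - x_c - η and x_a - x_c + η times one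
common function `pairCoef`. The identities between square roots behind this, including the
convention on √-1, are collected in `crossRel`. They give the relation between b_i and b_{i+1} at
once. In the Serre relation the inner commutator has coefficients proportional to `pairCoef`, and
the outer one is treated as for [b_i, b_i]: diagonal and generic pairs disappear and only b = bar a
is left (`serre_op`). The right hand side is brought to the same form in `serreRHS_eq`.

Existence and uniqueness of the homomorphism are formal because ħ is invertible in the target:
series with the right leading terms that satisfy the relations determine the images of the
generators (`existsUnique_hom`). The leading exponents come out right because λ - μ = ∑ m_i α_i. No
faithful model of the algebra of difference operators is needed. The commutative ring of functions
is the subalgebra of the target generated by the images of the function generators and ħ⁻¹, on which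
the β's act by conjugation (`exists_model`). -/

@[simp] theorem reflect_coeff (f : Ser A) (s : ℤ) :
    (reflect f).coeff s = ((Int.negOnePow s : ℤˣ) : ℤ) • f.coeff s := rfl

@[simp] theorem principal_coeff (f : Ser A) (s : ℤ) :
    (principal f).coeff s = if 1 ≤ s then f.coeff s else 0 := rfl

@[simp] theorem principal₂_coeff (F : Ser₂ A) (s : ℤ) :
    (principal₂ F).coeff s = if 1 ≤ s then principal (F.coeff s) else 0 := rfl

@[simp] theorem recip_coeff (a : A) (s : ℤ) :
    (recip a).coeff s = if 1 ≤ s then a ^ (s - 1).toNat else 0 := rfl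

theorem shift_coeff [Algebra Base A] (c : Base) (f : Ser A) (s : ℤ) :
    (shift c f).coeff s = ∑ᶠ k : ℕ,
      (Ring.choose (-(s - (k : ℤ))) k : ℤ) • (c ^ k • f.coeff (s - (k : ℤ))) := rfl

theorem X_mul_coeff (f : Ser A) (s : ℤ) : (X * f).coeff s = f.coeff (s + 1) := by
  rw [X, HahnSeries.coeff_single_mul, one_mul, sub_neg_eq_add]

theorem mul_X_coeff (f : Ser A) (s : ℤ) : (f * X).coeff s = f.coeff (s + 1) := by
  rw [X, HahnSeries.coeff_mul_single, mul_one, sub_neg_eq_add]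

@[simp] theorem C_mul_coeff (a : A) (f : Ser A) (s : ℤ) :
    (HahnSeries.C a * f).coeff s = a * f.coeff s := HahnSeries.coeff_single_zero_mul

@[simp] theorem mul_C_coeff (a : A) (f : Ser A) (s : ℤ) :
    (f * HahnSeries.C a).coeff s = f.coeff s * a := HahnSeries.coeff_mul_single_zero

theorem X_sub_C_mul_recip (a : A) : (X - HahnSeries.C a) * recip a = 1 := by
  ext s
  rw [sub_mul, HahnSeries.coeff_sub, X_mul_coeff, C_mul_coeff, recip_coeff, recip_coeff,
    HahnSeries.coeff_one]
  rcases lt_trichotomy s 0 with h | h | h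
  · simp [show ¬ (0 ≤ s) by omega, show ¬ (1 ≤ s) by omega, h.ne]
  · subst h; simp
  · have : (s + 1 - 1).toNat = (s - 1).toNat + 1 := by omega
    rw [this, pow_succ']
    simp [show (0 ≤ s) by omega, show 1 ≤ s by omega, h.ne']

theorem recip_mul_X_sub_C (a : A) : recip a * (X - HahnSeries.C a) = 1 := by
  ext s
  rw [mul_sub, HahnSeries.coeff_sub, mul_X_coeff, mul_C_coeff, recip_coeff, recip_coeff,
    HahnSeries.coeff_one]
  rcases lt_trichotomy s 0 with h | h | h
  · simp [show ¬ (0 ≤ s) by omega, show ¬ (1 ≤ s) by omega, h.ne]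
  · subst h; simp
  · have : (s + 1 - 1).toNat = (s - 1).toNat + 1 := by omega
    rw [this, pow_succ]
    simp [show (0 ≤ s) by omega, show 1 ≤ s by omega, h.ne']

theorem reflect_zero : reflect (0 : Ser A) = 0 := by ext s; simp

theorem reflect_add (f g : Ser A) : reflect (f + g) = reflect f + reflect g := by
  ext s; simp

theorem reflect_one : reflect (1 : Ser A) = 1 := by
  ext s
  rw [reflect_coeff, HahnSeries.coeff_one]
  split_ifs with h
  · subst h; simp
  · simp

theorem reflect_C_mul (a : A) (f : Ser A) :
    reflect (HahnSeries.C a * f) = HahnSeries.C a * reflect f := by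
  ext s; rw [reflect_coeff, C_mul_coeff, C_mul_coeff, reflect_coeff, mul_smul_comm]

theorem reflect_mul_C (a : A) (f : Ser A) :
    reflect (f * HahnSeries.C a) = reflect f * HahnSeries.C a := by
  ext s; rw [reflect_coeff, mul_C_coeff, mul_C_coeff, reflect_coeff, smul_mul_assoc]

theorem reflect_X_mul (f : Ser A) : reflect (X * f) = -(X * reflect f) := by
  ext s
  rw [HahnSeries.coeff_neg, X_mul_coeff, reflect_coeff, reflect_coeff, X_mul_coeff,
    Int.negOnePow_succ]
  simp

theorem reflect_X_sub_C_mul (a : A) (f : Ser A) :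
    reflect ((X - HahnSeries.C a) * f) = -((X + HahnSeries.C a) * reflect f) := by
  have h : (X - HahnSeries.C a) * f = X * f + HahnSeries.C (-a) * f := by
    rw [map_neg]; noncomm_ring
  rw [h, reflect_add, reflect_X_mul, reflect_C_mul, map_neg]; noncomm_ring

theorem reflect_X_sq_sub_C_mul (a : A) (f : Ser A) :
    reflect ((X ^ 2 - HahnSeries.C a) * f) = (X ^ 2 - HahnSeries.C a) * reflect f := by
  have h : (X ^ 2 - HahnSeries.C a) * f = X * (X * f) + HahnSeries.C (-a) * f := by
    rw [map_neg]; noncomm_ring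
  rw [h, reflect_add, reflect_X_mul, reflect_X_mul, reflect_C_mul, map_neg]; noncomm_ring

/-- Identities for `recip` are obtained by clearing the factor u - a on the left with this
cancellation rule, so that coefficients need not be compared. -/
theorem eq_recip_mul {a : A} {f g : Ser A} (h : (X - HahnSeries.C a) * f = g) :
    f = recip a * g := by
  rw [← h, ← mul_assoc, recip_mul_X_sub_C, one_mul]

theorem reflect_recip (a : A) : reflect (recip a) = -recip (-a) := by
  have h := reflect_X_sub_C_mul a (recip a)
  rw [X_sub_C_mul_recip, reflect_one] at h
  have h2 : (X - HahnSeries.C (-a)) * (-reflect (recip a)) = 1 := by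
    rw [h, map_neg]; noncomm_ring
  rw [← neg_eq_iff_eq_neg, eq_recip_mul h2, mul_one]

theorem principal_zero : principal (0 : Ser A) = 0 := by ext s; simp

theorem principal_add (f g : Ser A) : principal (f + g) = principal f + principal g := by
  ext s; by_cases h : 1 ≤ s <;> simp [h]

theorem principal_C_mul (a : A) (f : Ser A) :
    principal (HahnSeries.C a * f) = HahnSeries.C a * principal f := by
  ext s; by_cases h : 1 ≤ s <;> simp [h]

theorem principal_mul_C (a : A) (f : Ser A) :
    principal (f * HahnSeries.C a) = principal f * HahnSeries.C a := by
  ext s; by_cases h : 1 ≤ s <;> simp [h]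

theorem principal_sum {ι : Type*} (s : Finset ι) (f : ι → Ser A) :
    principal (∑ i ∈ s, f i) = ∑ i ∈ s, principal (f i) := by
  classical
  induction s using Finset.induction_on with
  | empty => simp [principal_zero]
  | insert a s ha ih => rw [Finset.sum_insert ha, Finset.sum_insert ha, principal_add, ih]

theorem principal_eq_self {f : Ser A} (h : ∀ s < 1, f.coeff s = 0) : principal f = f := by
  ext s
  rw [principal_coeff]
  split_ifs with hs
  · rfl
  · rw [h s (by omega)]

theorem principal_eq_zero {f : Ser A} (h : ∀ s, 1 ≤ s → f.coeff s = 0) : principal f = 0 := by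
  ext s
  rw [principal_coeff]
  split_ifs with hs
  · rw [h s hs]; rfl
  · rfl

theorem principal₂_add (F G : Ser₂ A) : principal₂ (F + G) = principal₂ F + principal₂ G := by
  ext s : 2; by_cases h : 1 ≤ s <;> simp [h, principal_add]

theorem principal₂_sum {ι : Type*} (s : Finset ι) (f : ι → Ser₂ A) :
    principal₂ (∑ i ∈ s, f i) = ∑ i ∈ s, principal₂ (f i) := by
  classical
  induction s using Finset.induction_on with
  | empty => ext s : 2; simp [principal_zero]
  | insert a s ha ih => rw [Finset.sum_insert ha, Finset.sum_insert ha, principal₂_add, ih]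

theorem inU_mul_inV_coeff (f g : Ser A) (t : ℤ) :
    (inU f * inV g).coeff t = f * HahnSeries.C (g.coeff t) := by
  rw [inU, C_mul_coeff]; rfl

/-- The two factors involve different variables, so negativity of the powers can be imposed on each
separately. -/
theorem principal₂_inU_mul_inV (f g : Ser A) :
    principal₂ (inU f * inV g) = inU (principal f) * inV (principal g) := by
  ext t : 2
  rw [principal₂_coeff, inU_mul_inV_coeff, inU_mul_inV_coeff, principal_mul_C, principal_coeff]
  split_ifs <;> simp

theorem principal_recip (a : A) : principal (recip a) = recip a :=
  principal_eq_self fun s hs => by simp [show ¬ 1 ≤ s by omega]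

theorem reflect_sum {ι : Type*} (s : Finset ι) (f : ι → Ser A) :
    reflect (∑ i ∈ s, f i) = ∑ i ∈ s, reflect (f i) := by
  classical
  induction s using Finset.induction_on with
  | empty => simp [reflect_zero]
  | insert a s ha ih => rw [Finset.sum_insert ha, Finset.sum_insert ha, reflect_add, ih]

end SeriesBasics

/-! ### The substitution u ↦ u + c. -/

section Shift

variable {A : Type*} [Ring A] [Algebra Base A]

theorem shift_support_finite (c : Base) (f : Ser A) (s : ℤ) (g : ℤ → ℕ → ℤ) :
    (Function.support fun k : ℕ => g s k • (c ^ k • f.coeff (s - (k : ℤ)))).Finite := by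
  obtain ⟨L, hL⟩ := bddBelow_support f
  refine (Set.finite_Iic (s - L).toNat).subset fun k hk => ?_
  have : f.coeff (s - (k : ℤ)) ≠ 0 := by
    intro h; apply hk; simp [h]
  have := hL this
  simp only [Set.mem_Iic]; omega

theorem shift_add (c : Base) (f g : Ser A) : shift c (f + g) = shift c f + shift c g := by
  ext s
  rw [HahnSeries.coeff_add, shift_coeff, shift_coeff, shift_coeff,
    ← finsum_add_distrib (shift_support_finite c f s fun s k => Ring.choose (-(s - (k : ℤ))) k)
      (shift_support_finite c g s fun s k => Ring.choose (-(s - (k : ℤ))) k)]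
  simp [smul_add]

theorem shift_zero' (c : Base) : shift c (0 : Ser A) = 0 := by
  ext s; simp [shift_coeff]

theorem shift_C_mul (c : Base) (a : A) (f : Ser A) :
    shift c (HahnSeries.C a * f) = HahnSeries.C a * shift c f := by
  ext s
  rw [C_mul_coeff, shift_coeff, shift_coeff]
  have h := (AddMonoidHom.mulLeft a).map_finsum
    (shift_support_finite c f s fun s k => Ring.choose (-(s - (k : ℤ))) k)
  refine Eq.trans ?_ h.symm
  simp only [C_mul_coeff, AddMonoidHom.coe_mulLeft, mul_smul_comm]

theorem shift_mul_C (c : Base) (a : A) (f : Ser A) :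
    shift c (f * HahnSeries.C a) = shift c f * HahnSeries.C a := by
  ext s
  rw [mul_C_coeff, shift_coeff, shift_coeff]
  have h := (AddMonoidHom.mulRight a).map_finsum
    (shift_support_finite c f s fun s k => Ring.choose (-(s - (k : ℤ))) k)
  refine Eq.trans ?_ h.symm
  simp only [mul_C_coeff, AddMonoidHom.mulRight_apply, smul_mul_assoc]

theorem shift_one (c : Base) : shift c (1 : Ser A) = 1 := by
  ext s
  rw [shift_coeff, finsum_eq_single _ s.toNat]
  · rw [HahnSeries.coeff_one, HahnSeries.coeff_one]
    rcases lt_trichotomy s 0 with h | h | h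
    · rw [if_neg (show s - (s.toNat : ℤ) ≠ 0 by omega), if_neg h.ne, smul_zero, smul_zero]
    · subst h; simp
    · rw [show s - (s.toNat : ℤ) = 0 by omega, neg_zero, Ring.choose_zero_pos _ (by omega)]
      simp [h.ne']
  · intro k hk
    rw [HahnSeries.coeff_one]
    split_ifs with h
    · rw [h, neg_zero, Ring.choose_zero_pos _ (by omega), zero_smul]
    · simp

/-- Pascal's rule for the generalised binomial coefficients. With compatibility with constants, this
is all the multiplicativity of the substitution that is needed: every series to be shifted is built
from linear factors and their inverses. -/
theorem shift_X_mul (c : Base) (f : Ser A) :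
    shift c (X * f) = (X + HahnSeries.C (algebraMap Base A c)) * shift c f := by
  ext s
  have hfin := fun (g : ℤ → ℕ → ℤ) (s : ℤ) => shift_support_finite c f s g
  obtain ⟨L, hL⟩ := bddBelow_support f
  have hf : ∀ t, t < L → f.coeff t = 0 := fun t ht => by
    by_contra h
    exact absurd (hL h) (not_le.2 ht)
  have key : ∀ (s : ℤ) (N : ℕ), s - N < L →
      (shift c f).coeff s = ∑ k ∈ Finset.range N,
        (Ring.choose (-(s - (k : ℤ))) k : ℤ) • (c ^ k • f.coeff (s - (k : ℤ))) := by
    intro s N hN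
    rw [shift_coeff]
    refine finsum_eq_sum_of_support_subset _ fun k hk => ?_
    rw [Finset.coe_range, Set.mem_Iio]
    by_contra hkN
    apply hk
    simp [hf (s - k) (by omega)]
  have key' : ∀ (s : ℤ) (N : ℕ), s + 1 - N < L →
      (shift c (X * f)).coeff s = ∑ k ∈ Finset.range N,
        (Ring.choose (-(s - (k : ℤ))) k : ℤ) • (c ^ k • f.coeff (s + 1 - (k : ℤ))) := by
    intro s N hN
    rw [shift_coeff]
    simp only [X_mul_coeff, show ∀ k : ℕ, s - (k : ℤ) + 1 = s + 1 - k from fun k => by ring]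
    refine finsum_eq_sum_of_support_subset _ fun k hk => ?_
    rw [Finset.coe_range, Set.mem_Iio]
    by_contra hkN
    apply hk
    simp [hf (s + 1 - k) (by omega)]
  -- Beyond N all coefficients involved vanish, so the three infinite sums become finite. Two of
  -- them run one step further because multiplication by u moves the index by one.
  obtain ⟨N, hN⟩ : ∃ N : ℕ, s - N < L := ⟨(s - L).toNat + 1, by omega⟩
  rw [add_mul, HahnSeries.coeff_add, X_mul_coeff, C_mul_coeff, ← Algebra.smul_def,
    key s N hN, key (s + 1) (N + 1) (by push_cast; omega), key' s (N + 1) (by push_cast; omega),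
    Finset.sum_range_succ', Finset.sum_range_succ', add_right_comm, Finset.smul_sum,
    ← Finset.sum_add_distrib]
  congr 1
  -- The term k + 1 of the two longer sums is matched with the term k of the shorter one; the terms
  -- at index 0 agree separately.
  · refine Finset.sum_congr rfl fun k _ => ?_
    have h1 : -(s - ((k + 1 : ℕ) : ℤ)) = (-(s - k)) + 1 := by push_cast; ring
    have h2 : -(s + 1 - ((k + 1 : ℕ) : ℤ)) = -(s - k) := by push_cast; ring
    have h3 : s + 1 - ((k + 1 : ℕ) : ℤ) = s - k := by push_cast; ring
    rw [h1, h2, h3, Ring.choose_succ_succ, add_smul, add_comm, smul_comm c, smul_smul c,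
      ← pow_succ']
  · simp

theorem shift_X_sub_C_mul (c : Base) (a : A) (f : Ser A) :
    shift c ((X - HahnSeries.C a) * f) =
      (X - HahnSeries.C (a - algebraMap Base A c)) * shift c f := by
  have h : (X - HahnSeries.C a) * f = X * f + HahnSeries.C (-a) * f := by
    rw [map_neg]; noncomm_ring
  rw [h, shift_add, shift_X_mul, shift_C_mul, map_neg, map_sub]; noncomm_ring

theorem shift_recip_mul (c : Base) (a : A) (f : Ser A) :
    shift c (recip a * f) = recip (a - algebraMap Base A c) * shift c f := by
  refine eq_recip_mul ?_
  rw [← shift_X_sub_C_mul, ← mul_assoc, X_sub_C_mul_recip, one_mul]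

theorem shift_recip (c : Base) (a : A) :
    shift c (recip a) = recip (a - algebraMap Base A c) := by
  have := shift_recip_mul c a 1
  rwa [mul_one, shift_one, mul_one] at this

theorem shift_neg (c : Base) (f : Ser A) : shift c (-f) = -shift c f := by
  rw [eq_neg_iff_add_eq_zero, ← shift_add, neg_add_cancel, shift_zero']

theorem shift_sum {ι : Type*} (c : Base) (s : Finset ι) (f : ι → Ser A) :
    shift c (∑ i ∈ s, f i) = ∑ i ∈ s, shift c (f i) := by
  classical
  induction s using Finset.induction_on with
  | empty => simp [shift_zero']
  | insert a s ha ih => rw [Finset.sum_insert ha, Finset.sum_insert ha, shift_add, ih]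

end Shift

/-! ## Functoriality -/

section Functoriality

variable {A B : Type*} [Ring A] [Algebra Base A] [Ring B] [Algebra Base B]

/-- Application of an algebra homomorphism to the coefficients of a series. -/
def serMap (φ : A →ₐ[Base] B) : Ser A →ₐ[Base] Ser B where
  toFun f := f.map φ
  map_zero' := by ext; simp
  map_one' := by
    ext s
    rw [HahnSeries.map_coeff, HahnSeries.coeff_one, HahnSeries.coeff_one]
    split_ifs <;> simp
  map_add' f g := by ext; simp
  map_mul' f g := HahnSeries.map_mul (φ : A →ₙ+* B)
  commutes' r := by
    rw [HahnSeries.algebraMap_apply, HahnSeries.algebraMap_apply]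
    ext s
    rw [HahnSeries.map_coeff, HahnSeries.C_apply, HahnSeries.C_apply, HahnSeries.coeff_single,
      HahnSeries.coeff_single]
    split_ifs <;> simp

@[simp] theorem serMap_coeff (φ : A →ₐ[Base] B) (f : Ser A) (s : ℤ) :
    (serMap φ f).coeff s = φ (f.coeff s) := rfl

/-- Constant series. -/
def constAlg (A : Type*) [Ring A] [Algebra Base A] : A →ₐ[Base] Ser A :=
  { (HahnSeries.C : A →+* Ser A) with
    commutes' := fun _ => (HahnSeries.algebraMap_apply).symm }

theorem constAlg_apply (a : A) : constAlg A a = HahnSeries.C a := rfl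

theorem inU_eq (f : Ser A) : inU f = constAlg (Ser A) f := rfl
theorem inV_eq (f : Ser A) : inV f = serMap (constAlg A) f := rfl
theorem inT_eq (f : Ser A) :
    inT f = serMap (constAlg (Ser A)) (serMap (constAlg A) f) := rfl
theorem inU₁T_eq (F : Ser₂ A) : inU₁T F = serMap (constAlg (Ser A)) F := rfl
theorem inU₂T_eq (F : Ser₂ A) : inU₂T F = serMap (serMap (constAlg A)) F := rfl

@[simp] theorem serMap_C (φ : A →ₐ[Base] B) (a : A) :
    serMap φ (HahnSeries.C a) = HahnSeries.C (φ a) := by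
  ext s
  rw [serMap_coeff, HahnSeries.C_apply, HahnSeries.C_apply, HahnSeries.coeff_single,
    HahnSeries.coeff_single]
  split_ifs <;> simp

@[simp] theorem serMap_X (φ : A →ₐ[Base] B) : serMap φ X = X := by
  ext s
  rw [serMap_coeff, X, X, HahnSeries.coeff_single, HahnSeries.coeff_single]
  split_ifs <;> simp

theorem serMap_serMap {E : Type*} [Ring E] [Algebra Base E] (ψ : B →ₐ[Base] E) (φ : A →ₐ[Base] B)
    (f : Ser A) : serMap ψ (serMap φ f) = serMap (ψ.comp φ) f := rfl

@[simp] theorem serMap_reflect (φ : A →ₐ[Base] B) (f : Ser A) :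
    serMap φ (reflect f) = reflect (serMap φ f) := by
  ext s; simp

@[simp] theorem serMap_principal (φ : A →ₐ[Base] B) (f : Ser A) :
    serMap φ (principal f) = principal (serMap φ f) := by
  ext s; by_cases h : 1 ≤ s <;> simp [h]

@[simp] theorem serMap_principal₂ (φ : A →ₐ[Base] B) (F : Ser₂ A) :
    serMap (serMap φ) (principal₂ F) = principal₂ (serMap (serMap φ) F) := by
  ext s : 2; by_cases h : 1 ≤ s <;> simp [h]

@[simp] theorem serMap_recip (φ : A →ₐ[Base] B) (a : A) :
    serMap φ (recip a) = recip (φ a) := by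
  ext s; by_cases h : 1 ≤ s <;> simp [h]

@[simp] theorem serMap_shift (φ : A →ₐ[Base] B) (c : Base) (f : Ser A) :
    serMap φ (shift c f) = shift c (serMap φ f) := by
  ext s
  rw [serMap_coeff, shift_coeff, shift_coeff]
  have h := (φ : A →+ B).map_finsum
    (shift_support_finite c f s fun s k => Ring.choose (-(s - (k : ℤ))) k)
  refine (h : _).trans ?_
  refine finsum_congr fun k => ?_
  simp

@[simp] theorem serMap_inU (φ : A →ₐ[Base] B) (f : Ser A) :
    serMap (serMap φ) (inU f) = inU (serMap φ f) := serMap_C _ _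

@[simp] theorem serMap_inV (φ : A →ₐ[Base] B) (f : Ser A) :
    serMap (serMap φ) (inV f) = inV (serMap φ f) := by
  ext s : 2; exact serMap_C _ _

@[simp] theorem serMap_inU₁ (φ : A →ₐ[Base] B) (f : Ser A) :
    serMap (serMap (serMap φ)) (inU₁ f) = inU₁ (serMap φ f) := by
  rw [inU₁, inU₁, serMap_C, serMap_inU]

@[simp] theorem serMap_inU₂ (φ : A →ₐ[Base] B) (f : Ser A) :
    serMap (serMap (serMap φ)) (inU₂ f) = inU₂ (serMap φ f) := by
  rw [inU₂, inU₂, serMap_C, serMap_inV]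

@[simp] theorem serMap_inT (φ : A →ₐ[Base] B) (f : Ser A) :
    serMap (serMap (serMap φ)) (inT f) = inT (serMap φ f) := by
  rw [inT, inT, serMap_inV, serMap_inV]

@[simp] theorem serMap_inU₁T (φ : A →ₐ[Base] B) (F : Ser₂ A) :
    serMap (serMap (serMap φ)) (inU₁T F) = inU₁T (serMap (serMap φ) F) := by
  ext s : 2; exact serMap_inU _ _

@[simp] theorem serMap_inU₂T (φ : A →ₐ[Base] B) (F : Ser₂ A) :
    serMap (serMap (serMap φ)) (inU₂T F) = inU₂T (serMap (serMap φ) F) := by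
  ext s : 2; exact serMap_inV _ _

@[simp] theorem serMap_comm (φ : A →ₐ[Base] B) (a b : A) :
    φ (comm a b) = comm (φ a) (φ b) := by simp [comm]

@[simp] theorem serMap_acomm (φ : A →ₐ[Base] B) (a b : A) :
    φ (acomm a b) = acomm (φ a) (φ b) := by simp [acomm]

namespace Currents

variable {n : ℕ}

/-- Application of an algebra homomorphism to a family of currents. -/
def map (φ : A →ₐ[Base] B) (D : Currents n A) : Currents n B where
  h i := serMap φ (D.h i)
  th i := serMap φ (D.th i)
  b j := serMap φ (D.b j)

variable (φ : A →ₐ[Base] B) (D : Currents n A)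

theorem map_z (i : Fin n) : (D.map φ).z i = serMap φ (D.z i) := by simp [z, map]

theorem map_relHBSame (i : Fin n) :
    (D.map φ).relHBSame i = serMap (serMap φ) (D.relHBSame i) := by
  simp [relHBSame, map]

theorem map_relHBNext (i : Fin n) :
    (D.map φ).relHBNext i = serMap (serMap φ) (D.relHBNext i) := by
  simp [relHBNext, map]

theorem map_relBBSame (i : Fin n) :
    (D.map φ).relBBSame i = serMap (serMap φ) (D.relBBSame i) := by
  simp [relBBSame, map_z]; simp [map]

theorem map_relBBNext (i j : Fin n) :
    (D.map φ).relBBNext i j = serMap (serMap φ) (D.relBBNext i j) := by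
  simp [relBBNext, map, bZero, -HahnSeries.C_apply]

theorem map_serreRHS (i j : Fin n) :
    (D.map φ).serreRHS i j = serMap (serMap φ) (D.serreRHS i j) := by
  simp [serreRHS, map_z]; simp [map]

theorem map_relSerre (i j : Fin n) :
    (D.map φ).relSerre i j = serMap (serMap (serMap φ)) (D.relSerre i j) := by
  simp [relSerre, map_serreRHS]; simp [map]

/-- Every relation is made from operations that commute with coefficientwise application of a
homomorphism. Hence the relators of the free algebra are sent to relators of the image currents. -/
theorem Relator.map {x : A} (hx : D.Relator x) : (D.map φ).Relator (φ x) := by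
  cases hx with
  | h_th i s => simpa [Currents.map, ← serMap_coeff] using Relator.h_th (D := D.map φ) i s
  | th_h i s => simpa [Currents.map, ← serMap_coeff] using Relator.th_h (D := D.map φ) i s
  | z_even i s =>
    simpa [map_z, ← serMap_coeff] using Relator.z_even (D := D.map φ) i s
  | hh i j s t =>
    have := Relator.hh (D := D.map φ) i j s t
    simpa only [Currents.map, ← serMap_inU, ← serMap_inV, ← serMap_comm, serMap_coeff] using this
  | hb_same i s t => simpa [map_relHBSame] using Relator.hb_same (D := D.map φ) i s t
  | hb_next i s t => simpa [map_relHBNext] using Relator.hb_next (D := D.map φ) i s t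
  | hb_far i j h₁ h₂ s t =>
    have := Relator.hb_far (D := D.map φ) i j h₁ h₂ s t
    simpa only [Currents.map, ← serMap_inU, ← serMap_inV, ← serMap_comm, serMap_coeff] using this
  | bb_far i j h s t =>
    have := Relator.bb_far (D := D.map φ) i j h s t
    simpa only [Currents.map, ← serMap_inU, ← serMap_inV, ← serMap_comm, serMap_coeff] using this
  | bb_same i s t => simpa [map_relBBSame] using Relator.bb_same (D := D.map φ) i s t
  | bb_next i j h s t => simpa [map_relBBNext] using Relator.bb_next (D := D.map φ) i j h s t
  | serre i j h s₁ s₂ t => simpa [map_relSerre] using Relator.serre (D := D.map φ) i j h s₁ s₂ t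

end Currents

end Functoriality

/-! ## Homomorphisms out of the shifted twisted Yangian -/

section Universal

variable {n : ℕ} (mu : Fin (n + 1) → ℤ)
variable {A B : Type*} [Ring A] [Algebra Base A] [Ring B] [Algebra Base B]

theorem monicSeries_coeff (e : ℤ) (x : ∀ r : ℤ, e ≤ r → A) (s : ℤ) :
    (monicSeries e x).coeff s =
      (if s = e then 1 else 0) + hbar • (if hs : e ≤ s - 1 then x (s - 1) hs else 0) := by
  rw [monicSeries, HahnSeries.coeff_add, HahnSeries.coeff_single, HahnSeries.coeff_smul]
  congr 1
  by_cases h : s = e <;> simp [h]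

theorem lowSeries_coeff (x : ℕ → A) (s : ℤ) :
    (lowSeries x).coeff s = hbar • (if 1 ≤ s then x (s - 1).toNat else 0) := by
  rw [lowSeries, HahnSeries.coeff_smul]
  rfl

theorem serMap_monicSeries (φ : A →ₐ[Base] B) (e : ℤ) (x : ∀ r : ℤ, e ≤ r → A) :
    serMap φ (monicSeries e x) = monicSeries e fun r hr => φ (x r hr) := by
  ext s
  rw [serMap_coeff, monicSeries_coeff, monicSeries_coeff, map_add, map_smul]
  congr 2
  · split_ifs <;> simp
  · split_ifs <;> simp

theorem serMap_lowSeries (φ : A →ₐ[Base] B) (x : ℕ → A) :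
    serMap φ (lowSeries x) = lowSeries fun t => φ (x t) := by
  ext s
  rw [serMap_coeff, lowSeries_coeff, lowSeries_coeff, map_smul]
  congr 1
  split_ifs <;> simp

theorem map_currents (φ : A →ₐ[Base] B) (g : Gen mu → A) :
    (currents mu g).map φ = currents mu (φ ∘ g) := by
  simp only [currents, Currents.map, serMap_monicSeries, serMap_lowSeries]
  rfl

theorem map_cur (Φ : ShiftedTwistedYangian mu →ₐ[Base] A) :
    (ShiftedTwistedYangian.cur mu).map Φ =
      currents mu fun x => Φ (ShiftedTwistedYangian.gen mu x) :=
  map_currents mu Φ _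

/-- The projection from the free algebra. -/
def ShiftedTwistedYangian.proj :
    FreeAlgebra Base (Gen mu) →ₐ[Base] ShiftedTwistedYangian mu :=
  RingQuot.mkAlgHom Base (YangianRel mu)

theorem ShiftedTwistedYangian.h_mul_th (i : Fin (n + 1)) :
    (ShiftedTwistedYangian.cur mu).h i * (ShiftedTwistedYangian.cur mu).th i = 1 := by
  have hcur : ShiftedTwistedYangian.cur mu =
      (currents mu (FreeAlgebra.ι Base)).map (ShiftedTwistedYangian.proj mu) :=
    (map_currents mu (ShiftedTwistedYangian.proj mu) _).symm
  rw [← sub_eq_zero]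
  ext s
  have hrel := (RingQuot.mkAlgHom_rel Base (s := YangianRel mu)
    (x := (((currents mu (FreeAlgebra.ι Base)).h i * (currents mu (FreeAlgebra.ι Base)).th i
      - 1).coeff s)) (y := 0) ⟨rfl, 0, by
        rw [pow_zero, one_smul]; exact Currents.Relator.h_th i s⟩).trans (map_zero _)
  have : serMap (ShiftedTwistedYangian.proj mu)
      ((currents mu (FreeAlgebra.ι Base)).h i * (currents mu (FreeAlgebra.ι Base)).th i - 1)
      = (ShiftedTwistedYangian.cur mu).h i * (ShiftedTwistedYangian.cur mu).th i - 1 := by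
    rw [hcur, map_sub, map_mul, map_one]; rfl
  rw [← this, serMap_coeff]
  exact hrel

theorem hom_ext {Φ Ψ : ShiftedTwistedYangian mu →ₐ[Base] A}
    (h : ∀ x, Φ (ShiftedTwistedYangian.gen mu x) = Ψ (ShiftedTwistedYangian.gen mu x)) :
    Φ = Ψ :=
  RingQuot.ringQuot_ext' _ _ _ (FreeAlgebra.hom_ext (funext h))

theorem hbar_smul_cancel (hb : IsUnit (algebraMap Base A hbar)) {x y : A}
    (h : hbar • x = hbar • y) : x = y := by
  rw [Algebra.smul_def, Algebra.smul_def] at h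
  exact hb.mul_left_cancel h

theorem monicSeries_injective (hb : IsUnit (algebraMap Base A hbar)) {e : ℤ}
    {x y : ∀ r : ℤ, e ≤ r → A} (h : monicSeries e x = monicSeries e y) : x = y := by
  funext r hr
  have h1 := congrArg (fun f : Ser A => f.coeff (r + 1)) h
  simp only [monicSeries_coeff, add_sub_cancel_right, dif_pos hr] at h1
  exact hbar_smul_cancel hb (add_left_cancel h1)

theorem lowSeries_injective (hb : IsUnit (algebraMap Base A hbar)) {x y : ℕ → A}
    (h : lowSeries x = lowSeries y) : x = y := by
  funext t
  have h1 := congrArg (fun f : Ser A => f.coeff ((t : ℤ) + 1)) h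
  simp only [lowSeries_coeff, add_sub_cancel_right, Int.toNat_natCast,
    if_pos (show (1 : ℤ) ≤ t + 1 by omega)] at h1
  exact hbar_smul_cancel hb h1

/-- The coefficients below the leading one can be divided by ħ, so nothing is required of them. -/
theorem exists_monicSeries (hb : IsUnit (algebraMap Base A hbar)) {e : ℤ} {f : Ser A}
    (h1 : f.coeff e = 1) (h0 : ∀ s < e, f.coeff s = 0) :
    ∃ x : ∀ r : ℤ, e ≤ r → A, monicSeries e x = f := by
  obtain ⟨w, hw⟩ := hb
  refine ⟨fun r _ => (↑w⁻¹ : A) * f.coeff (r + 1), ?_⟩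
  ext s
  rw [monicSeries_coeff]
  rcases lt_trichotomy s e with h | h | h
  · simp [h.ne, show ¬ e ≤ s - 1 by omega, h0 s h]
  · subst h; simp [h1]
  · rw [dif_pos (show e ≤ s - 1 by omega), Algebra.smul_def, ← hw, sub_add_cancel,
      Units.mul_inv_cancel_left, if_neg h.ne', zero_add]

theorem exists_lowSeries (hb : IsUnit (algebraMap Base A hbar)) {f : Ser A}
    (h0 : ∀ s < 1, f.coeff s = 0) : ∃ x : ℕ → A, lowSeries x = f := by
  obtain ⟨w, hw⟩ := hb
  refine ⟨fun r => (↑w⁻¹ : A) * f.coeff (r + 1), ?_⟩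
  ext s
  rw [lowSeries_coeff]
  by_cases h : 1 ≤ s
  · rw [if_pos h, Algebra.smul_def, ← hw, show (((s - 1).toNat : ℤ) + 1) = s by omega,
      Units.mul_inv_cancel_left]
  · rw [if_neg h, smul_zero, h0 s (by omega)]

/-- The universal property in a form adapted to series: as ħ is a unit, the series determine the
images of the generators and conversely, so currents with the right leading terms that kill all
relators define a homomorphism. The series h̃_i need not be prescribed, being the inverse of h_i. -/
theorem existsUnique_hom (hb : IsUnit (algebraMap Base A hbar)) (D : Currents n A)
    (hrel : ∀ x, D.Relator x → x = 0)
    (hh1 : ∀ i, (D.h i).coeff (2 * mu i) = 1) (hh0 : ∀ i, ∀ s < 2 * mu i, (D.h i).coeff s = 0)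
    (ht1 : ∀ i, (D.th i).coeff (-(2 * mu i)) = 1)
    (ht0 : ∀ i, ∀ s < -(2 * mu i), (D.th i).coeff s = 0)
    (hb0 : ∀ j, ∀ s < 1, (D.b j).coeff s = 0) :
    ∃! Φ : ShiftedTwistedYangian mu →ₐ[Base] A,
      (∀ i : Fin n, ((ShiftedTwistedYangian.cur mu).b i).map Φ = D.b i) ∧
      (∀ i : Fin (n + 1), ((ShiftedTwistedYangian.cur mu).h i).map Φ = D.h i) := by
  choose xh hxh using fun i => exists_monicSeries hb (hh1 i) (hh0 i)
  choose xt hxt using fun i => exists_monicSeries hb (ht1 i) (ht0 i)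
  choose xb hxb using fun j => exists_lowSeries hb (hb0 j)
  let g : Gen mu → A := fun x => match x with
    | .h i r hr => xh i r hr
    | .th i s hs => xt i s hs
    | .b j t => xb j t
  have hg : currents mu g = D := by
    have e1 : (currents mu g).h = D.h := funext hxh
    have e2 : (currents mu g).th = D.th := funext hxt
    have e3 : (currents mu g).b = D.b := funext hxb
    cases D
    simp only at e1 e2 e3
    rw [← e1, ← e2, ← e3]
  have hlift : (currents mu (FreeAlgebra.ι Base)).map (FreeAlgebra.lift Base g) = D := by
    rw [map_currents, FreeAlgebra.ι_comp_lift, hg]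
  have hresp : ∀ ⦃x y : FreeAlgebra Base (Gen mu)⦄, YangianRel mu x y →
      FreeAlgebra.lift Base g x = FreeAlgebra.lift Base g y := by
    rintro x y ⟨rfl, k, hk⟩
    have h1 := hrel _ (hlift ▸ Currents.Relator.map (FreeAlgebra.lift Base g) _ hk)
    rw [map_smul, Algebra.smul_def, map_pow] at h1
    rw [map_zero]
    -- The relations of the Yangian are imposed after cancelling ħ^k; in the target this
    -- cancellation is automatic.
    exact (hb.pow k).mul_left_cancel (by rw [h1, mul_zero])
  let Φ : ShiftedTwistedYangian mu →ₐ[Base] A :=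
    RingQuot.liftAlgHom Base ⟨FreeAlgebra.lift Base g, hresp⟩
  have hΦ : ∀ x, Φ (ShiftedTwistedYangian.gen mu x) = g x := fun x => by
    refine (RingQuot.liftAlgHom_mkAlgHom_apply _ _ _ _).trans ?_
    exact FreeAlgebra.lift_ι_apply _ _
  have hcur : (ShiftedTwistedYangian.cur mu).map Φ = D := by
    rw [map_cur, funext hΦ]; exact hg
  refine ⟨Φ, ⟨fun i => congrFun (congrArg Currents.b hcur) i,
    fun i => congrFun (congrArg Currents.h hcur) i⟩, ?_⟩
  rintro Ψ ⟨h2, h1⟩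
  have h1' : ∀ i, (D.h i) = ((ShiftedTwistedYangian.cur mu).map Ψ).h i := fun i => (h1 i).symm
  have h2' : ∀ i, (D.b i) = ((ShiftedTwistedYangian.cur mu).map Ψ).b i := fun i => (h2 i).symm
  have hinv : ∀ Θ : ShiftedTwistedYangian mu →ₐ[Base] A, ∀ i,
      ((ShiftedTwistedYangian.cur mu).map Θ).h i * ((ShiftedTwistedYangian.cur mu).map Θ).th i
        = 1 := fun Θ i => by
    have := congrArg (serMap Θ) (ShiftedTwistedYangian.h_mul_th mu i)
    rwa [map_mul, map_one] at this
  have hthh : ∀ i, D.th i * D.h i = 1 := fun i => by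
    rw [← sub_eq_zero]
    ext s
    exact hrel _ (Currents.Relator.th_h i s)
  -- A second homomorphism agrees with the first on h_i(u), hence on the unique inverse of that
  -- series.
  have h3' : ∀ i, (D.th i) = ((ShiftedTwistedYangian.cur mu).map Ψ).th i := fun i => by
    have h4 := hinv Ψ i
    rw [← h1'] at h4
    exact left_inv_eq_right_inv (hthh i) h4
  rw [map_cur] at h1' h2' h3'
  refine hom_ext mu fun x => ?_
  rw [hΦ]
  cases x with
  | h i r hr =>
    have e : monicSeries _ (xh i) =
        monicSeries _ fun r hr => Ψ (ShiftedTwistedYangian.gen mu (.h i r hr)) :=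
      (hxh i).trans (h1' i)
    exact (congrFun (congrFun (monicSeries_injective hb e) r) hr).symm
  | th i r hr =>
    have e : monicSeries _ (xt i) =
        monicSeries _ fun r hr => Ψ (ShiftedTwistedYangian.gen mu (.th i r hr)) :=
      (hxt i).trans (h3' i)
    exact (congrFun (congrFun (monicSeries_injective hb e) r) hr).symm
  | b j t =>
    have e : lowSeries (xb j) = lowSeries fun t => Ψ (ShiftedTwistedYangian.gen mu (.b j t)) :=
      (hxb j).trans (h2' j)
    exact (congrFun (lowSeries_injective hb e) t).symm

end Universal

/-! ## Rings of shift operators -/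

theorem algebraMap_halfHbar {A : Type*} [Ring A] [Algebra Base A] (k : ℤ) :
    algebraMap Base A (halfHbar k) = k * algebraMap Base A (halfHbar 1) := by
  have : halfHbar k = (k : Base) * halfHbar 1 := by
    rw [halfHbar, halfHbar, ← Polynomial.C_eq_intCast, ← mul_assoc, ← Polynomial.C_mul]
    congr 2; push_cast; ring
  rw [this, map_mul, map_intCast]

theorem algebraMap_hbar {A : Type*} [Ring A] [Algebra Base A] :
    algebraMap Base A hbar = 2 * algebraMap Base A (halfHbar 1) := by
  have : hbar = halfHbar 2 := by simp [hbar, halfHbar]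
  rw [this, algebraMap_halfHbar]; norm_num

theorem eq_zero_of_add_self {A : Type*} [Ring A] [Algebra Base A] {x : A} (h : x + x = 0) :
    x = 0 := by
  have h2 : (Polynomial.C (1 / 2) : Base) • (x + x) = x := by
    rw [smul_add, ← add_smul, ← Polynomial.C_add]; norm_num
  rw [← h2, h, smul_zero]

instance serAlgebra {A : Type*} [Ring A] [Algebra Base A] : Algebra Base (Ser A) :=
  HahnSeries.instAlgebra

/-- A commutative ring `F` of functions inside a ring `A` of shift operators: the operators `T a`
commute with each other, and commute past functions through automorphisms `sh a`. The involution
`bar` exchanges a shift and its inverse. -/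
structure ShiftSystem (S F A : Type*) [CommRing F] [Algebra Base F] [Ring A] [Algebra Base A] where
  ι : F →ₐ[Base] A
  sh : S → F →ₐ[Base] F
  T : S → A
  bar : S → S
  T_mul : ∀ a f, T a * ι f = ι (sh a f) * T a
  T_comm : ∀ a b, T a * T b = T b * T a
  T_bar : ∀ a, T a * T (bar a) = 1
  sh_comm : ∀ a b f, sh a (sh b f) = sh b (sh a f)
  sh_bar : ∀ a f, sh a (sh (bar a) f) = f
  bar_bar : ∀ a, bar (bar a) = a
  bar_ne : ∀ a, bar a ≠ a

/-! ### Resolvent identities in a commutative ring. -/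

section Inverses

variable {F : Type*} [CommRing F]

theorem inv_sub_inv {u v p r r' : F} (hr : (u - p) * r = 1) (hr' : (v - p) * r' = 1) :
    r' - r = (u - v) * (r * r') := by
  linear_combination -r' * hr + r * hr'

theorem inv_mul_sub_inv_mul {u v p q r r' t t' : F}
    (hr : (u - p) * r = 1) (hr' : (v - p) * r' = 1)
    (ht : (u - q) * t = 1) (ht' : (v - q) * t' = 1) :
    r * t' - r' * t = r * r' * (t * t') * ((v - u) * (p - q)) := by
  linear_combination (-r * t' * t * (u - q)) * hr' - r * t' * ht
    + (r' * t * t' * (v - q)) * hr + r' * t * ht'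

/-- Both differences of resolvents are divisible by v - u, and together they leave the single factor
p - q - ħ. In the application q is the shifted pole sh_a(x_b), so the factor vanishes for b = a. -/
theorem bb_same_coeff {u v p q r r' t t' η : F}
    (hr : (u - p) * r = 1) (hr' : (v - p) * r' = 1)
    (ht : (u - q) * t = 1) (ht' : (v - q) * t' = 1) :
    (v - u) * (u + v) * (r * t' - r' * t) - 2 * η * (u + v) * ((r' - r) * (t' - t)) =
      (u + v) * (v - u) ^ 2 * (r * r' * (t * t')) * (p - q - 2 * η) := by
  rw [inv_mul_sub_inv_mul hr hr' ht ht', inv_sub_inv hr hr', inv_sub_inv ht ht']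
  ring

end Inverses

/-! ### The relations as identities between coefficients of shift operators. -/

namespace ShiftSystem

variable {S F A : Type*} [CommRing F] [Algebra Base F] [Ring A] [Algebra Base A]

/-- The ring of shift operators with series coefficients. -/
def ser (M : ShiftSystem S F A) : ShiftSystem S (Ser F) (Ser A) where
  ι := serMap M.ι
  sh a := serMap (M.sh a)
  T a := HahnSeries.C (M.T a)
  bar := M.bar
  T_mul a f := by
    ext s
    rw [C_mul_coeff, mul_C_coeff, serMap_coeff, serMap_coeff, serMap_coeff, M.T_mul]
  T_comm a b := by rw [← map_mul, ← map_mul, M.T_comm]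
  T_bar a := by rw [← map_mul, M.T_bar, map_one]
  sh_comm a b f := by ext s; simp [M.sh_comm]
  sh_bar a f := by ext s; simp [M.sh_bar]
  bar_bar := M.bar_bar
  bar_ne := M.bar_ne

variable (M : ShiftSystem S F A)

theorem mono_mul (f g : F) (a : S) (t : A) :
    (M.ι f * M.T a) * (M.ι g * t) = M.ι (f * M.sh a g) * (M.T a * t) := by
  rw [mul_assoc, ← mul_assoc (M.T a), M.T_mul, map_mul]; simp only [mul_assoc]

theorem sh_inv {a : S} {y r : F} (h : y * r = 1) : M.sh a y * M.sh a r = 1 := by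
  rw [← map_mul, h, map_one]

theorem sh_inv_fixed {a : S} {y r : F} (h : y * r = 1) (hy : M.sh a y = y) : M.sh a r = r := by
  have h2 := M.sh_inv (a := a) h
  rw [hy] at h2
  linear_combination r * h2 - M.sh a r * h

variable {M}

/-- Symmetrise the double sum and divide by two. The pairs (a, bar a) are left out of the
symmetrisation: T_a T_{bar a} = 1, so their contributions need not cancel and form the result. -/
theorem sum_pairs [DecidableEq S] {s : Finset S} (hs : ∀ a ∈ s, M.bar a ∈ s) {Φ : S → S → A}
    (h0 : ∀ a ∈ s, Φ a a = 0)
    (h1 : ∀ a ∈ s, ∀ b ∈ s, b ≠ a → b ≠ M.bar a → Φ a b + Φ b a = 0) :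
    ∑ a ∈ s, ∑ b ∈ s, Φ a b = ∑ a ∈ s, Φ a (M.bar a) := by
  have h2 : ∑ a ∈ s, Φ a (M.bar a) =
      ∑ a ∈ s, ∑ b ∈ s, if b = M.bar a then Φ a b else 0 := by
    refine Finset.sum_congr rfl fun a ha => ?_
    rw [Finset.sum_ite_eq' s (M.bar a), if_pos (hs a ha)]
  rw [← sub_eq_zero, h2, ← Finset.sum_sub_distrib]
  simp_rw [← Finset.sum_sub_distrib]
  apply eq_zero_of_add_self
  nth_rewrite 2 [Finset.sum_comm]
  rw [← Finset.sum_add_distrib]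
  refine Finset.sum_eq_zero fun a ha => ?_
  rw [← Finset.sum_add_distrib]
  refine Finset.sum_eq_zero fun b hb => ?_
  by_cases hab : b = a
  · subst hab
    simp [h0 b hb, (M.bar_ne b).symm]
  · by_cases hab' : b = M.bar a
    · have : a = M.bar b := by rw [hab', M.bar_bar]
      rw [if_pos hab', if_pos this, sub_self, sub_self, add_zero]
    · have : a ≠ M.bar b := fun h => hab' (by rw [h, M.bar_bar])
      rw [if_neg hab', if_neg this, sub_zero, sub_zero, h1 a ha b hb hab hab']

variable (M)

/-- The operator `∑_{a ∈ s} r_a f_a T_a`. -/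
def op (s : Finset S) (r f : S → F) : A := ∑ a ∈ s, M.ι (r a * f a) * M.T a

variable {M}

theorem op_mul_op (s t : Finset S) (r f r' f' : S → F) :
    M.op s r f * M.op t r' f' = ∑ a ∈ s, ∑ b ∈ t,
      M.ι (r a * f a * (M.sh a (r' b) * M.sh a (f' b))) * (M.T a * M.T b) := by
  rw [op, op, Finset.sum_mul_sum]
  refine Finset.sum_congr rfl fun a _ => Finset.sum_congr rfl fun b _ => ?_
  rw [M.mono_mul, map_mul (M.sh a)]

/-- After subtraction of the square term, each coefficient of T_a T_b contains x_a - sh_a(x_b) - ħ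
by `bb_same_coeff`. The diagonal drops out, generic pairs cancel by the exchange hypothesis `hf`,
and the pairs (a, bar a) produce a pure function. -/
theorem bb_same_op [DecidableEq S] {s : Finset S} (hs : ∀ a ∈ s, M.bar a ∈ s)
    {x f r r' ρ R R' : S → F} {u v η : F}
    (hu : ∀ a, M.sh a u = u) (hv : ∀ a, M.sh a v = v)
    (hη : η = algebraMap Base F (halfHbar 1))
    (hr : ∀ a ∈ s, (u - x a) * r a = 1) (hr' : ∀ a ∈ s, (v - x a) * r' a = 1)
    (hR : ∀ a ∈ s, (u ^ 2 - x a ^ 2) * R a = 1) (hR' : ∀ a ∈ s, (v ^ 2 - x a ^ 2) * R' a = 1)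
    (hx : ∀ a ∈ s, M.sh a (x a) = x a - 2 * η) (hxbar : ∀ a ∈ s, x (M.bar a) = -x a - 2 * η)
    (hxx : ∀ a ∈ s, ∀ b ∈ s, b ≠ a → b ≠ M.bar a → M.sh a (x b) = x b)
    (hf : ∀ a ∈ s, ∀ b ∈ s, b ≠ a → b ≠ M.bar a →
      (x a - x b - 2 * η) * (f a * M.sh a (f b)) = (x a - x b + 2 * η) * (f b * M.sh b (f a)))
    (hρ : ∀ a ∈ s, f a * M.sh a (f (M.bar a)) = ρ a) :
    M.ι ((v - u) * (u + v)) * comm (M.op s r f) (M.op s r' f) =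
      M.ι (2 * η * (u + v)) * (M.op s r' f - M.op s r f) ^ 2 +
        M.ι ((u + v) * (v - u) ^ 2 * ∑ a ∈ s, R a * R' a * (2 * x a - 2 * η) * ρ a) := by
  have hshη : ∀ a, M.sh a η = η := fun a => by rw [hη, AlgHom.commutes]
  have hsub : M.op s r' f - M.op s r f = M.op s (fun a => r' a - r a) f := by
    simp only [op, ← Finset.sum_sub_distrib]
    refine Finset.sum_congr rfl fun a _ => ?_
    rw [← sub_mul, ← map_sub]; congr 2; ring
  have key : M.ι ((v - u) * (u + v)) * comm (M.op s r f) (M.op s r' f) -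
      M.ι (2 * η * (u + v)) * (M.op s r' f - M.op s r f) ^ 2 =
      ∑ a ∈ s, ∑ b ∈ s, M.ι ((u + v) * (v - u) ^ 2 * (r a * r' a * (M.sh a (r b) * M.sh a (r' b))) *
        (x a - M.sh a (x b) - 2 * η) * (f a * M.sh a (f b))) * (M.T a * M.T b) := by
    rw [hsub, comm, pow_two, op_mul_op, op_mul_op, op_mul_op, ← Finset.sum_sub_distrib,
      Finset.mul_sum, Finset.mul_sum, ← Finset.sum_sub_distrib]
    refine Finset.sum_congr rfl fun a ha => ?_
    rw [← Finset.sum_sub_distrib, Finset.mul_sum, Finset.mul_sum, ← Finset.sum_sub_distrib]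
    refine Finset.sum_congr rfl fun b hb => ?_
    have h1 := M.sh_inv (a := a) (hr b hb)
    have h2 := M.sh_inv (a := a) (hr' b hb)
    rw [map_sub, hu] at h1
    rw [map_sub, hv] at h2
    have h3 := bb_same_coeff (η := η) (hr a ha) (hr' a ha) h1 h2
    rw [← h3]
    simp only [← mul_assoc, ← sub_mul, ← map_sub M.ι, ← map_mul M.ι]
    congr 3
    rw [map_sub (M.sh a)]
    ring
  rw [← sub_eq_iff_eq_add', key, sum_pairs hs]
  · rw [Finset.mul_sum, map_sum]
    refine Finset.sum_congr rfl fun a ha => ?_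
    rw [M.T_bar, mul_one, hρ a ha]
    congr 1
    -- The pole of bar a lands on -x_a, so the product of the two resolvents is 1/(u² - x_a²).
    have e : M.sh a (x (M.bar a)) = -x a := by
      rw [hxbar a ha]; simp only [map_sub, map_neg, map_mul, map_ofNat, hshη, hx a ha]; ring
    have h1 := M.sh_inv (a := a) (hr _ (hs a ha))
    have h2 := M.sh_inv (a := a) (hr' _ (hs a ha))
    rw [map_sub, hu, e] at h1
    rw [map_sub, hv, e] at h2
    have e1 : r a * M.sh a (r (M.bar a)) = R a := by
      linear_combination (R a * (u + x a) * M.sh a (r (M.bar a))) * hr a ha + R a * h1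
        - r a * M.sh a (r (M.bar a)) * hR a ha
    have e2 : r' a * M.sh a (r' (M.bar a)) = R' a := by
      linear_combination (R' a * (v + x a) * M.sh a (r' (M.bar a))) * hr' a ha + R' a * h2
        - r' a * M.sh a (r' (M.bar a)) * hR' a ha
    rw [e, ← e1, ← e2]
    ring
  · intro a ha
    rw [hx a ha]
    simp
  · intro a ha b hb hab hab'
    have hba' : a ≠ M.bar b := fun h => hab' (by rw [h, M.bar_bar])
    rw [M.T_comm b a, ← add_mul, ← map_add]
    have e1 := hxx a ha b hb hab hab'
    have e2 := hxx b hb a ha (Ne.symm hab) hba'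
    rw [M.sh_inv_fixed (hr b hb) (by rw [map_sub, hu, e1]),
      M.sh_inv_fixed (hr' b hb) (by rw [map_sub, hv, e1]),
      M.sh_inv_fixed (hr a ha) (by rw [map_sub, hu, e2]),
      M.sh_inv_fixed (hr' a ha) (by rw [map_sub, hv, e2]), e1, e2]
    rw [show (_ : F) + _ = 0 by
      linear_combination ((u + v) * (v - u) ^ 2 * (r a * r' a * (r b * r' b))) *
        hf a ha b hb hab hab', map_zero, zero_mul]

/-- The shifts T_a and T_c do not touch each other's resolvents, so for each pair (a, c) both orders
of composition are multiples of the common function q. What remains is a rational identity in u, v,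
x_a, x_c. -/
theorem bb_next_op {s t : Finset S} {x f r r' : S → F} {q : S → S → F} {u v η : F}
    (hr : ∀ a ∈ s, (u - x a) * r a = 1) (hr' : ∀ c ∈ t, (v - x c) * r' c = 1)
    (hshr : ∀ a ∈ s, ∀ c ∈ t, M.sh a (r' c) = r' c)
    (hshr' : ∀ a ∈ s, ∀ c ∈ t, M.sh c (r a) = r a)
    (hq : ∀ a ∈ s, ∀ c ∈ t, f a * M.sh a (f c) = (x a - x c - η) * q a c)
    (hq' : ∀ a ∈ s, ∀ c ∈ t, f c * M.sh c (f a) = (x a - x c + η) * q a c) :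
    M.ι (u - v) * comm (M.op s r f) (M.op t r' f) =
      -(M.ι η * acomm (M.op s r f) (M.op t r' f)) + comm (M.op s 1 f) (M.op t r' f) +
        comm (M.op t 1 f) (M.op s r f) := by
  rw [comm, acomm, comm, comm]
  simp only [op_mul_op]
  rw [Finset.sum_comm (s := t) (t := s), Finset.sum_comm (s := t) (t := s),
    Finset.sum_comm (s := t) (t := s)]
  simp only [Finset.mul_sum, ← Finset.sum_sub_distrib, ← Finset.sum_add_distrib,
    ← Finset.sum_neg_distrib]
  refine Finset.sum_congr rfl fun a ha => Finset.sum_congr rfl fun c hc => ?_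
  rw [M.T_comm c a]
  simp only [← sub_mul, ← add_mul, ← mul_assoc, ← map_sub, ← map_add, ← map_mul, ← neg_mul,
    ← map_neg]
  congr 3
  -- The resolvent r'_c has pole x_c; translating v by x_a - x_c lets it be compared with r_a as if
  -- both had the pole x_a.
  have h := inv_sub_inv (hr a ha) (p := x a) (v := v + x a - x c) (r' := r' c)
    (by rw [← hr' c hc]; ring)
  simp only [Pi.one_apply, map_mul, map_one, hshr a ha c hc, hshr' a ha c hc]
  linear_combination ((u - v) * r a * r' c + η * r a * r' c - r' c + r a) * hq a ha c hc +
    (- (u - v) * r a * r' c + η * r a * r' c + r' c - r a) * hq' a ha c hc +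
    2 * η * q a c * h

theorem bb_far_op {s t : Finset S} {f r r' : S → F}
    (hshr : ∀ a ∈ s, ∀ c ∈ t, M.sh a (r' c) = r' c)
    (hshr' : ∀ a ∈ s, ∀ c ∈ t, M.sh c (r a) = r a)
    (hf : ∀ a ∈ s, ∀ c ∈ t, f a * M.sh a (f c) = f c * M.sh c (f a)) :
    comm (M.op s r f) (M.op t r' f) = 0 := by
  rw [comm, op_mul_op, op_mul_op, Finset.sum_comm (s := t), sub_eq_zero]
  refine Finset.sum_congr rfl fun a ha => Finset.sum_congr rfl fun c hc => ?_
  rw [M.T_comm c a, hshr a ha c hc, hshr' a ha c hc]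
  congr 2
  linear_combination r a * r' c * hf a ha c hc

theorem ι_mul_op (s : Finset S) (r f : S → F) (h : F) :
    M.ι h * M.op s r f = ∑ a ∈ s, M.ι (h * (r a * f a)) * M.T a := by
  simp only [op, Finset.mul_sum, ← mul_assoc, ← map_mul]

theorem op_mul_ι (s : Finset S) (r f : S → F) (h : F) :
    M.op s r f * M.ι h = ∑ a ∈ s, M.ι (r a * f a * M.sh a h) * M.T a := by
  simp only [op, Finset.sum_mul, mul_assoc, M.T_mul]
  simp only [← mul_assoc, ← map_mul]

theorem op_sub (s : Finset S) (r r' f : S → F) :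
    M.op s r f - M.op s r' f = M.op s (fun a => r a - r' a) f := by
  simp only [op, ← Finset.sum_sub_distrib]
  refine Finset.sum_congr rfl fun a _ => ?_
  rw [← sub_mul, ← map_sub]; congr 2; ring

theorem hb_far_op {s : Finset S} {f r : S → F} {h : F} (hh : ∀ a ∈ s, M.sh a h = h) :
    comm (M.ι h) (M.op s r f) = 0 := by
  rw [comm, ι_mul_op, op_mul_ι, sub_eq_zero]
  refine Finset.sum_congr rfl fun a ha => ?_
  rw [hh a ha, mul_comm]

/-- Each T_a contributes the difference h - sh_a(h), so the whole relation is a consequence of the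
quotient sh_a(h)/h. -/
theorem hb_same_op {s : Finset S} {x f r r₁ r₂ : S → F} {u v h η : F}
    (hr : ∀ a ∈ s, (v - x a) * r a = 1) (hr₁ : ∀ a ∈ s, (u + η - x a) * r₁ a = 1)
    (hr₂ : ∀ a ∈ s, (-u - η - x a) * r₂ a = 1)
    (hh : ∀ a ∈ s, M.sh a h * (u ^ 2 - (x a + η) ^ 2) = h * (u ^ 2 - (x a - η) ^ 2)) :
    M.ι ((u - v + η) * (u + v + η)) * comm (M.ι h) (M.op s r f) =
      M.ι (2 * η * (u + v + η)) * ((M.op s r₁ f - M.op s r f) * M.ι h) +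
        M.ι (2 * η * (u - v + η)) * (M.ι h * (M.op s r f - M.op s r₂ f)) := by
  rw [comm, op_sub, op_sub, ι_mul_op, op_mul_ι, op_mul_ι, ι_mul_op]
  simp only [Finset.mul_sum, ← Finset.sum_sub_distrib, ← Finset.sum_add_distrib]
  refine Finset.sum_congr rfl fun a ha => ?_
  simp only [← sub_mul, ← add_mul, ← mul_assoc, ← map_sub, ← map_add, ← map_mul]
  congr 2
  have e₁ := inv_sub_inv (hr a ha) (hr₁ a ha)
  have e₂ := inv_sub_inv (hr a ha) (hr₂ a ha)
  -- The variable v has been removed here. Rearranged, this says h (1 + ħ r₂) = sh_a(h) (1 - ħ r₁),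
  -- which is the hypothesis `hh` divided by the two linear factors.
  have e₃ : h - M.sh a h = -(2 * η * r₁ a * M.sh a h) - 2 * η * r₂ a * h := by
    linear_combination (M.sh a h - h * r₂ a * (-u + η - x a)) * hr₁ a ha
      + (M.sh a h * r₁ a * (u - η - x a) - h) * hr₂ a ha + r₁ a * r₂ a * hh a ha
  linear_combination ((u - v + η) * (u + v + η) * r a * f a) * e₃ -
    2 * η * (u + v + η) * f a * M.sh a h * e₁ + 2 * η * (u - v + η) * f a * h * e₂

theorem hb_next_op {s : Finset S} {x f r r₁ r₂ : S → F} {u v h η : F}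
    (hr : ∀ a ∈ s, (v - x a) * r a = 1) (hr₁ : ∀ a ∈ s, (u - x a) * r₁ a = 1)
    (hr₂ : ∀ a ∈ s, (-u - x a) * r₂ a = 1)
    (hh : ∀ a ∈ s, M.sh a h * ((u - x a + 2 * η) * (u + x a)) =
      h * ((u - x a) * (u + x a + 2 * η))) :
    M.ι ((u - v) * (u + v)) * comm (M.ι h) (M.op s r f) =
      M.ι (2 * η * (u - v)) * (M.ι h * (M.op s r₂ f - M.op s r f)) +
        M.ι (2 * η * (u + v)) * ((M.op s r f - M.op s r₁ f) * M.ι h) := by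
  rw [comm, op_sub, op_sub, ι_mul_op, op_mul_ι, op_mul_ι, ι_mul_op]
  simp only [Finset.mul_sum, ← Finset.sum_sub_distrib, ← Finset.sum_add_distrib]
  refine Finset.sum_congr rfl fun a ha => ?_
  simp only [← sub_mul, ← add_mul, ← mul_assoc, ← map_sub, ← map_add, ← map_mul]
  congr 2
  have e₁ := inv_sub_inv (hr a ha) (hr₁ a ha)
  have e₂ := inv_sub_inv (hr a ha) (hr₂ a ha)
  -- Equivalently h (1 - ħ r₂) = sh_a(h) (1 + ħ r₁), again `hh` divided by two linear factors.
  have e₃ : h - M.sh a h = 2 * η * r₁ a * M.sh a h + 2 * η * r₂ a * h := by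
    linear_combination (M.sh a h - h * r₂ a * (-u - x a - 2 * η)) * hr₁ a ha
      + (M.sh a h * r₁ a * (u - x a + 2 * η) - h) * hr₂ a ha + r₁ a * r₂ a * hh a ha
  linear_combination ((u - v) * (u + v) * r a * f a) * e₃ +
    2 * η * (u + v) * f a * M.sh a h * e₁ - 2 * η * (u - v) * f a * h * e₂

theorem comm_op_mono (s : Finset S) (c : S) {r f : S → F} {t g : F}
    (ht : ∀ a ∈ s, M.sh a t = t) (hr : ∀ a ∈ s, M.sh c (r a) = r a) :
    comm (M.op s r f) (M.ι (t * g) * M.T c) = ∑ b ∈ s,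
      M.ι (t * (r b * (f b * M.sh b g - g * M.sh c (f b)))) * (M.T b * M.T c) := by
  rw [comm, op, Finset.sum_mul, Finset.mul_sum, ← Finset.sum_sub_distrib]
  refine Finset.sum_congr rfl fun b hb => ?_
  rw [M.mono_mul, M.mono_mul, M.T_comm c b, ← sub_mul, ← map_sub, map_mul, map_mul, ht b hb,
    hr b hb]
  congr 2
  ring

/-- The outer commutator of the Serre relation: all terms are ordered as T_a T_b T_c, so only the
accumulated shifts of the coefficients differ. -/
theorem comm_op_sum (s : Finset S) (c : S) {r f h : S → F} :
    comm (M.op s r f) (∑ b ∈ s, M.ι (h b) * (M.T b * M.T c)) = ∑ a ∈ s, ∑ b ∈ s,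
      M.ι (r a * f a * M.sh a (h b) - h b * M.sh b (M.sh c (r a * f a))) *
        (M.T a * M.T b * M.T c) := by
  rw [comm, op, Finset.sum_mul_sum, Finset.sum_mul_sum, Finset.sum_comm (s := s) (t := s)
    (f := fun i j => M.ι (h i) * (M.T i * M.T c) * (M.ι (r j * f j) * M.T j)),
    ← Finset.sum_sub_distrib]
  refine Finset.sum_congr rfl fun a _ => ?_
  rw [← Finset.sum_sub_distrib]
  refine Finset.sum_congr rfl fun b _ => ?_
  have e : M.ι (h b) * (M.T b * M.T c) * (M.ι (r a * f a) * M.T a) =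
      M.ι (h b * M.sh b (M.sh c (r a * f a))) * (M.T a * M.T b * M.T c) := by
    calc M.ι (h b) * (M.T b * M.T c) * (M.ι (r a * f a) * M.T a)
        = M.ι (h b) * (M.T b * (M.T c * M.ι (r a * f a)) * M.T a) := by simp only [mul_assoc]
      _ = M.ι (h b) * (M.T b * M.ι (M.sh c (r a * f a)) * (M.T c * M.T a)) := by
          rw [M.T_mul]; simp only [mul_assoc]
      _ = M.ι (h b) * M.ι (M.sh b (M.sh c (r a * f a))) * (M.T b * (M.T a * M.T c)) := by
          rw [M.T_mul, M.T_comm c a]; simp only [mul_assoc]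
      _ = _ := by rw [← map_mul, ← mul_assoc (M.T b), M.T_comm b a]
  rw [M.mono_mul, e, ← mul_assoc (M.T a), ← sub_mul, ← map_sub]

/-- The inner commutator has coefficients -ħ q_b by `hq`. In the outer one the diagonal vanishes by
`hqa`, generic pairs cancel by `hqb`, and for b = bar a the product T_a T_b T_c collapses to T_c.
This is why a double commutator is linear in the shifts of the neighbouring node. -/
theorem serre_op [DecidableEq S] {s : Finset S} (hs : ∀ a ∈ s, M.bar a ∈ s) (c : S)
    {x f q r₁ r₂ R₁ R₂ w : S → F} {u₁ u₂ t g η : F}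
    (hu₁ : ∀ a, M.sh a u₁ = u₁) (hu₂ : ∀ a, M.sh a u₂ = u₂)
    (ht : ∀ a ∈ s, M.sh a t = t)
    (hη : η = algebraMap Base F (halfHbar 1))
    (hr₁ : ∀ a ∈ s, (u₁ - x a) * r₁ a = 1) (hr₂ : ∀ a ∈ s, (u₂ - x a) * r₂ a = 1)
    (hR₁ : ∀ a ∈ s, (u₁ ^ 2 - x a ^ 2) * R₁ a = 1) (hR₂ : ∀ a ∈ s, (u₂ ^ 2 - x a ^ 2) * R₂ a = 1)
    (hx : ∀ a ∈ s, M.sh a (x a) = x a - 2 * η) (hxbar : ∀ a ∈ s, x (M.bar a) = -x a - 2 * η)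
    (hxx : ∀ a ∈ s, ∀ b ∈ s, b ≠ a → b ≠ M.bar a → M.sh a (x b) = x b)
    (hxc : ∀ a ∈ s, M.sh c (x a) = x a)
    (hq : ∀ a ∈ s, f a * M.sh a g - g * M.sh c (f a) = -(2 * η * q a))
    (hqa : ∀ a ∈ s, f a * M.sh a (q a) = q a * M.sh a (M.sh c (f a)))
    (hqb : ∀ a ∈ s, ∀ b ∈ s, b ≠ a → b ≠ M.bar a →
      f a * M.sh a (q b) - q b * M.sh b (M.sh c (f a)) +
        (f b * M.sh b (q a) - q a * M.sh a (M.sh c (f b))) = 0)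
    (hqbar : ∀ a ∈ s, f a * M.sh a (q (M.bar a)) - q a * M.sh a (M.sh c (f (M.bar a))) =
      -((2 * x a - 2 * η) * w a)) :
    M.ι (u₁ + u₂) *
      (comm (M.op s r₁ f) (comm (M.op s r₂ f) (M.ι (t * g) * M.T c)) +
        comm (M.op s r₂ f) (comm (M.op s r₁ f) (M.ι (t * g) * M.T c))) =
    M.ι (4 * η * t * ∑ a ∈ s, (u₁ * R₁ a + u₂ * R₂ a) * ((2 * x a - 2 * η) * w a)) * M.T c := by
  have hshη : ∀ a, M.sh a η = η := fun a => by rw [hη, AlgHom.commutes]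
  have hc₁ : ∀ a ∈ s, M.sh c (r₁ a) = r₁ a := fun a ha =>
    M.sh_inv_fixed (hr₁ a ha) (by rw [map_sub, hu₁, hxc a ha])
  have hc₂ : ∀ a ∈ s, M.sh c (r₂ a) = r₂ a := fun a ha =>
    M.sh_inv_fixed (hr₂ a ha) (by rw [map_sub, hu₂, hxc a ha])
  have inner : ∀ r : S → F, (∀ a ∈ s, M.sh c (r a) = r a) →
      comm (M.op s r f) (M.ι (t * g) * M.T c) =
        ∑ b ∈ s, M.ι (t * (r b * -(2 * η * q b))) * (M.T b * M.T c) := fun r hr => by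
    rw [comm_op_mono s c ht hr]
    exact Finset.sum_congr rfl fun b hb => by rw [hq b hb]
  rw [inner r₁ hc₁, inner r₂ hc₂, comm_op_sum, comm_op_sum, ← Finset.sum_add_distrib,
    Finset.mul_sum]
  have key : ∀ a ∈ s, M.ι (u₁ + u₂) *
      (∑ b ∈ s, M.ι (r₁ a * f a * M.sh a (t * (r₂ b * -(2 * η * q b))) -
          t * (r₂ b * -(2 * η * q b)) * M.sh b (M.sh c (r₁ a * f a))) *
            (M.T a * M.T b * M.T c) +
        ∑ b ∈ s, M.ι (r₂ a * f a * M.sh a (t * (r₁ b * -(2 * η * q b))) -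
          t * (r₁ b * -(2 * η * q b)) * M.sh b (M.sh c (r₂ a * f a))) *
            (M.T a * M.T b * M.T c)) =
      ∑ b ∈ s, M.ι (-(2 * η * t * (u₁ + u₂)) *
        ((r₁ a * M.sh a (r₂ b) + r₂ a * M.sh a (r₁ b)) * (f a * M.sh a (q b)) -
          (r₂ b * M.sh b (r₁ a) + r₁ b * M.sh b (r₂ a)) * (q b * M.sh b (M.sh c (f a))))) *
        (M.T a * M.T b * M.T c) := fun a ha => by
    rw [← Finset.sum_add_distrib, Finset.mul_sum]
    refine Finset.sum_congr rfl fun b hb => ?_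
    rw [← add_mul, ← map_add, ← mul_assoc, ← map_mul]
    congr 2
    simp only [map_mul, map_neg, map_ofNat, hshη, ht a ha, hc₁ a ha, hc₂ a ha]
    ring
  rw [Finset.sum_congr rfl key, sum_pairs hs]
  -- With k_i = 1/(u_i - x) and p_i = 1/(u_i + x), multiplication of k₁p₂ + k₂p₁ by u₁ + u₂ gives k₁
  -- + p₂ + k₂ + p₁. Regrouped as (k₁ + p₁) + (k₂ + p₂), this separates the two variables.
  · have U : ∀ a ∈ s, (u₁ + u₂) * (r₁ a * M.sh a (r₂ (M.bar a)) + r₂ a * M.sh a (r₁ (M.bar a)))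
        = 2 * (u₁ * R₁ a + u₂ * R₂ a) := fun a ha => by
      have e : M.sh a (x (M.bar a)) = -x a := by
        rw [hxbar a ha]; simp only [map_sub, map_neg, map_mul, map_ofNat, hshη, hx a ha]; ring
      have h1 := M.sh_inv (a := a) (hr₁ _ (hs a ha))
      have h2 := M.sh_inv (a := a) (hr₂ _ (hs a ha))
      rw [map_sub, hu₁, e] at h1
      rw [map_sub, hu₂, e] at h2
      have e1 : R₁ a = r₁ a * M.sh a (r₁ (M.bar a)) := by
        linear_combination -(R₁ a * (u₁ + x a) * M.sh a (r₁ (M.bar a))) * hr₁ a ha - R₁ a * h1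
          + r₁ a * M.sh a (r₁ (M.bar a)) * hR₁ a ha
      have e2 : R₂ a = r₂ a * M.sh a (r₂ (M.bar a)) := by
        linear_combination -(R₂ a * (u₂ + x a) * M.sh a (r₂ (M.bar a))) * hr₂ a ha - R₂ a * h2
          + r₂ a * M.sh a (r₂ (M.bar a)) * hR₂ a ha
      rw [e1, e2]
      generalize M.sh a (r₁ (M.bar a)) = p₁ at *
      generalize M.sh a (r₂ (M.bar a)) = p₂ at *
      have h3 := hr₁ a ha
      have h4 := hr₂ a ha
      generalize r₁ a = k₁ at *
      generalize r₂ a = k₂ at *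
      have i1 : k₁ + p₁ = 2 * u₁ * (k₁ * p₁) := by linear_combination -p₁ * h3 - k₁ * h1
      have i2 : k₂ + p₂ = 2 * u₂ * (k₂ * p₂) := by linear_combination -p₂ * h4 - k₂ * h2
      have i3 : k₁ - k₂ = (u₂ - u₁) * (k₁ * k₂) := by linear_combination k₂ * h3 - k₁ * h4
      have i4 : k₁ + p₂ = (u₁ + u₂) * (k₁ * p₂) := by linear_combination -p₂ * h3 - k₁ * h2
      have i5 : k₂ + p₁ = (u₁ + u₂) * (k₂ * p₁) := by linear_combination -p₁ * h4 - k₂ * h1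
      linear_combination i1 + i2 - i4 - i5
    have hsum : ∀ a ∈ s, M.ι (-(2 * η * t * (u₁ + u₂)) *
        ((r₁ a * M.sh a (r₂ (M.bar a)) + r₂ a * M.sh a (r₁ (M.bar a))) *
            (f a * M.sh a (q (M.bar a))) -
          (r₂ (M.bar a) * M.sh (M.bar a) (r₁ a) + r₁ (M.bar a) * M.sh (M.bar a) (r₂ a)) *
            (q (M.bar a) * M.sh (M.bar a) (M.sh c (f a))))) * (M.T a * M.T (M.bar a) * M.T c) =
        M.ι (-(4 * η * t) * ((u₁ * R₁ a + u₂ * R₂ a) * (f a * M.sh a (q (M.bar a))))) * M.T c +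
        M.ι (4 * η * t * ((u₁ * R₁ (M.bar a) + u₂ * R₂ (M.bar a)) *
          (q (M.bar a) * M.sh (M.bar a) (M.sh c (f (M.bar (M.bar a))))))) * M.T c :=
        fun a ha => by
      rw [M.T_bar, one_mul, ← add_mul, ← map_add]
      congr 2
      have U1 := U a ha
      have U2 := U _ (hs a ha)
      rw [M.bar_bar] at U2
      rw [M.bar_bar]
      linear_combination -(2 * η * t) * (f a * M.sh a (q (M.bar a))) * U1 +
        (2 * η * t) * (q (M.bar a) * M.sh (M.bar a) (M.sh c (f a))) * U2
    rw [Finset.sum_congr rfl hsum, Finset.sum_add_distrib]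
    -- The two halves of the commutator carry the resolvents of a and of bar a. Reindexing the
    -- second half by a ↦ bar a gives both the same factor, and `hqbar` then applies.
    have reindex : ∀ G : S → A, ∑ a ∈ s, G (M.bar a) = ∑ a ∈ s, G a := fun G =>
      Finset.sum_nbij' M.bar M.bar hs hs (fun a _ => M.bar_bar a) (fun a _ => M.bar_bar a)
        fun _ _ => rfl
    rw [reindex fun a => M.ι (4 * η * t * ((u₁ * R₁ a + u₂ * R₂ a) *
          (q a * M.sh a (M.sh c (f (M.bar a)))))) * M.T c, ← Finset.sum_add_distrib,
      Finset.mul_sum, map_sum, Finset.sum_mul]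
    refine Finset.sum_congr rfl fun a ha => ?_
    rw [← add_mul, ← map_add]
    congr 2
    linear_combination -(4 * η * t) * (u₁ * R₁ a + u₂ * R₂ a) * hqbar a ha
  · intro a ha
    rw [hqa a ha, sub_eq_zero.2 (by ring), mul_zero, map_zero, zero_mul]
  · intro a ha b hb hab hab'
    have hba' : a ≠ M.bar b := fun h => hab' (by rw [h, M.bar_bar])
    rw [M.T_comm b a, ← add_mul, ← map_add]
    have e1 := hxx a ha b hb hab hab'
    have e2 := hxx b hb a ha (Ne.symm hab) hba'
    rw [M.sh_inv_fixed (hr₁ b hb) (by rw [map_sub, hu₁, e1]),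
      M.sh_inv_fixed (hr₂ b hb) (by rw [map_sub, hu₂, e1]),
      M.sh_inv_fixed (hr₁ a ha) (by rw [map_sub, hu₁, e2]),
      M.sh_inv_fixed (hr₂ a ha) (by rw [map_sub, hu₂, e2])]
    rw [show (_ : F) + _ = 0 by
      linear_combination (-(2 * η * t * (u₁ + u₂)) * (r₁ a * r₂ b + r₂ a * r₁ b)) *
        hqb a ha b hb hab hab', map_zero, zero_mul]

end ShiftSystem

/-! ## Functions of the variables `γ` -/

/-- The sign attached to a signed index: `1` for `β⁻¹` and `-1` for `β`. -/
def sgn (σ : Bool) : ℤ := if σ then 1 else -1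

/-- A commutative ring of functions of the variables `γ` with the shift operators acting on it,
satisfying the relations of the extended algebra of difference operators. -/
structure Model {n : ℕ} (m : Fin n → ℕ) (R : Fin n → Polynomial Base) (F A : Type*)
    [CommRing F] [Algebra Base F] [Ring A] [Algebra Base A]
    extends ShiftSystem (Idx m × Bool) F A where
  fn : DGen m → F
  bar_eq : ∀ a, bar a = (a.1, !a.2)
  isUnit_hbar : IsUnit (algebraMap Base F hbar)
  invQuad_mul : ∀ p q h hne a c, fn (.invQuad p q h hne a c) *
    ((fn (.gam p) + algebraMap Base F (halfHbar (2 * a))) ^ 2 -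
      (fn (.gam q) + algebraMap Base F (halfHbar (2 * c))) ^ 2) = 1
  invLin_mul : ∀ p a, fn (.invLin p a) * (fn (.gam p) + algebraMap Base F (halfHbar a)) = 1
  sqrtSub_sq : ∀ p q h a, fn (.sqrtSub p q h a) ^ 2 =
    fn (.gam p) - fn (.gam q) + algebraMap Base F (halfHbar a)
  sqrtAdd_sq : ∀ p q h a, fn (.sqrtAdd p q h a) ^ 2 =
    fn (.gam p) + fn (.gam q) + algebraMap Base F (halfHbar a)
  sqrtR_sq : ∀ p a, fn (.sqrtR p a) ^ 2 =
    Polynomial.aeval (fn (.gam p) + algebraMap Base F (halfHbar (2 * a))) (R p.1)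
  sh_gam : ∀ a q, sh a (fn (.gam q)) =
    fn (.gam q) - algebraMap Base F (halfHbar (2 * (sgn a.2 * dlt a.1 q)))
  sh_sqrtSub : ∀ a p q h k, sh a (fn (.sqrtSub p q h k)) =
    fn (.sqrtSub p q h (k - 2 * (sgn a.2 * (dlt a.1 p - dlt a.1 q))))
  sh_sqrtAdd : ∀ a p q h k, sh a (fn (.sqrtAdd p q h k)) =
    fn (.sqrtAdd p q h (k - 2 * (sgn a.2 * (dlt a.1 p + dlt a.1 q))))
  sh_sqrtR : ∀ a p k, sh a (fn (.sqrtR p k)) = fn (.sqrtR p (k - sgn a.2 * dlt a.1 p))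

namespace Model

variable {n : ℕ} {m : Fin n → ℕ} {R : Fin n → Polynomial Base} {F A : Type*}
  [CommRing F] [Algebra Base F] [Ring A] [Algebra Base A] (M : Model m R F A)

/-- `ħ / 2`. -/
def eta (_ : Model m R F A) : F := algebraMap Base F (halfHbar 1)

theorem sh_eta (a : Idx m × Bool) : M.sh a M.eta = M.eta := AlgHom.commutes _ _

/-- `γ_p`. -/
def gam (p : Idx m) : F := M.fn (.gam p)

theorem dlt_self (p : Idx m) : dlt p p = 1 := if_pos rfl

theorem dlt_ne {p q : Idx m} (h : p ≠ q) : dlt p q = 0 := if_neg h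

theorem sh_gam_self (p : Idx m) (σ : Bool) :
    M.sh (p, σ) (M.gam p) = M.gam p - 2 * sgn σ * M.eta := by
  rw [gam, M.sh_gam, dlt_self, algebraMap_halfHbar, eta]; push_cast; ring

theorem sh_gam_ne {a : Idx m × Bool} {q : Idx m} (h : a.1 ≠ q) : M.sh a (M.gam q) = M.gam q := by
  rw [gam, M.sh_gam, dlt_ne h, algebraMap_halfHbar]; simp

/-- The poles of the current: `γ_p` and `-γ_p - ħ`. -/
def x (a : Idx m × Bool) : F := if a.2 then M.gam a.1 else -M.gam a.1 - 2 * M.eta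

@[simp] theorem x_true (p : Idx m) : M.x (p, true) = M.gam p := rfl
@[simp] theorem x_false (p : Idx m) : M.x (p, false) = -M.gam p - 2 * M.eta := rfl

theorem x_bar (a : Idx m × Bool) : M.x (M.bar a) = -M.x a - 2 * M.eta := by
  rw [M.bar_eq]
  rcases a with ⟨p, _ | _⟩ <;> simp

theorem sh_x_self (a : Idx m × Bool) : M.sh a (M.x a) = M.x a - 2 * M.eta := by
  rcases a with ⟨p, _ | _⟩
  · simp only [x_false, map_sub, map_neg, map_mul, map_ofNat, sh_gam_self, sh_eta, sgn]
    simp; ring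
  · simp only [x_true, sh_gam_self, sgn]
    simp

theorem sh_x_ne {a b : Idx m × Bool} (h : a.1 ≠ b.1) : M.sh a (M.x b) = M.x b := by
  rcases b with ⟨q, _ | _⟩
  · simp only [x_false, map_sub, map_neg, map_mul, map_ofNat, sh_gam_ne M h, sh_eta]
  · simp only [x_true, sh_gam_ne M h]

theorem sh_x_bar (a : Idx m × Bool) : M.sh a (M.x (M.bar a)) = -M.x a := by
  rw [M.x_bar]
  simp only [map_sub, map_neg, map_mul, map_ofNat, sh_eta, sh_x_self]; ring

theorem fst_bar (a : Idx m × Bool) : (M.bar a).1 = a.1 := by rw [M.bar_eq]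

theorem eq_or_eq_bar {a b : Idx m × Bool} (h : b.1 = a.1) : b = a ∨ b = M.bar a := by
  rw [M.bar_eq]
  rcases a with ⟨p, _ | _⟩ <;> rcases b with ⟨q, _ | _⟩ <;> simp_all

theorem fst_ne {a b : Idx m × Bool} (h : b ≠ a) (h' : b ≠ M.bar a) : a.1 ≠ b.1 := fun e =>
  (M.eq_or_eq_bar e.symm).elim h h'

/-- The two poles over a point are exchanged by reflection about -ħ/2, so only the square of the
distance to this centre is independent of the sign. -/
theorem x_bar_add (a : Idx m × Bool) : (M.x a + M.eta) ^ 2 = (M.gam a.1 + M.eta) ^ 2 := by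
  rcases a with ⟨p, _ | _⟩
  · simp; ring
  · simp

/-! ### Square roots -/

section Roots

variable (I : ℂ)

/-- The square root of `γ_p - γ_q + kħ/2` for adjacent nodes. -/
def rootSub (p q : Idx m) (k : ℤ) : F :=
  if h : (p.1 : ℕ) + 1 = q.1 then M.fn (.sqrtSub p q h k)
  else if h : (q.1 : ℕ) + 1 = p.1 then
    (Polynomial.C (-I) : Base) • M.fn (.sqrtSub q p h (-k))
  else 1

/-- The square root of `γ_p + γ_q + kħ/2` for adjacent nodes. -/
def rootAdd (p q : Idx m) (k : ℤ) : F :=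
  if h : (p.1 : ℕ) + 1 = q.1 then M.fn (.sqrtAdd p q h k)
  else if h : (q.1 : ℕ) + 1 = p.1 then M.fn (.sqrtAdd q p h k)
  else 1

theorem sh_rootSub (a : Idx m × Bool) (p q : Idx m) (k : ℤ) :
    M.sh a (M.rootSub I p q k) =
      M.rootSub I p q (k - 2 * (sgn a.2 * (dlt a.1 p - dlt a.1 q))) := by
  unfold rootSub
  split_ifs with h h'
  · rw [M.sh_sqrtSub]
  · rw [map_smul, M.sh_sqrtSub]
    congr 3
    ring
  · simp

theorem sh_rootAdd (a : Idx m × Bool) (p q : Idx m) (k : ℤ) :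
    M.sh a (M.rootAdd p q k) =
      M.rootAdd p q (k - 2 * (sgn a.2 * (dlt a.1 p + dlt a.1 q))) := by
  unfold rootAdd
  split_ifs with h h'
  · rw [M.sh_sqrtAdd]
  · rw [M.sh_sqrtAdd]
    congr 3
    ring
  · simp

/-- The chosen square root of `-1`. -/
def imag (_ : Model m R F A) : F := algebraMap Base F (Polynomial.C I)

theorem sh_imag (a : Idx m × Bool) : M.sh a (M.imag I) = M.imag I := AlgHom.commutes _ _

theorem imag_sq (hI : I ^ 2 = -1) : M.imag I ^ 2 = -1 := by
  rw [imag, ← map_pow, ← map_pow, hI, map_neg, map_neg, map_one, map_one]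

theorem rootSub_sq {p q : Idx m} (h : (p.1 : ℕ) + 1 = q.1) (k : ℤ) :
    M.rootSub I p q k ^ 2 = M.gam p - M.gam q + k * M.eta := by
  rw [rootSub, dif_pos h, M.sqrtSub_sq, algebraMap_halfHbar]; rfl

theorem rootAdd_sq {p q : Idx m} (h : (p.1 : ℕ) + 1 = q.1) (k : ℤ) :
    M.rootAdd p q k ^ 2 = M.gam p + M.gam q + k * M.eta := by
  rw [rootAdd, dif_pos h, M.sqrtAdd_sq, algebraMap_halfHbar]; rfl

/-- Solving x^{1/2} = √-1 (-x)^{1/2} for the root of -x gives the factor -√-1. -/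
theorem rootSub_symm {p q : Idx m} (h : (p.1 : ℕ) + 1 = q.1) (k : ℤ) :
    M.rootSub I q p k = -(M.imag I * M.rootSub I p q (-k)) := by
  rw [rootSub, dif_neg (by omega), dif_pos h, rootSub, dif_pos h, Algebra.smul_def, map_neg,
    map_neg, neg_mul, imag]

theorem rootAdd_symm {p q : Idx m} (h : (p.1 : ℕ) + 1 = q.1) (k : ℤ) :
    M.rootAdd q p k = M.rootAdd p q k := by
  rw [rootAdd, dif_neg (by omega), dif_pos h, rootAdd, dif_pos h]

/-- The square root of `x_a² - (γ_q + ħ/2)²` for adjacent nodes. -/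
def root (a : Idx m × Bool) (q : Idx m) : F :=
  M.rootSub I a.1 q (-sgn a.2) * M.rootAdd a.1 q (2 - sgn a.2)

theorem sh_root_ne {a b : Idx m × Bool} {q : Idx m} (h : a.1 ≠ b.1) (h' : a.1 ≠ q) :
    M.sh a (M.root I b q) = M.root I b q := by
  rw [root, map_mul, sh_rootSub, sh_rootAdd, dlt_ne h, dlt_ne h']; simp

/-- The function `q` in `f_a sh_a(f_c) = (x_a - x_c - ħ/2) q`, for `c` over the node after that
of `a`. -/
def crossAux (a c : Idx m × Bool) : F :=
  -(M.imag I * sgn a.2 * if a.2 = c.2 then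
      M.rootAdd a.1 c.1 (2 - sgn a.2) * M.rootAdd a.1 c.1 (2 - 3 * sgn a.2)
    else M.rootSub I a.1 c.1 (-sgn a.2) * M.rootSub I a.1 c.1 (-3 * sgn a.2))

/-- The function `q` in `f_a sh_a(f_c) = (x_a - x_c - ħ/2) q` for adjacent nodes. -/
def cross (a c : Idx m × Bool) : F :=
  if (a.1.1 : ℕ) + 1 = c.1.1 then M.crossAux I a c else -M.crossAux I c a

theorem sh_cross_ne {a b c : Idx m × Bool} (h : a.1 ≠ b.1) (h' : a.1 ≠ c.1) :
    M.sh a (M.cross I b c) = M.cross I b c := by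
  have e : ∀ k, M.sh a (M.rootSub I b.1 c.1 k) = M.rootSub I b.1 c.1 k := fun k => by
    rw [sh_rootSub, dlt_ne h, dlt_ne h']; simp
  have e' : ∀ k, M.sh a (M.rootAdd b.1 c.1 k) = M.rootAdd b.1 c.1 k := fun k => by
    rw [sh_rootAdd, dlt_ne h, dlt_ne h']; simp
  have e₁ : ∀ k, M.sh a (M.rootSub I c.1 b.1 k) = M.rootSub I c.1 b.1 k := fun k => by
    rw [sh_rootSub, dlt_ne h, dlt_ne h']; simp
  have e₂ : ∀ k, M.sh a (M.rootAdd c.1 b.1 k) = M.rootAdd c.1 b.1 k := fun k => by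
    rw [sh_rootAdd, dlt_ne h, dlt_ne h']; simp
  unfold cross crossAux
  split_ifs <;> simp [e, e', e₁, e₂, sh_imag]

section Pair

variable {p q : Idx m} (h : (p.1 : ℕ) + 1 = q.1)

theorem ne_of_succ {p q : Idx m} (h : (p.1 : ℕ) + 1 = q.1) : p ≠ q := fun e => by
  rw [e] at h; omega

include h

theorem sh_left_rootSub (σ : Bool) (k : ℤ) :
    M.sh (p, σ) (M.rootSub I p q k) = M.rootSub I p q (k - 2 * sgn σ) := by
  rw [sh_rootSub, dlt_self, dlt_ne (ne_of_succ h)]; simp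

theorem sh_right_rootSub (σ : Bool) (k : ℤ) :
    M.sh (q, σ) (M.rootSub I p q k) = M.rootSub I p q (k + 2 * sgn σ) := by
  rw [sh_rootSub, dlt_self, dlt_ne (ne_of_succ h).symm]; simp

theorem sh_left_rootAdd (σ : Bool) (k : ℤ) :
    M.sh (p, σ) (M.rootAdd p q k) = M.rootAdd p q (k - 2 * sgn σ) := by
  rw [sh_rootAdd, dlt_self, dlt_ne (ne_of_succ h)]; simp

theorem sh_right_rootAdd (σ : Bool) (k : ℤ) :
    M.sh (q, σ) (M.rootAdd p q k) = M.rootAdd p q (k - 2 * sgn σ) := by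
  rw [sh_rootAdd, dlt_self, dlt_ne (ne_of_succ h).symm]; simp

theorem root_right (τ : Bool) : M.root I (q, τ) p =
    -(M.imag I * M.rootSub I p q (sgn τ)) * M.rootAdd p q (2 - sgn τ) := by
  rw [root, M.rootSub_symm I h, M.rootAdd_symm h, neg_neg]

/-- For equal signs x_a - x_c is ±(γ_p - γ_q): the shift makes the two roots of differences
coincide, so they square to a linear factor, and the roots of sums survive in `crossAux`. For
opposite signs sums and differences exchange roles. All four choices of signs are checked. -/
theorem crossAux_left (hI : I ^ 2 = -1) (σ τ : Bool) :
    M.root I (p, σ) q * M.sh (p, σ) (M.root I (q, τ) p) =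
      (M.x (p, σ) - M.x (q, τ) - M.eta) * M.crossAux I (p, σ) (q, τ) ∧
    M.root I (q, τ) p * M.sh (q, τ) (M.root I (p, σ) q) =
      (M.x (p, σ) - M.x (q, τ) + M.eta) * M.crossAux I (p, σ) (q, τ) ∧
    M.root I (p, σ) q * M.sh (p, σ) (M.crossAux I (p, σ) (q, τ)) =
      M.crossAux I (p, σ) (q, τ) * M.sh (p, σ) (M.sh (q, τ) (M.root I (p, σ) q)) ∧
    M.root I (q, τ) p * M.sh (q, τ) (M.crossAux I (p, σ) (q, τ)) =
      M.crossAux I (p, σ) (q, τ) * M.sh (q, τ) (M.sh (p, σ) (M.root I (q, τ) p)) ∧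
    M.root I (p, σ) q * M.sh (p, σ) (M.root I (p, !σ) q) =
      M.x (p, σ) ^ 2 - (M.gam q + M.eta) ^ 2 ∧
    M.root I (q, τ) p * M.sh (q, τ) (M.root I (q, !τ) p) =
      M.x (q, τ) ^ 2 - (M.gam p + M.eta) ^ 2 := by
  simp only [M.root_right I h]
  simp only [root, crossAux]
  have hJ := M.imag_sq I hI
  have hD := M.rootSub_sq I h
  -- The offsets that occur are -sgn and -3 sgn for differences, 2 - sgn and 2 - 3 sgn for sums; the
  -- eight squares below cover them.
  have hP := M.rootAdd_sq h
  have hD1 := hD 1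
  have hD2 := hD (-1)
  have hP1 := hP 1
  have hD3 := hD 3
  have hD4 := hD (-3)
  have hP3 := hP 3
  have hP5 := hP 5
  have hP6 := hP (-1)
  clear hD hP
  refine ⟨?_, ?_, ?_, ?_, ?_, ?_⟩ <;> rcases σ with _ | _ <;> rcases τ with _ | _ <;>
    simp [sgn, sh_imag, M.sh_left_rootSub I h, M.sh_left_rootAdd h, M.sh_right_rootSub I h,
      M.sh_right_rootAdd h] at * <;> grind

/-- Here the shift makes one root of `crossAux` coincide with a root of the other factor. One linear
factor comes out and the remaining pair is the root of the other index. -/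
theorem crossAux_bar (hI : I ^ 2 = -1) (σ τ : Bool) :
    M.root I (p, σ) q * M.sh (p, σ) (M.crossAux I (p, !σ) (q, τ)) =
      -((M.x (p, σ) - M.x (q, τ) - M.eta) * M.root I (q, τ) p) ∧
    M.root I (q, τ) p * M.sh (q, τ) (M.crossAux I (p, σ) (q, !τ)) =
      (M.x (q, τ) - M.x (p, σ) - M.eta) * M.root I (p, σ) q ∧
    M.crossAux I (p, σ) (q, τ) * M.sh (p, σ) (M.sh (q, τ) (M.root I (p, !σ) q)) =
      (M.x (p, σ) + M.x (q, τ) - M.eta) * M.root I (q, τ) p ∧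
    M.crossAux I (p, σ) (q, τ) * M.sh (q, τ) (M.sh (p, σ) (M.root I (q, !τ) p)) =
      -((M.x (q, τ) + M.x (p, σ) - M.eta) * M.root I (p, σ) q) := by
  simp only [M.root_right I h]
  simp only [root, crossAux]
  have hJ := M.imag_sq I hI
  have hD := M.rootSub_sq I h
  have hP := M.rootAdd_sq h
  have hD1 := hD 1
  have hD2 := hD (-1)
  have hP1 := hP 1
  have hD3 := hD 3
  have hD4 := hD (-3)
  have hP3 := hP 3
  have hP5 := hP 5
  have hP6 := hP (-1)
  clear hD hP
  refine ⟨?_, ?_, ?_, ?_⟩ <;> rcases σ with _ | _ <;> rcases τ with _ | _ <;>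
    simp [sgn, sh_imag, M.sh_left_rootSub I h, M.sh_left_rootAdd h, M.sh_right_rootSub I h,
      M.sh_right_rootAdd h] at * <;> grind

end Pair

/-- The relations between the square roots attached to a pair of adjacent signed indices. -/
structure CrossRel (a c : Idx m × Bool) : Prop where
  root_sh_root : M.root I a c.1 * M.sh a (M.root I c a.1) =
    (M.x a - M.x c - M.eta) * M.cross I a c
  root_sh_root' : M.root I c a.1 * M.sh c (M.root I a c.1) =
    (M.x a - M.x c + M.eta) * M.cross I a c
  root_sh_cross : M.root I a c.1 * M.sh a (M.cross I a c) =
    M.cross I a c * M.sh a (M.sh c (M.root I a c.1))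
  root_sh_cross_bar : M.root I a c.1 * M.sh a (M.cross I (M.bar a) c) =
    -((M.x a - M.x c - M.eta) * M.root I c a.1)
  cross_sh_root_bar : M.cross I a c * M.sh a (M.sh c (M.root I (M.bar a) c.1)) =
    (M.x a + M.x c - M.eta) * M.root I c a.1
  root_sh_root_bar : M.root I a c.1 * M.sh a (M.root I (M.bar a) c.1) =
    M.x a ^ 2 - (M.gam c.1 + M.eta) ^ 2

/-- Adjacency of nodes. -/
def Adj (p q : Idx m) : Prop := |(p.1 : ℤ) - (q.1 : ℤ)| = 1

theorem Adj.cases {p q : Idx m} (h : Adj p q) :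
    (p.1 : ℕ) + 1 = q.1 ∨ (q.1 : ℕ) + 1 = p.1 := by
  unfold Adj at h
  rcases (abs_eq (by norm_num)).1 h with h | h <;> omega

theorem Adj.symm {p q : Idx m} (h : Adj p q) : Adj q p := by
  unfold Adj at *
  rwa [abs_sub_comm]

theorem Adj.fst_ne {p q : Idx m} (h : Adj p q) : p.1 ≠ q.1 := fun e => by
  rcases h.cases with h | h <;> rw [e] at h <;> omega

theorem Adj.ne {p q : Idx m} (h : Adj p q) : p ≠ q := fun e => h.fst_ne (congrArg _ e)

/-- Exchanging a and c negates `cross`, just as it negates x_a - x_c. The relations for a descending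
pair of nodes are thus those of the ascending pair, with the first two interchanged. -/
theorem crossRel (hI : I ^ 2 = -1) {a c : Idx m × Bool} (h : Adj a.1 c.1) :
    M.CrossRel I a c := by
  obtain ⟨p, σ⟩ := a
  obtain ⟨q, τ⟩ := c
  rcases h.cases with h | h
  · obtain ⟨h1, h2, h3, -, h4, -⟩ := M.crossAux_left I h hI σ τ
    obtain ⟨k1, -, k2, -⟩ := M.crossAux_bar I h hI σ τ
    constructor <;> simp only [M.bar_eq, cross, if_pos h] <;> assumption
  · have h' : ¬ (p.1 : ℕ) + 1 = q.1 := by simp only at h; omega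
    obtain ⟨h1, h2, -, h3, -, h4⟩ := M.crossAux_left I h hI τ σ
    obtain ⟨-, k1, -, k2⟩ := M.crossAux_bar I h hI τ σ
    constructor <;> simp only [M.bar_eq, cross, if_neg h', map_neg]
    · linear_combination h2
    · linear_combination h1
    · linear_combination -h3
    · linear_combination -k1
    · linear_combination -k2
    · exact h4

end Roots

end Model

namespace Model

variable {n : ℕ} {m : Fin n → ℕ} {d : Fin n → ℕ} {r : ∀ i, Fin (d i) → ℂ} {F A : Type*}
  [CommRing F] [Algebra Base F] [Ring A] [Algebra Base A] (M : Model m (Rpoly r) F A)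

/-! ### The coefficients of the currents -/

/-- The value of `R_i`. -/
def Rval (_ : Model m (Rpoly r) F A) (i : Fin n) (y : F) : F :=
  ∏ k, (y ^ 2 - algebraMap Base F (Polynomial.C (r i k ^ 2)))

theorem aeval_Rpoly (i : Fin n) (y : F) : Polynomial.aeval y (Rpoly r i) = M.Rval i y := by
  simp [Rpoly, Rval, map_prod]

/-- `R_p(γ_p)^{1/2}` or `R_p(γ_p + ħ)^{1/2}`. -/
def rt (a : Idx m × Bool) : F := M.fn (.sqrtR a.1 (if a.2 then 0 else 1))

theorem rt_sh_rt (a : Idx m × Bool) : M.rt a * M.sh a (M.rt (M.bar a)) = M.Rval a.1.1 (M.x a) := by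
  rw [M.bar_eq]
  rcases a with ⟨p, _ | _⟩
  · simp only [rt, M.sh_sqrtR, dlt_self, sgn, Bool.not_false]
    simp only [if_true, Bool.false_eq_true, if_false]
    norm_num
    -- The root is evaluated at γ + ħ while the pole is -γ - ħ; the values agree because R_i is
    -- even.
    rw [← pow_two, M.sqrtR_sq, M.aeval_Rpoly, Rval, Rval, algebraMap_halfHbar]
    refine Finset.prod_congr rfl fun k _ => ?_
    change (M.gam p + _ * M.eta) ^ 2 - _ = _
    push_cast
    ring
  · simp only [rt, M.sh_sqrtR, dlt_self, sgn, Bool.not_true]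
    simp only [if_true, Bool.false_eq_true, if_false]
    norm_num
    rw [← pow_two, M.sqrtR_sq, M.aeval_Rpoly, algebraMap_halfHbar]
    simp [gam]

theorem sh_rt_ne {a b : Idx m × Bool} (h : a.1 ≠ b.1) : M.sh a (M.rt b) = M.rt b := by
  simp only [rt, M.sh_sqrtR, dlt_ne h, mul_zero, sub_zero]

/-- `1 / (2 (γ_p - ħ/2))` or `1 / (2 (γ_p + 3ħ/2))`. -/
def lin (a : Idx m × Bool) : F :=
  (Polynomial.C (1 / 2) : Base) • M.fn (.invLin a.1 (if a.2 then -1 else 3))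

/-- The denominators 2(γ - ħ/2) and 2(γ + 3ħ/2) are both 2x_a - ħ up to the sign of the index. This
gives a uniform treatment of ϰ and ϰ'. -/
theorem lin_mul (a : Idx m × Bool) : (2 * M.x a - 2 * M.eta) * M.lin a = sgn a.2 := by
  have h2 : (2 : F) * algebraMap Base F (Polynomial.C (1 / 2)) = 1 := by
    rw [← map_ofNat (algebraMap Base F) 2, ← map_mul,
      show (OfNat.ofNat 2 : Base) = Polynomial.C 2 from rfl, ← Polynomial.C_mul]
    norm_num
  have h := M.invLin_mul a.1 (if a.2 then -1 else 3)
  rw [algebraMap_halfHbar] at h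
  change _ * (M.gam a.1 + _ * M.eta) = 1 at h
  rw [lin, Algebra.smul_def]
  rcases a with ⟨p, _ | _⟩
  · simp [sgn] at *
    linear_combination -h - M.fn (.invLin p 3) * (M.gam p + 3 * M.eta) * h2
  · simp [sgn] at *
    linear_combination h + M.fn (.invLin p (-1)) * (M.gam p - M.eta) * h2

theorem sgn_mul_self (σ : Bool) : (sgn σ : F) * sgn σ = 1 := by
  rcases σ with _ | _ <;> simp [sgn]

theorem sgn_not (σ : Bool) : sgn (!σ) = -sgn σ := by
  rcases σ with _ | _ <;> simp [sgn]

/-- The shift turns 2x_{bar a} - ħ into -(2x_a + ħ), and this sign is compensated by the opposite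
signs of a and bar a. -/
theorem lin_sh_lin (a : Idx m × Bool) :
    (2 * M.x a - 2 * M.eta) * (2 * M.x a + 2 * M.eta) * (M.lin a * M.sh a (M.lin (M.bar a))) = 1 := by
  have h1 := M.lin_mul a
  have h2 := congrArg (M.sh a) (M.lin_mul (M.bar a))
  simp only [map_mul, map_sub, map_ofNat, M.sh_x_bar, M.sh_eta, map_intCast] at h2
  rw [M.bar_eq, sgn_not, ← M.bar_eq] at h2
  push_cast at h2
  have h3 := sgn_mul_self (F := F) a.2
  linear_combination (2 * M.x a + 2 * M.eta) * M.sh a (M.lin (M.bar a)) * h1 - sgn a.2 * h2 + h3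

theorem sh_lin_ne {a b : Idx m × Bool} (h : a.1 ≠ b.1) : M.sh a (M.lin b) = M.lin b := by
  have h1 := M.lin_mul b
  have h4 := sgn_mul_self (F := F) b.2
  have h5 : (sgn b.2 * (2 * M.x b - 2 * M.eta)) * M.lin b = 1 := by
    linear_combination sgn b.2 * h1 + h4
  exact M.sh_inv_fixed h5 (by
    simp only [map_mul, map_sub, map_intCast, map_ofNat, M.sh_x_ne h, M.sh_eta])

/-- `1 / (γ_p² - γ_q²)` or `1 / ((γ_p + ħ)² - (γ_q + ħ)²)`. -/
def quad (a : Idx m × Bool) (q : Idx m) : F :=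
  if h : a.1.1 = q.1 ∧ a.1 ≠ q then
    M.fn (.invQuad a.1 q h.1 h.2 (if a.2 then 0 else 1) (if a.2 then 0 else 1)) else 1

theorem quad_mul {a : Idx m × Bool} {q : Idx m} (h : a.1.1 = q.1) (h' : a.1 ≠ q) :
    (M.x a ^ 2 - M.x (q, a.2) ^ 2) * M.quad a q = 1 := by
  rw [quad, dif_pos ⟨h, h'⟩]
  have := M.invQuad_mul a.1 q h h' (if a.2 then 0 else 1) (if a.2 then 0 else 1)
  rw [algebraMap_halfHbar] at this
  change _ * ((M.gam a.1 + _ * M.eta) ^ 2 - (M.gam q + _ * M.eta) ^ 2) = 1 at this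
  rcases a with ⟨p, _ | _⟩
  · simp at *
    linear_combination this
  · simp at *
    linear_combination this

theorem sh_quad_ne {a b : Idx m × Bool} {q : Idx m} (h : a.1 ≠ b.1) (h' : a.1 ≠ q) :
    M.sh a (M.quad b q) = M.quad b q := by
  by_cases hq : b.1.1 = q.1 ∧ b.1 ≠ q
  · refine M.sh_inv_fixed (M.quad_mul hq.1 hq.2) ?_
    rw [map_sub, map_pow, map_pow, M.sh_x_ne h, M.sh_x_ne (b := (q, b.2)) h']
  · rw [quad, dif_neg hq, map_one]

/-- The unshifted factor compares x_a with the pole over q of the same sign. The shifted one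
compares -x_a with the pole of the other sign, so the product sees both. -/
theorem quad_sh_quad {a : Idx m × Bool} {q : Idx m} (h : a.1.1 = q.1) (h' : a.1 ≠ q) :
    ((M.x a ^ 2 - M.x (q, true) ^ 2) * (M.x a ^ 2 - M.x (q, false) ^ 2)) *
      (M.quad a q * M.sh a (M.quad (M.bar a) q)) = 1 := by
  have h1 := M.quad_mul h h'
  have h2 := M.quad_mul (a := M.bar a) (q := q) (by rw [M.fst_bar]; exact h)
    (by rw [M.fst_bar]; exact h')
  have h3 := M.sh_inv (a := a) h2
  rw [map_sub, map_pow, map_pow, M.sh_x_bar, M.sh_x_ne (b := (q, _)) h'] at h3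
  have e : (M.x a ^ 2 - M.x (q, true) ^ 2) * (M.x a ^ 2 - M.x (q, false) ^ 2) =
      (M.x a ^ 2 - M.x (q, a.2) ^ 2) * ((-M.x a) ^ 2 - M.x (q, (M.bar a).2) ^ 2) := by
    rw [M.bar_eq]
    rcases a with ⟨p, _ | _⟩ <;> simp <;> ring
  rw [e]
  linear_combination ((-M.x a) ^ 2 - M.x (q, (M.bar a).2) ^ 2) * M.sh a (M.quad (M.bar a) q) * h1
    + h3

/-- On each side the linear factor x_a - x_b ∓ ħ cancels against a factor of one denominator, and
the same fraction remains. -/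
theorem quad_star {a b : Idx m × Bool} (h : a.1.1 = b.1.1) (h' : a.1 ≠ b.1) :
    (M.x a - M.x b - 2 * M.eta) * (M.quad a b.1 * M.sh a (M.quad b a.1)) =
      (M.x a - M.x b + 2 * M.eta) * (M.quad b a.1 * M.sh b (M.quad a b.1)) := by
  have h1 := M.quad_mul h h'
  have h2 := M.quad_mul h.symm h'.symm
  have h3 := M.sh_inv (a := b) h1
  have h4 := M.sh_inv (a := a) h2
  rw [map_sub, map_pow, map_pow, M.sh_x_ne h'.symm] at h3
  rw [map_sub, map_pow, map_pow, M.sh_x_ne h'] at h4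
  have ha : a = (a.1, a.2) := rfl
  have hb : b = (b.1, b.2) := rfl
  by_cases hs : a.2 = b.2
  · rw [hs] at h1 h3
    rw [← hs] at h2 h4
    rw [← ha, M.sh_x_self] at h4
    rw [← hb, M.sh_x_self] at h3
    rw [← ha] at h2
    rw [← hb] at h1
    generalize M.quad a b.1 = k₁ at *
    generalize M.quad b a.1 = k₂ at *
    generalize M.sh b k₁ = k₃ at *
    generalize M.sh a k₂ = k₄ at *
    generalize M.x a = X at *
    generalize M.x b = Y at *
    generalize M.eta = e at *
    linear_combination (-(X - Y - 2 * e) * k₁ * k₄ * (Y ^ 2 - X ^ 2) * k₂) * h3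
      - (X - Y - 2 * e) * k₁ * k₄ * h2
      + ((X - Y + 2 * e) * k₂ * k₃ * (X ^ 2 - Y ^ 2) * k₁) * h4
      + (X - Y + 2 * e) * k₂ * k₃ * h1
  -- For opposite signs the point of b with the sign of a is bar b. Its pole is -x_b - ħ before the
  -- shift and -x_b after it.
  · have hbb : (b.1, a.2) = M.bar b := by rw [M.bar_eq]; ext <;> simp; grind
    have haa : (a.1, b.2) = M.bar a := by rw [M.bar_eq]; ext <;> simp; grind
    rw [hbb] at h1 h3
    rw [haa] at h2 h4
    rw [M.sh_x_bar] at h3 h4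
    rw [M.x_bar] at h1 h2
    generalize M.quad a b.1 = k₁ at *
    generalize M.quad b a.1 = k₂ at *
    generalize M.sh b k₁ = k₃ at *
    generalize M.sh a k₂ = k₄ at *
    generalize M.x a = X at *
    generalize M.x b = Y at *
    generalize M.eta = e at *
    linear_combination (-(X - Y - 2 * e) * k₁ * k₄ * (Y ^ 2 - (-X - 2 * e) ^ 2) * k₂) * h3
      - (X - Y - 2 * e) * k₁ * k₄ * h2
      + ((X - Y + 2 * e) * k₂ * k₃ * (X ^ 2 - (-Y - 2 * e) ^ 2) * k₁) * h4
      + (X - Y + 2 * e) * k₂ * k₃ * h1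

/-- The other indices over the node of `p`. -/
def others (p : Idx m) : Finset (Idx m) := Finset.univ.filter fun q => p.1 = q.1 ∧ p ≠ q

theorem mem_others {p q : Idx m} : q ∈ others p ↔ p.1 = q.1 ∧ p ≠ q := by simp [others]

variable (I : ℂ)

/-- The coefficient of the shift `T_a` in the current, with the square roots attached to `Q`. -/
def coef (Q : Finset (Idx m)) (a : Idx m × Bool) : F :=
  M.rt a * (∏ q ∈ Q, M.root I a q) * M.lin a * ∏ q ∈ others a.1, M.quad a q

theorem coef_eq_root_mul {Q : Finset (Idx m)} {q : Idx m} (h : q ∈ Q) (a : Idx m × Bool) :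
    M.coef I Q a = M.root I a q * M.coef I (Q.erase q) a := by
  rw [coef, coef, ← Finset.mul_prod_erase _ _ h]; ring

/-- A shift over another node acts on this coefficient only through square roots. The set Q is a
parameter so that the root towards a given neighbour can be split off, leaving a fixed factor. -/
theorem sh_coef {Q : Finset (Idx m)} {a c : Idx m × Bool} (h : c.1.1 ≠ a.1.1) (h' : c.1 ∉ Q) :
    M.sh c (M.coef I Q a) = M.coef I Q a := by
  have hne : c.1 ≠ a.1 := fun e => h (congrArg _ e)
  rw [coef, map_mul, map_mul, map_mul, M.sh_rt_ne hne, M.sh_lin_ne hne, map_prod, map_prod]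
  congr 1
  · congr 2
    exact Finset.prod_congr rfl fun q hq => M.sh_root_ne I hne fun e => h' (e ▸ hq)
  · exact Finset.prod_congr rfl fun q hq => M.sh_quad_ne hne fun e =>
      h (by rw [e]; exact (mem_others.1 hq).1.symm)

/-- Apart from the one quadratic denominator joining a and b, each coefficient is fixed by the shift
of the other index. The exchange relation therefore reduces to `quad_star`. -/
theorem coef_star {Q Q' : Finset (Idx m)} {a b : Idx m × Bool} (h : a.1.1 = b.1.1)
    (h' : a.1 ≠ b.1) (hQ : b.1 ∉ Q) (hQ' : a.1 ∉ Q') :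
    (M.x a - M.x b - 2 * M.eta) * (M.coef I Q a * M.sh a (M.coef I Q' b)) =
      (M.x a - M.x b + 2 * M.eta) * (M.coef I Q' b * M.sh b (M.coef I Q a)) := by
  have key : ∀ {Q : Finset (Idx m)} {a b : Idx m × Bool}, a.1.1 = b.1.1 → a.1 ≠ b.1 → b.1 ∉ Q →
      ∃ g, M.coef I Q a = M.quad a b.1 * g ∧ M.sh b g = g := by
    intro Q a b h h' hQ
    refine ⟨M.rt a * (∏ q ∈ Q, M.root I a q) * M.lin a *
      ∏ q ∈ (others a.1).erase b.1, M.quad a q, ?_, ?_⟩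
    · rw [coef, ← Finset.mul_prod_erase _ _ (mem_others.2 ⟨h, h'⟩)]; ring
    · rw [map_mul, map_mul, map_mul, M.sh_rt_ne h'.symm, M.sh_lin_ne h'.symm, map_prod, map_prod]
      congr 1
      · congr 2
        exact Finset.prod_congr rfl fun q hq => M.sh_root_ne I h'.symm fun e => hQ (e ▸ hq)
      · exact Finset.prod_congr rfl fun q hq => M.sh_quad_ne h'.symm fun e =>
          (Finset.mem_erase.1 hq).1 e.symm
  obtain ⟨g, hg, hg'⟩ := key h h' hQ
  obtain ⟨k, hk, hk'⟩ := key h.symm h'.symm hQ'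
  rw [hg, hk, map_mul, map_mul, hg', hk']
  linear_combination g * k * M.quad_star h h'

/-- The product `∏ (x_a² - x_b²)` over the signed indices `b` over the node of `a` other than
`a` and `bar a`. -/
def disc (a : Idx m × Bool) : F :=
  ∏ q ∈ others a.1, (M.x a ^ 2 - M.x (q, true) ^ 2) * (M.x a ^ 2 - M.x (q, false) ^ 2)

/-- All square roots meet their equals after the shift, and the product is rational. The right hand
side is the numerator of z_i at u = x_a, so this computes the residues of z_i. -/
theorem coef_sh_coef_bar (hI : I ^ 2 = -1) {Q : Finset (Idx m)} {a : Idx m × Bool}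
    (hQ : ∀ q ∈ Q, Adj a.1 q) :
    (2 * M.x a - 2 * M.eta) * (2 * M.x a + 2 * M.eta) * M.disc a *
      (M.coef I Q a * M.sh a (M.coef I Q (M.bar a))) =
    M.Rval a.1.1 (M.x a) * ∏ q ∈ Q, (M.x a ^ 2 - (M.gam q + M.eta) ^ 2) := by
  have h1 := M.rt_sh_rt a
  have h2 := M.lin_sh_lin a
  have h3 : (∏ q ∈ Q, M.root I a q) * M.sh a (∏ q ∈ Q, M.root I (M.bar a) q) =
      ∏ q ∈ Q, (M.x a ^ 2 - (M.gam q + M.eta) ^ 2) := by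
    rw [map_prod, ← Finset.prod_mul_distrib]
    exact Finset.prod_congr rfl fun q hq =>
      (M.crossRel I hI (a := a) (c := (q, true)) (hQ q hq)).root_sh_root_bar
  have h4 : M.disc a * ((∏ q ∈ others a.1, M.quad a q) *
      M.sh a (∏ q ∈ others a.1, M.quad (M.bar a) q)) = 1 := by
    rw [disc, map_prod, ← Finset.prod_mul_distrib, ← Finset.prod_mul_distrib]
    exact Finset.prod_eq_one fun q hq =>
      M.quad_sh_quad (mem_others.1 hq).1 (mem_others.1 hq).2
  rw [coef, coef, M.fst_bar, map_mul, map_mul, map_mul, ← h1, ← h3]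
  linear_combination (M.rt a * M.sh a (M.rt (M.bar a)) * ((∏ q ∈ Q, M.root I a q) *
    M.sh a (∏ q ∈ Q, M.root I (M.bar a) q))) * (M.disc a * ((∏ q ∈ others a.1, M.quad a q) *
      M.sh a (∏ q ∈ others a.1, M.quad (M.bar a) q)) * h2 + h4)

/-- The indices over the nodes adjacent to that of `p`. -/
def adj (p : Idx m) : Finset (Idx m) := Finset.univ.filter fun q => |(p.1 : ℤ) - (q.1 : ℤ)| = 1

theorem mem_adj {p q : Idx m} : q ∈ adj p ↔ Adj p q := by simp [adj, Adj]

/-- The coefficient of `T_a T_c` in `-[E_a, E_c] / ħ` for adjacent `a` and `c`. -/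
def pairCoef (a c : Idx m × Bool) : F :=
  M.cross I a c * M.coef I ((adj a.1).erase c.1) a * M.coef I ((adj c.1).erase a.1) c

/-! ### Coefficients at adjacent nodes. -/

section Adjacent

variable (hI : I ^ 2 = -1) {a c : Idx m × Bool} (h : Adj a.1 c.1)

include h in
theorem coef_adj : M.coef I (adj a.1) a = M.root I a c.1 * M.coef I ((adj a.1).erase c.1) a :=
  M.coef_eq_root_mul I (mem_adj.2 h) a

include h in
theorem sh_coef_erase :
    M.sh c (M.coef I ((adj a.1).erase c.1) a) = M.coef I ((adj a.1).erase c.1) a :=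
  M.sh_coef I h.fst_ne.symm (Finset.notMem_erase _ _)

include hI h

theorem coef_sh_coef_adj : M.coef I (adj a.1) a * M.sh a (M.coef I (adj c.1) c) =
    (M.x a - M.x c - M.eta) * M.pairCoef I a c := by
  rw [M.coef_adj I h, M.coef_adj I h.symm, map_mul, M.sh_coef_erase I h.symm, pairCoef]
  linear_combination (M.coef I ((adj a.1).erase c.1) a * M.coef I ((adj c.1).erase a.1) c) *
    (M.crossRel I hI h).root_sh_root

theorem coef_sh_coef_adj' : M.coef I (adj c.1) c * M.sh c (M.coef I (adj a.1) a) =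
    (M.x a - M.x c + M.eta) * M.pairCoef I a c := by
  rw [M.coef_adj I h, M.coef_adj I h.symm, map_mul, M.sh_coef_erase I h, pairCoef]
  linear_combination (M.coef I ((adj a.1).erase c.1) a * M.coef I ((adj c.1).erase a.1) c) *
    (M.crossRel I hI h).root_sh_root'

theorem coef_sh_pairCoef : M.coef I (adj a.1) a * M.sh a (M.pairCoef I a c) =
    M.pairCoef I a c * M.sh a (M.sh c (M.coef I (adj a.1) a)) := by
  rw [M.coef_adj I h, pairCoef, map_mul, map_mul, map_mul, map_mul, M.sh_coef_erase I h,
    M.sh_coef_erase I h.symm]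
  linear_combination (M.coef I ((adj a.1).erase c.1) a * M.coef I ((adj c.1).erase a.1) c *
    M.sh a (M.coef I ((adj a.1).erase c.1) a)) * (M.crossRel I hI h).root_sh_cross

/-- The two terms contribute x_a - x_c - η and x_a + x_c - η. In their sum x_c cancels, leaving 2x_a
- ħ. -/
theorem coef_sh_pairCoef_bar :
    M.coef I (adj a.1) a * M.sh a (M.pairCoef I (M.bar a) c) -
      M.pairCoef I a c * M.sh a (M.sh c (M.coef I (adj a.1) (M.bar a))) =
    -((2 * M.x a - 2 * M.eta) * (M.coef I ((adj a.1).erase c.1) a *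
      M.sh a (M.coef I ((adj a.1).erase c.1) (M.bar a)) * M.coef I (adj c.1) c)) := by
  have e1 : M.coef I (adj a.1) (M.bar a) =
      M.root I (M.bar a) c.1 * M.coef I ((adj a.1).erase c.1) (M.bar a) :=
    M.coef_eq_root_mul I (mem_adj.2 h) _
  have e2 : M.sh c (M.coef I ((adj a.1).erase c.1) (M.bar a)) =
      M.coef I ((adj a.1).erase c.1) (M.bar a) :=
    M.sh_coef I (by rw [M.fst_bar]; exact h.fst_ne.symm) (Finset.notMem_erase _ _)
  rw [M.coef_adj I h, e1, pairCoef, pairCoef, M.fst_bar, map_mul, map_mul, map_mul, map_mul, e2,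
    M.sh_coef_erase I h.symm, M.coef_adj I h.symm]
  linear_combination (M.coef I ((adj a.1).erase c.1) a * M.coef I ((adj c.1).erase a.1) c *
    M.sh a (M.coef I ((adj a.1).erase c.1) (M.bar a))) *
      ((M.crossRel I hI h).root_sh_cross_bar - (M.crossRel I hI h).cross_sh_root_bar)

/-- After the adjacent relations are used, each of the four terms is a common product of cross
functions times a linear factor. Collecting these leaves x_a - x_b ∓ ħ, and `coef_star` finishes. -/
theorem coef_sh_pairCoef_ne {b : Idx m × Bool} (hab : a.1.1 = b.1.1) (hne : a.1 ≠ b.1) :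
    M.coef I (adj a.1) a * M.sh a (M.pairCoef I b c) -
        M.pairCoef I b c * M.sh b (M.sh c (M.coef I (adj a.1) a)) +
      (M.coef I (adj b.1) b * M.sh b (M.pairCoef I a c) -
        M.pairCoef I a c * M.sh a (M.sh c (M.coef I (adj b.1) b))) = 0 := by
  have hb : Adj b.1 c.1 := by unfold Adj at *; rwa [← hab]
  -- In the coefficient of c the roots towards both a and b are removed below, so that neither shift
  -- acts on what is left.
  have hac : a.1 ≠ c.1 := h.ne
  have hbc : b.1 ≠ c.1 := hb.ne
  set C := M.coef I (((adj c.1).erase a.1).erase b.1) c with hC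
  have e1 : M.coef I ((adj c.1).erase a.1) c = M.root I c b.1 * C :=
    M.coef_eq_root_mul I (Finset.mem_erase.2 ⟨hne.symm, mem_adj.2 hb.symm⟩) c
  have e2 : M.coef I ((adj c.1).erase b.1) c = M.root I c a.1 * C := by
    rw [hC, Finset.erase_right_comm]
    exact M.coef_eq_root_mul I (Finset.mem_erase.2 ⟨hne, mem_adj.2 h.symm⟩) c
  have e3 : M.sh a C = C := M.sh_coef I h.fst_ne
    (fun hh => Finset.notMem_erase _ _ (Finset.mem_of_mem_erase hh))
  have e4 : M.sh b C = C := M.sh_coef I hb.fst_ne (Finset.notMem_erase _ _)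
  have star := M.coef_star I (Q := (adj a.1).erase c.1) (Q' := (adj b.1).erase c.1) hab hne
    (fun hh => (mem_adj.1 (Finset.mem_of_mem_erase hh)).fst_ne hab)
    (fun hh => (mem_adj.1 (Finset.mem_of_mem_erase hh)).fst_ne hab.symm)
  have ra := M.crossRel I hI h
  have rb := M.crossRel I hI hb
  have s1 : M.sh a (M.cross I b c) = M.cross I b c := M.sh_cross_ne I hne hac
  have s2 : M.sh b (M.cross I a c) = M.cross I a c := M.sh_cross_ne I hne.symm hbc
  have s3 : M.sh b (M.sh c (M.root I a c.1)) = M.sh c (M.root I a c.1) := by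
    rw [M.sh_comm, M.sh_root_ne I hne.symm hbc]
  have s4 : M.sh a (M.sh c (M.root I b c.1)) = M.sh c (M.root I b c.1) := by
    rw [M.sh_comm, M.sh_root_ne I hne hac]
  rw [pairCoef, pairCoef, e1, e2, M.coef_adj I h, M.coef_adj I hb]
  simp only [map_mul, e3, e4, s1, s2, s3, s4, M.sh_coef_erase I h, M.sh_coef_erase I hb]
  have t1 := ra.root_sh_root
  have t2 := ra.root_sh_root'
  have t3 := rb.root_sh_root
  have t4 := rb.root_sh_root'
  set α := M.coef I ((adj a.1).erase c.1) a * M.sh a (M.coef I ((adj b.1).erase c.1) b) with hα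
  set β := M.coef I ((adj b.1).erase c.1) b * M.sh b (M.coef I ((adj a.1).erase c.1) a) with hβ
  linear_combination (α * M.cross I b c * C) * t1 - (β * M.cross I b c * C) * t2 +
    (β * M.cross I a c * C) * t3 - (α * M.cross I a c * C) * t4 +
    M.cross I a c * M.cross I b c * C * star

end Adjacent

theorem coef_sh_coef_far {a c : Idx m × Bool} (h : a.1.1 ≠ c.1.1) (h' : ¬ Adj a.1 c.1) :
    M.coef I (adj a.1) a * M.sh a (M.coef I (adj c.1) c) =
      M.coef I (adj c.1) c * M.sh c (M.coef I (adj a.1) a) := by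
  rw [M.sh_coef I h fun hh => h' (mem_adj.1 hh).symm,
    M.sh_coef I h.symm fun hh => h' (mem_adj.1 hh), mul_comm]

end Model

/-! ## Products of linear factors -/

/-- `f = u ^ (-e) + (lower powers of u)`. -/
def LeadsWith {A : Type*} [Ring A] (e : ℤ) (f : Ser A) : Prop :=
  f.coeff e = 1 ∧ ∀ s < e, f.coeff s = 0

namespace LeadsWith

variable {A : Type*} [Ring A]

theorem one : LeadsWith 0 (1 : Ser A) :=
  ⟨by simp [HahnSeries.coeff_one], fun s hs => by simp [HahnSeries.coeff_one, hs.ne]⟩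

theorem mul {e e' : ℤ} {f g : Ser A} (hf : LeadsWith e f) (hg : LeadsWith e' g) :
    LeadsWith (e + e') (f * g) := by
  have le_of_mem : ∀ s, ∀ ij ∈ Finset.antidiagonal f.isPWO_support g.isPWO_support s,
      e ≤ ij.1 ∧ e' ≤ ij.2 ∧ ij.1 + ij.2 = s := by
    intro s ij hij
    rw [Finset.mem_antidiagonal] at hij
    refine ⟨?_, ?_, hij.2.2⟩
    · by_contra h
      exact hij.1 (hf.2 _ (not_le.1 h))
    · by_contra h
      exact hij.2.1 (hg.2 _ (not_le.1 h))
  constructor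
  · rw [HahnSeries.coeff_mul, Finset.sum_eq_single (e, e'), hf.1, hg.1, one_mul]
    · intro ij hij hne
      obtain ⟨h1, h2, h3⟩ := le_of_mem _ ij hij
      exact absurd (Prod.ext (by simp only; omega) (by simp only; omega)) hne
    · intro h
      rw [Finset.mem_antidiagonal] at h
      by_contra hne
      apply h
      refine ⟨fun h0 => hne ?_, fun h0 => hne ?_, rfl⟩
      · simp only at h0 ⊢; rw [h0, zero_mul]
      · simp only at h0 ⊢; rw [h0, mul_zero]
  · intro s hs
    rw [HahnSeries.coeff_mul]
    refine Finset.sum_eq_zero fun ij hij => ?_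
    obtain ⟨h1, h2, h3⟩ := le_of_mem _ ij hij
    omega

theorem X_sub_C (a : A) : LeadsWith (-1) (X - HahnSeries.C a : Ser A) := by
  constructor
  · simp [X, HahnSeries.C_apply]
  · intro s hs
    simp [X, HahnSeries.C_apply, hs.ne, show s ≠ 0 by omega]

theorem recip (a : A) : LeadsWith 1 (recip a) :=
  ⟨by simp, fun s hs => by simp [show ¬ 1 ≤ s by omega]⟩

end LeadsWith

/-! ### Partial fractions over a commutative ring. -/

section CommSeries

variable {F : Type*} [CommRing F]

theorem X_sq_sub_C (y : F) : (X ^ 2 - HahnSeries.C (y ^ 2) : Ser F) =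
    (X - HahnSeries.C y) * (X - HahnSeries.C (-y)) := by
  rw [map_neg, map_pow]; ring

theorem recip_mul_recip_neg (y : F) :
    (X ^ 2 - HahnSeries.C (y ^ 2)) * (recip y * recip (-y)) = 1 := by
  rw [X_sq_sub_C]
  linear_combination (X - HahnSeries.C (-y)) * recip (-y) * X_sub_C_mul_recip y +
    X_sub_C_mul_recip (-y)

/-- A series whose coefficients of negative powers of `u` vanish. -/
def IsPoly (f : Ser F) : Prop := ∀ s, 1 ≤ s → f.coeff s = 0

theorem IsPoly.add {f g : Ser F} (hf : IsPoly f) (hg : IsPoly g) : IsPoly (f + g) :=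
  fun s hs => by rw [HahnSeries.coeff_add, hf s hs, hg s hs, add_zero]

theorem IsPoly.X_mul {f : Ser F} (hf : IsPoly f) : IsPoly (X * f) :=
  fun s hs => by rw [X_mul_coeff, hf _ (by omega)]

theorem IsPoly.C_mul {f : Ser F} (a : F) (hf : IsPoly f) : IsPoly (HahnSeries.C a * f) :=
  fun s hs => by rw [C_mul_coeff, hf s hs, mul_zero]

theorem IsPoly.one : IsPoly (1 : Ser F) := fun s hs => by
  rw [HahnSeries.coeff_one, if_neg (by omega)]

theorem IsPoly.eval₂ (G : Polynomial F) : IsPoly (G.eval₂ HahnSeries.C (X ^ 2)) := by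
  induction G using Polynomial.induction_on' with
  | add p q hp hq => rw [Polynomial.eval₂_add]; exact hp.add hq
  | monomial k a =>
    rw [Polynomial.eval₂_monomial]
    refine IsPoly.C_mul a ?_
    induction k with
    | zero => simpa using IsPoly.one
    | succ k ih =>
      have h : (X ^ 2 : Ser F) ^ (k + 1) = X * (X * (X ^ 2) ^ k) := by ring
      rw [h]
      exact ih.X_mul.X_mul

theorem IsPoly.principal {f : Ser F} (h : IsPoly f) : principal f = 0 := principal_eq_zero h

theorem principal_recip_mul_recip (a b : F) : principal (recip a * recip b) = recip a * recip b :=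
  principal_eq_self fun _ hs => ((LeadsWith.recip a).mul (LeadsWith.recip b)).2 _ (by omega)

theorem principal_X_mul_recip_mul_recip (a b : F) :
    principal (X * (recip a * recip b)) = X * (recip a * recip b) :=
  principal_eq_self fun _ hs => by
    rw [X_mul_coeff]
    exact ((LeadsWith.recip a).mul (LeadsWith.recip b)).2 _ (by omega)

/-- The difference of p and the interpolating sum vanishes at each y_i. Since the y_i - y_j are
units, the factors X - y_i are pairwise coprime, and their product divides the difference. No domain
hypothesis is needed. -/
theorem exists_partial_fractions {ι : Type*} [DecidableEq ι] (s : Finset ι) (y c : ι → F)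
    (hy : ∀ i ∈ s, ∀ j ∈ s, i ≠ j → IsUnit (y i - y j)) (p : Polynomial F)
    (hc : ∀ i ∈ s, c i * ∏ j ∈ s.erase i, (y i - y j) = p.eval (y i)) :
    ∃ G : Polynomial F, p = (∏ i ∈ s, (Polynomial.X - Polynomial.C (y i))) * G +
      ∑ i ∈ s, Polynomial.C (c i) * ∏ j ∈ s.erase i, (Polynomial.X - Polynomial.C (y j)) := by
  have hdvd : (∏ i ∈ s, (Polynomial.X - Polynomial.C (y i))) ∣
      p - ∑ i ∈ s, Polynomial.C (c i) *
        ∏ j ∈ s.erase i, (Polynomial.X - Polynomial.C (y j)) := by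
    refine Finset.prod_dvd_of_coprime (fun i hi j hj hij =>
      Polynomial.isCoprime_X_sub_C_of_isUnit_sub (hy i hi j hj hij)) fun i hi => ?_
    rw [Polynomial.dvd_iff_isRoot, Polynomial.IsRoot, Polynomial.eval_sub,
      Polynomial.eval_finsetSum, Finset.sum_eq_single i]
    · rw [Polynomial.eval_mul, Polynomial.eval_C, Polynomial.eval_prod]
      simp only [Polynomial.eval_sub, Polynomial.eval_X, Polynomial.eval_C]
      rw [hc i hi, sub_self]
    · intro j _ hji
      rw [Polynomial.eval_mul, Polynomial.eval_prod,
        Finset.prod_eq_zero (Finset.mem_erase.2 ⟨hji.symm, hi⟩) (by simp), mul_zero]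
    · exact fun h => absurd hi h
  obtain ⟨G, hG⟩ := hdvd
  exact ⟨G, by rw [← hG]; ring⟩

/-- Polynomial partial fractions in the variable u², divided by the product of the u² - y_i². The
quotient polynomial evaluated at u² contributes no negative powers. -/
theorem exists_partial_fractions_series {ι : Type*} [DecidableEq ι] (s : Finset ι) (y c : ι → F)
    (hy : ∀ i ∈ s, ∀ j ∈ s, i ≠ j → IsUnit (y i ^ 2 - y j ^ 2)) (p : Polynomial F)
    (hc : ∀ i ∈ s, c i * ∏ j ∈ s.erase i, (y i ^ 2 - y j ^ 2) = p.eval (y i ^ 2)) :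
    ∃ G : Ser F, IsPoly G ∧
      p.eval₂ HahnSeries.C (X ^ 2) * ∏ i ∈ s, (recip (y i) * recip (-y i)) =
        G + ∑ i ∈ s, HahnSeries.C (c i) * (recip (y i) * recip (-y i)) := by
  obtain ⟨G, hG⟩ := exists_partial_fractions s (fun i => y i ^ 2) c hy p hc
  refine ⟨G.eval₂ HahnSeries.C (X ^ 2), IsPoly.eval₂ G, ?_⟩
  have h1 : ∀ t : Finset ι, (∏ i ∈ t, (Polynomial.X - Polynomial.C (y i ^ 2))).eval₂
      HahnSeries.C (X ^ 2) * ∏ i ∈ t, (recip (y i) * recip (-y i)) = (1 : Ser F) := by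
    intro t
    rw [Polynomial.eval₂_finsetProd, ← Finset.prod_mul_distrib]
    refine Finset.prod_eq_one fun i _ => ?_
    rw [Polynomial.eval₂_sub, Polynomial.eval₂_X, Polynomial.eval₂_C, recip_mul_recip_neg]
  conv_lhs => rw [hG]
  rw [Polynomial.eval₂_add, Polynomial.eval₂_mul, Polynomial.eval₂_finsetSum, add_mul,
    Finset.sum_mul]
  congr 1
  · linear_combination (Polynomial.eval₂ HahnSeries.C (X ^ 2) G) * h1 s
  · refine Finset.sum_congr rfl fun i hi => ?_
    rw [Polynomial.eval₂_mul, Polynomial.eval₂_C, ← Finset.mul_prod_erase s _ hi]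
    linear_combination HahnSeries.C (c i) * (recip (y i) * recip (-y i)) * h1 (s.erase i)

end CommSeries

/-! ## Invertible series -/

section Units

variable {F : Type*} [CommRing F]

/-- The invertible series `u - a`. -/
def linUnit (a : F) : (Ser F)ˣ :=
  ⟨X - HahnSeries.C a, recip a, X_sub_C_mul_recip a, recip_mul_X_sub_C a⟩

@[simp] theorem val_linUnit (a : F) : (linUnit a : Ser F) = X - HahnSeries.C a := rfl
@[simp] theorem val_inv_linUnit (a : F) : ((linUnit a)⁻¹ : (Ser F)ˣ).val = recip a := rfl

/-- The invertible series `u² - y²`. -/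
def sqUnit (y : F) : (Ser F)ˣ := linUnit y * linUnit (-y)

@[simp] theorem val_sqUnit (y : F) : (sqUnit y : Ser F) = X ^ 2 - HahnSeries.C (y ^ 2) :=
  (X_sq_sub_C y).symm

theorem val_inv_sqUnit (y : F) : ((sqUnit y)⁻¹ : (Ser F)ˣ).val = recip y * recip (-y) := by
  rw [sqUnit, mul_inv, Units.val_mul, val_inv_linUnit, val_inv_linUnit]

theorem sqUnit_neg (y : F) : sqUnit (-y) = sqUnit y := by
  rw [sqUnit, sqUnit, neg_neg, mul_comm]

/-- `f = u ^ (-e) + (lower powers of u)`, for an invertible series. -/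
def UnitLeadsWith (e : ℤ) (f : (Ser F)ˣ) : Prop :=
  LeadsWith e (f : Ser F) ∧ LeadsWith (-e) ((f⁻¹ : (Ser F)ˣ) : Ser F)

namespace UnitLeadsWith

theorem one : UnitLeadsWith 0 (1 : (Ser F)ˣ) := by
  refine ⟨LeadsWith.one, ?_⟩
  rw [inv_one, neg_zero]
  exact LeadsWith.one

theorem mul {e e' : ℤ} {f g : (Ser F)ˣ} (hf : UnitLeadsWith e f) (hg : UnitLeadsWith e' g) :
    UnitLeadsWith (e + e') (f * g) := by
  refine ⟨hf.1.mul hg.1, ?_⟩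
  rw [mul_inv, neg_add]
  exact hf.2.mul hg.2

theorem inv {e : ℤ} {f : (Ser F)ˣ} (hf : UnitLeadsWith e f) : UnitLeadsWith (-e) f⁻¹ :=
  ⟨hf.2, by rw [inv_inv, neg_neg]; exact hf.1⟩

theorem pow {e : ℤ} {f : (Ser F)ˣ} (hf : UnitLeadsWith e f) (k : ℕ) :
    UnitLeadsWith (k * e) (f ^ k) := by
  induction k with
  | zero => simpa using one
  | succ k ih =>
    rw [pow_succ]
    convert ih.mul hf using 1
    push_cast; ring

theorem prod {ι : Type*} (s : Finset ι) {e : ι → ℤ} {f : ι → (Ser F)ˣ}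
    (h : ∀ i ∈ s, UnitLeadsWith (e i) (f i)) :
    UnitLeadsWith (∑ i ∈ s, e i) (∏ i ∈ s, f i) := by
  classical
  induction s using Finset.induction_on with
  | empty => simpa using one
  | insert a s ha ih =>
    rw [Finset.sum_insert ha, Finset.prod_insert ha]
    exact (h a (Finset.mem_insert_self _ _)).mul
      (ih fun i hi => h i (Finset.mem_insert_of_mem hi))

theorem linUnit (a : F) : UnitLeadsWith (-1) (linUnit a) :=
  ⟨LeadsWith.X_sub_C a, LeadsWith.recip a⟩

end UnitLeadsWith

/-- `f(u + c) = g(u)`, in a form compatible with products. -/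
def ShiftsTo [Algebra Base F] (c : Base) (f f' : (Ser F)ˣ) : Prop :=
  ∀ g : Ser F, shift c (f.val * g) = f'.val * shift c g

namespace ShiftsTo

variable [Algebra Base F] {c : Base}

theorem shift_eq {f f' : (Ser F)ˣ} (h : ShiftsTo c f f') : shift c (f : Ser F) = f' := by
  have := h 1
  rwa [mul_one, shift_one, mul_one] at this

theorem one : ShiftsTo c (1 : (Ser F)ˣ) 1 := fun g => by rw [Units.val_one, one_mul, one_mul]

theorem mul {f f' g g' : (Ser F)ˣ} (hf : ShiftsTo c f f') (hg : ShiftsTo c g g') :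
    ShiftsTo c (f * g) (f' * g') := fun k => by
  rw [Units.val_mul, mul_assoc, hf, hg, Units.val_mul, mul_assoc]

theorem inv {f f' : (Ser F)ˣ} (hf : ShiftsTo c f f') : ShiftsTo c f⁻¹ f'⁻¹ := fun k => by
  rw [Units.eq_inv_mul_iff_mul_eq, ← hf, Units.mul_inv_cancel_left]

theorem pow {f f' : (Ser F)ˣ} (hf : ShiftsTo c f f') (k : ℕ) : ShiftsTo c (f ^ k) (f' ^ k) := by
  induction k with
  | zero => simpa using one
  | succ k ih => rw [pow_succ, pow_succ]; exact ih.mul hf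

theorem prod {ι : Type*} (s : Finset ι) {f f' : ι → (Ser F)ˣ}
    (h : ∀ i ∈ s, ShiftsTo c (f i) (f' i)) : ShiftsTo c (∏ i ∈ s, f i) (∏ i ∈ s, f' i) := by
  classical
  induction s using Finset.induction_on with
  | empty => simpa using one
  | insert a s ha ih =>
    rw [Finset.prod_insert ha, Finset.prod_insert ha]
    exact (h a (Finset.mem_insert_self _ _)).mul
      (ih fun i hi => h i (Finset.mem_insert_of_mem hi))

theorem linUnit (a : F) : ShiftsTo c (linUnit a) (linUnit (a - algebraMap Base F c)) :=
  fun g => shift_X_sub_C_mul c a g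

end ShiftsTo

/-- `f(-u) = f(u)`, in a form compatible with products. -/
def IsEven (f : (Ser F)ˣ) : Prop := ∀ g : Ser F, reflect (f.val * g) = f.val * reflect g

namespace IsEven

theorem reflect_eq {f : (Ser F)ˣ} (h : IsEven f) : reflect (f : Ser F) = f := by
  have := h 1
  rwa [mul_one, reflect_one, mul_one] at this

theorem mul {f g : (Ser F)ˣ} (hf : IsEven f) (hg : IsEven g) : IsEven (f * g) := fun k => by
  rw [Units.val_mul, mul_assoc, hf, hg, mul_assoc]

theorem inv {f : (Ser F)ˣ} (hf : IsEven f) : IsEven f⁻¹ := fun k => by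
  rw [Units.eq_inv_mul_iff_mul_eq, ← hf, Units.mul_inv_cancel_left]

theorem prod {ι : Type*} (s : Finset ι) {f : ι → (Ser F)ˣ} (h : ∀ i ∈ s, IsEven (f i)) :
    IsEven (∏ i ∈ s, f i) := by
  classical
  induction s using Finset.induction_on with
  | empty => exact fun k => by rw [Finset.prod_empty, Units.val_one, one_mul, one_mul]
  | insert a s ha ih =>
    rw [Finset.prod_insert ha]
    exact (h a (Finset.mem_insert_self _ _)).mul
      (ih fun i hi => h i (Finset.mem_insert_of_mem hi))

theorem sqUnit (y : F) : IsEven (sqUnit y) := fun g => by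
  rw [val_sqUnit, reflect_X_sq_sub_C_mul]

end IsEven

variable {F' : Type*} [CommRing F'] [Algebra Base F] [Algebra Base F']

/-- The action of an algebra homomorphism on invertible series. -/
def unitMap (φ : F →ₐ[Base] F') : (Ser F)ˣ →* (Ser F')ˣ := Units.map (serMap φ : Ser F →* Ser F')

@[simp] theorem val_unitMap (φ : F →ₐ[Base] F') (f : (Ser F)ˣ) :
    (unitMap φ f : Ser F') = serMap φ (f : Ser F) := rfl

@[simp] theorem unitMap_linUnit (φ : F →ₐ[Base] F') (a : F) :
    unitMap φ (linUnit a) = linUnit (φ a) := by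
  ext1
  simp only [val_unitMap, val_linUnit, map_sub, serMap_X, serMap_C]

@[simp] theorem unitMap_sqUnit (φ : F →ₐ[Base] F') (a : F) :
    unitMap φ (sqUnit a) = sqUnit (φ a) := by
  rw [sqUnit, map_mul, unitMap_linUnit, unitMap_linUnit, map_neg, sqUnit]

end Units

namespace Model

variable {n : ℕ} {m : Fin n → ℕ} {d : Fin n → ℕ} {r : ∀ i, Fin (d i) → ℂ} {F A : Type*}
  [CommRing F] [Algebra Base F] [Ring A] [Algebra Base A] (M : Model m (Rpoly r) F A)

/-! ### The Cartan currents -/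

/-- The signed indices over the node `i`. -/
def signed (m : Fin n → ℕ) (i : Fin n) : Finset (Idx m × Bool) :=
  Finset.univ.filter fun a => a.1.1 = i

theorem mem_signed {i : Fin n} {a : Idx m × Bool} : a ∈ signed m i ↔ a.1.1 = i := by
  simp [signed]

/-- The indices over the node `i`. -/
def indices (m : Fin n → ℕ) (P : Fin n → Prop) [DecidablePred P] : Finset (Idx m) :=
  Finset.univ.filter fun p => P p.1

theorem mem_indices {P : Fin n → Prop} [DecidablePred P] {p : Idx m} : p ∈ indices m P ↔ P p.1 := by
  simp [indices]

theorem prod_signed {G : Type*} [CommMonoid G] (i : Fin n) (f : Idx m × Bool → G) :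
    ∏ a ∈ signed m i, f a = ∏ p ∈ indices m (· = i), f (p, true) * f (p, false) := by
  have : signed m i = indices m (· = i) ×ˢ Finset.univ := by
    ext a; simp [mem_signed, mem_indices]
  rw [this, Finset.prod_product]
  simp

/-- The series `R_i(u - kħ/2)`. -/
def Runit (i : Fin n) (k : ℤ) : (Ser F)ˣ :=
  ∏ l, linUnit (k * M.eta + algebraMap Base F (Polynomial.C (r i l))) *
    linUnit (k * M.eta - algebraMap Base F (Polynomial.C (r i l)))

/-- The image of `h_i(u)`. -/
def hUnit (e : ℕ) (i : Fin (n + 1)) : (Ser F)ˣ :=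
  (linUnit ((i : ℤ) * M.eta))⁻¹ ^ (2 * e) *
    (∏ j ∈ Finset.univ.filter (fun j : Fin n => j.castSucc < i), M.Runit j ((i : ℤ) - j - 1)) *
    (∏ p ∈ indices m (fun j => j.castSucc = i), sqUnit (M.gam p + M.eta)) *
    (∏ p ∈ indices m (fun j => j.succ = i),
      linUnit (M.gam p) * linUnit (-M.gam p - 2 * M.eta))⁻¹

/-- The image of `z_i(u)`, with the factors attached to `Q` in the numerator. -/
def zUnit (i : Fin n) (Q : Finset (Idx m)) : (Ser F)ˣ :=
  M.Runit i 0 * (∏ q ∈ Q, sqUnit (M.gam q + M.eta)) * (∏ a ∈ signed m i, sqUnit (M.x a))⁻¹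

theorem shiftsTo_linUnit {a b : F} (h : b = a + M.eta) :
    ShiftsTo (halfHbar (-1)) (linUnit a) (linUnit b) := by
  convert ShiftsTo.linUnit a using 2
  rw [algebraMap_halfHbar, h, eta]; push_cast; ring

theorem shiftsTo_Runit (i : Fin n) (k : ℤ) :
    ShiftsTo (halfHbar (-1)) (M.Runit i k) (M.Runit i (k + 1)) :=
  ShiftsTo.prod _ fun l _ =>
    (M.shiftsTo_linUnit (by push_cast; ring)).mul (M.shiftsTo_linUnit (by push_cast; ring))

/-- In the quotient of h_{i+1} by the shifted h_i the prefactors and the R_j with j < i cancel,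
leaving R_i. The points at nodes i - 1 and i + 1 give the numerator of z_i, and those at node i give
the denominator. -/
theorem shift_hUnit (e : ℕ) (i : Fin n) :
    ShiftsTo (halfHbar (-1)) (M.hUnit e i.castSucc)⁻¹
      (M.zUnit i (indices m fun j => |(i : ℤ) - j| = 1) * (M.hUnit e i.succ)⁻¹) := by
  have h1 : ShiftsTo (halfHbar (-1)) (M.hUnit e i.castSucc)
    ((linUnit ((i.succ : ℤ) * M.eta))⁻¹ ^ (2 * e) *
    (∏ j ∈ Finset.univ.filter (fun j : Fin n => j.castSucc < i.castSucc),
      M.Runit j ((i.castSucc : ℤ) - j - 1 + 1)) *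
    (∏ p ∈ indices m (fun j => j.castSucc = i.castSucc),
      linUnit (M.gam p + 2 * M.eta) * linUnit (-M.gam p)) *
    (∏ p ∈ indices m (fun j => j.succ = i.castSucc),
      sqUnit (M.gam p + M.eta))⁻¹) := by
    refine ((((M.shiftsTo_linUnit ?_).inv.pow _).mul ?_).mul ?_).mul ?_
    · simp; ring
    · exact ShiftsTo.prod _ fun j _ => M.shiftsTo_Runit _ _
    · exact ShiftsTo.prod _ fun p _ =>
        (M.shiftsTo_linUnit (by ring)).mul (M.shiftsTo_linUnit (by ring))
    · exact (ShiftsTo.prod _ fun p _ =>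
        (M.shiftsTo_linUnit (by ring)).mul (M.shiftsTo_linUnit (by ring))).inv
  have h2 : (∏ q ∈ indices m (fun j => |(i : ℤ) - j| = 1), sqUnit (M.gam q + M.eta)) =
      (∏ q ∈ indices m (fun j => j.succ = i.castSucc), sqUnit (M.gam q + M.eta)) *
      ∏ q ∈ indices m (fun j => j.castSucc = i.succ), sqUnit (M.gam q + M.eta) := by
    rw [← Finset.prod_union]
    · congr 1
      ext q
      simp only [Finset.mem_union, mem_indices, abs_eq (zero_le_one' ℤ), Fin.ext_iff,
        Fin.val_succ, Fin.val_castSucc]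
      omega
    · rw [Finset.disjoint_left]
      intro q
      simp only [mem_indices, Fin.ext_iff, Fin.val_succ, Fin.val_castSucc]
      omega
  have h3 : (∏ j ∈ Finset.univ.filter (fun j : Fin n => j.castSucc < i.succ),
      M.Runit j ((i.succ : ℤ) - j - 1)) = M.Runit i 0 *
      (∏ j ∈ Finset.univ.filter (fun j : Fin n => j.castSucc < i.castSucc),
      M.Runit j ((i.castSucc : ℤ) - j - 1 + 1)) := by
    have : Finset.univ.filter (fun j : Fin n => j.castSucc < i.succ) =
        insert i (Finset.univ.filter (fun j : Fin n => j.castSucc < i.castSucc)) := by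
      ext j
      simp only [Finset.mem_filter, Finset.mem_insert, Finset.mem_univ, true_and, Fin.lt_def,
        Fin.ext_iff, Fin.val_succ, Fin.val_castSucc]
      omega
    rw [this, Finset.prod_insert (by simp)]
    congr 1
    · congr 1; simp
    · refine Finset.prod_congr rfl fun j _ => ?_
      congr 1; simp; ring
  -- Each point p contributes four linear factors: γ_p and -γ_p - ħ from h_{i+1}, γ_p + ħ and -γ_p
  -- from the shifted h_i. They pair up as u² - x_a² for the two signs.
  have h4 : (∏ a ∈ signed m i, sqUnit (M.x a)) =
      (∏ p ∈ indices m (fun j => j.succ = i.succ),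
        linUnit (M.gam p) * linUnit (-M.gam p - 2 * M.eta)) *
      (∏ p ∈ indices m (fun j => j.castSucc = i.castSucc),
        linUnit (M.gam p + 2 * M.eta) * linUnit (-M.gam p)) := by
    simp only [Fin.succ_inj, Fin.castSucc_inj, prod_signed, ← Finset.prod_mul_distrib]
    refine Finset.prod_congr rfl fun p _ => ?_
    rw [x_true, x_false, sqUnit, sqUnit,
      show -(-M.gam p - 2 * M.eta) = M.gam p + 2 * M.eta by ring]
    ac_rfl
  convert h1.inv using 1
  rw [zUnit, hUnit, h2, h3, h4]
  rw [eq_inv_iff_mul_eq_one]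
  simp only [mul_inv, inv_inv]
  generalize (linUnit ((i.succ : ℤ) * M.eta))⁻¹ ^ (2 * e) = a₁
  generalize (∏ j ∈ Finset.univ.filter (fun j : Fin n => j.castSucc < i.castSucc),
      M.Runit j ((i.castSucc : ℤ) - j - 1 + 1)) = a₂
  generalize (∏ p ∈ indices m (fun j => j.succ = i.succ),
        linUnit (M.gam p) * linUnit (-M.gam p - 2 * M.eta)) = a₃
  generalize (∏ p ∈ indices m (fun j => j.castSucc = i.castSucc),
        linUnit (M.gam p + 2 * M.eta) * linUnit (-M.gam p)) = a₄
  generalize (∏ q ∈ indices m (fun j => j.succ = i.castSucc), sqUnit (M.gam q + M.eta)) = a₅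
  generalize (∏ q ∈ indices m (fun j => j.castSucc = i.succ), sqUnit (M.gam q + M.eta)) = a₆
  generalize M.Runit i 0 = a₇
  rw [show a₇ * (a₅ * a₆) * (a₃⁻¹ * a₄⁻¹) * (a₁⁻¹ * (a₇⁻¹ * a₂⁻¹) * a₆⁻¹ * a₃) *
    (a₁ * a₂ * a₄ * a₅⁻¹) = (a₇ * a₇⁻¹) * (a₁ * a₁⁻¹) * (a₂ * a₂⁻¹) * (a₃ * a₃⁻¹) * (a₄ * a₄⁻¹) *
      (a₅ * a₅⁻¹) * (a₆ * a₆⁻¹) by ac_rfl]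
  simp

theorem Runit_zero (i : Fin n) :
    M.Runit i 0 = ∏ l, sqUnit (algebraMap Base F (Polynomial.C (r i l))) := by
  simp [Runit, sqUnit]

theorem isEven_zUnit (i : Fin n) (Q : Finset (Idx m)) : IsEven (M.zUnit i Q) := by
  rw [zUnit, Runit_zero]
  exact ((IsEven.prod _ fun l _ => IsEven.sqUnit _).mul (IsEven.prod _ fun q _ =>
    IsEven.sqUnit _)).mul (IsEven.prod _ fun a _ => IsEven.sqUnit _).inv

/-- Linear factors have exponent -1 and their inverses +1; the exponent counts them. -/
theorem leadsWith_hUnit (e : ℕ) (i : Fin (n + 1)) :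
    UnitLeadsWith (2 * e - 2 * ∑ j ∈ Finset.univ.filter (fun j : Fin n => j.castSucc < i), (d j : ℤ)
      - 2 * (indices m (fun j => j.castSucc = i)).card + 2 * (indices m (fun j => j.succ = i)).card)
      (M.hUnit e i) := by
  have h1 : ∀ p : Idx m, UnitLeadsWith (-2) (sqUnit (M.gam p + M.eta)) := fun p =>
    (UnitLeadsWith.linUnit _).mul (UnitLeadsWith.linUnit _)
  have h2 : ∀ p : Idx m, UnitLeadsWith (-2) (linUnit (M.gam p) * linUnit (-M.gam p - 2 * M.eta)) :=
    fun p => (UnitLeadsWith.linUnit _).mul (UnitLeadsWith.linUnit _)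
  have h3 : ∀ (j : Fin n) (k : ℤ), UnitLeadsWith (-2 * d j) (M.Runit j k) := fun j k => by
    have := UnitLeadsWith.prod Finset.univ fun l (_ : l ∈ Finset.univ) =>
      (UnitLeadsWith.linUnit (k * M.eta + algebraMap Base F (Polynomial.C (r j l)))).mul
      (UnitLeadsWith.linUnit (k * M.eta - algebraMap Base F (Polynomial.C (r j l))))
    convert this using 1
    · simp; ring
    · rfl
  have := ((((UnitLeadsWith.linUnit ((i : ℤ) * M.eta)).inv.pow (2 * e)).mul
    (UnitLeadsWith.prod (Finset.univ.filter (fun j : Fin n => j.castSucc < i))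
      fun j _ => h3 j ((i : ℤ) - j - 1))).mul
    (UnitLeadsWith.prod (indices m (fun j => j.castSucc = i)) fun p _ => h1 p)).mul
    (UnitLeadsWith.prod (indices m (fun j => j.succ = i)) fun p _ => h2 p).inv
  convert this using 1
  · simp only [Finset.sum_const, nsmul_eq_mul, ← Finset.mul_sum]
    push_cast; ring
  · rfl

theorem sh_Runit (a : Idx m × Bool) (i : Fin n) (k : ℤ) :
    unitMap (M.sh a) (M.Runit i k) = M.Runit i k := by
  simp only [Runit, map_prod, map_mul, unitMap_linUnit, map_add, map_sub, map_intCast, M.sh_eta,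
    AlgHom.commutes]

theorem exists_hUnit_eq (e : ℕ) (i : Fin (n + 1)) :
    ∃ c : (Ser F)ˣ, (∀ a, unitMap (M.sh a) c = c) ∧ M.hUnit e i =
      c * (∏ p ∈ indices m (fun j => j.castSucc = i), sqUnit (M.gam p + M.eta)) *
    (∏ p ∈ indices m (fun j => j.succ = i),
      linUnit (M.gam p) * linUnit (-M.gam p - 2 * M.eta))⁻¹ := by
  refine ⟨_, fun a => ?_, rfl⟩
  simp only [map_mul, map_pow, map_inv, map_prod, M.sh_Runit, unitMap_linUnit, map_intCast,
    M.sh_eta]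

theorem prod_indices_eq {a : Idx m × Bool} {P : Fin n → Prop} [DecidablePred P]
    {f : Idx m → (Ser F)ˣ} (hf : ∀ q, q ≠ a.1 → unitMap (M.sh a) (f q) = f q) {y y' : (Ser F)ˣ}
    (hP : P a.1.1) (h : unitMap (M.sh a) (f a.1) * y = f a.1 * y') :
    unitMap (M.sh a) (∏ p ∈ indices m P, f p) * y = (∏ p ∈ indices m P, f p) * y' := by
  have ha : a.1 ∈ indices m P := mem_indices.2 hP
  have h1 : unitMap (M.sh a) (∏ p ∈ (indices m P).erase a.1, f p) =
      ∏ p ∈ (indices m P).erase a.1, f p := by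
    rw [map_prod]
    exact Finset.prod_congr rfl fun q hq => hf q (Finset.mem_erase.1 hq).1
  rw [← Finset.mul_prod_erase _ _ ha, map_mul, h1, mul_right_comm, h, mul_right_comm]

theorem prod_indices_ne {a : Idx m × Bool} {P : Fin n → Prop} [DecidablePred P]
    {f : Idx m → (Ser F)ˣ} (hf : ∀ q, q ≠ a.1 → unitMap (M.sh a) (f q) = f q)
    (hP : ¬ P a.1.1) : unitMap (M.sh a) (∏ p ∈ indices m P, f p) = ∏ p ∈ indices m P, f p := by
  rw [map_prod]
  exact Finset.prod_congr rfl fun q hq => hf q fun e => hP (e ▸ mem_indices.1 hq)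

theorem sh_num_ne {a : Idx m × Bool} (q : Idx m) (h : q ≠ a.1) :
    unitMap (M.sh a) (sqUnit (M.gam q + M.eta)) = sqUnit (M.gam q + M.eta) := by
  rw [unitMap_sqUnit, map_add, M.sh_gam_ne h.symm, M.sh_eta]

theorem sh_den_ne {a : Idx m × Bool} (q : Idx m) (h : q ≠ a.1) :
    unitMap (M.sh a) (linUnit (M.gam q) * linUnit (-M.gam q - 2 * M.eta)) =
      linUnit (M.gam q) * linUnit (-M.gam q - 2 * M.eta) := by
  rw [map_mul, unitMap_linUnit, unitMap_linUnit]
  simp only [map_sub, map_neg, map_mul, map_ofNat, M.sh_gam_ne h.symm, M.sh_eta]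

theorem sh_hUnit_far {a : Idx m × Bool} {e : ℕ} {i : Fin (n + 1)} (h : i ≠ a.1.1.castSucc)
    (h' : i ≠ a.1.1.succ) : unitMap (M.sh a) (M.hUnit e i) = M.hUnit e i := by
  obtain ⟨c, hc, e⟩ := M.exists_hUnit_eq e i
  rw [e, map_mul, map_mul, hc, map_inv, M.prod_indices_ne M.sh_num_ne h.symm,
    M.prod_indices_ne M.sh_den_ne h'.symm]

/-- Only the numerator factor of the point under a moves. As this factor is even in its argument, γ
+ ħ/2 may be replaced by x_a + ħ/2 for both signs. -/
theorem sh_hUnit_same (e : ℕ) (a : Idx m × Bool) :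
    unitMap (M.sh a) (M.hUnit e a.1.1.castSucc) * sqUnit (M.x a + M.eta) =
      M.hUnit e a.1.1.castSucc * sqUnit (M.x a - M.eta) := by
  obtain ⟨c, hc, e⟩ := M.exists_hUnit_eq e a.1.1.castSucc
  have key : unitMap (M.sh a) (sqUnit (M.gam a.1 + M.eta)) * sqUnit (M.x a + M.eta) =
      sqUnit (M.gam a.1 + M.eta) * sqUnit (M.x a - M.eta) := by
    rw [unitMap_sqUnit, map_add, M.sh_eta]
    rcases a with ⟨p, _ | _⟩
    · rw [M.sh_gam_self, x_false, mul_comm, ← sqUnit_neg, ← sqUnit_neg (_ - M.eta)]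
      simp only [sgn]
      congr 2 <;> simp <;> ring
    · rw [M.sh_gam_self, x_true, mul_comm]
      simp only [sgn]
      congr 2; simp; ring
  have key' := M.prod_indices_eq (P := fun j => j.castSucc = a.1.1.castSucc) M.sh_num_ne rfl key
  rw [e, map_mul, map_mul, hc, map_inv, M.prod_indices_ne M.sh_den_ne (by simp [Fin.ext_iff]),
    mul_right_comm, mul_assoc c, key']
  simp only [mul_assoc]
  rw [mul_comm (sqUnit (M.x a - _))]

/-- Only the denominator factor of the point under a moves. It is the product of u - x_a and u -
x_{bar a}, whose poles are sent to x_a - ħ and -x_a. -/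
theorem sh_hUnit_next (e : ℕ) (a : Idx m × Bool) :
    unitMap (M.sh a) (M.hUnit e a.1.1.succ) *
        (linUnit (M.x a - 2 * M.eta) * linUnit (-M.x a)) =
      M.hUnit e a.1.1.succ * (linUnit (M.x a) * linUnit (-M.x a - 2 * M.eta)) := by
  obtain ⟨c, hc, e⟩ := M.exists_hUnit_eq e a.1.1.succ
  have key : unitMap (M.sh a) (linUnit (M.gam a.1) * linUnit (-M.gam a.1 - 2 * M.eta)) *
      (linUnit (M.x a) * linUnit (-M.x a - 2 * M.eta)) =
      (linUnit (M.gam a.1) * linUnit (-M.gam a.1 - 2 * M.eta)) *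
        (linUnit (M.x a - 2 * M.eta) * linUnit (-M.x a)) := by
    rw [map_mul, unitMap_linUnit, unitMap_linUnit]
    simp only [map_sub, map_neg, map_mul, map_ofNat, M.sh_eta]
    rcases a with ⟨p, _ | _⟩
    · simp only [M.sh_gam_self, x_false]
      simp only [sgn]
      rw [mul_comm, mul_comm (linUnit (M.gam p))]
      rw [mul_comm (linUnit (_ - _ * _ * _))]
      congr 3 <;> simp <;> ring
    · simp only [M.sh_gam_self, x_true]
      simp only [sgn]
      rw [mul_comm]
      congr 3 <;> simp
  have key' := M.prod_indices_eq (P := fun j => j.succ = a.1.1.succ) M.sh_den_ne rfl key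
  rw [e, map_mul, map_mul, hc, map_inv, M.prod_indices_ne M.sh_num_ne (by simp [Fin.ext_iff]),
    mul_assoc (c * _), mul_assoc (c * _)]
  congr 1
  rw [inv_mul_eq_iff_eq_mul, mul_left_comm, eq_inv_mul_iff_mul_eq, key']

end Model

namespace Model

variable {n : ℕ} {m : Fin n → ℕ} {d : Fin n → ℕ} {r : ∀ i, Fin (d i) → ℂ} {F A : Type*}
  [CommRing F] [Algebra Base F] [Ring A] [Algebra Base A] (M : Model m (Rpoly r) F A)

/-! ### Partial fractions -/

theorem isUnit_two_eta : IsUnit (2 * M.eta) := by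
  rw [eta, ← algebraMap_hbar]; exact M.isUnit_hbar

theorem isUnit_two : IsUnit (2 : F) := by
  have h : IsUnit (algebraMap Base F (Polynomial.C 2)) :=
    ((isUnit_iff_ne_zero.2 two_ne_zero : IsUnit (2 : ℂ)).map Polynomial.C).map _
  rwa [map_ofNat, map_ofNat] at h

theorem isUnit_gam_add (p : Idx m) : IsUnit (M.gam p + M.eta) :=
  IsUnit.of_mul_eq_one_right _ (M.invLin_mul p 1)

theorem isUnit_x_add (a : Idx m × Bool) : IsUnit (M.x a + M.eta) := by
  rw [← isUnit_pow_iff two_ne_zero, x_bar_add]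
  exact (M.isUnit_gam_add _).pow 2

theorem x_sq_sub_x_bar_sq (a : Idx m × Bool) :
    M.x a ^ 2 - M.x (M.bar a) ^ 2 = -(2 * M.eta) * (2 * M.x a + 2 * M.eta) := by
  rw [x_bar]; ring

/-- Over distinct points the inverse is among the generators. Over the same point the difference is
a multiple of ħ(γ + ħ/2), so this is where ħ must be inverted: the poles γ² and (γ + ħ)² collide at
ħ = 0. -/
theorem isUnit_x_sq_sub {i : Fin n} {a b : Idx m × Bool} (ha : a ∈ signed m i)
    (hb : b ∈ signed m i) (h : a ≠ b) : IsUnit (M.x a ^ 2 - M.x b ^ 2) := by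
  by_cases hp : b.1 = a.1
  · rcases M.eq_or_eq_bar hp with rfl | rfl
    · exact absurd rfl h
    · rw [x_sq_sub_x_bar_sq, ← mul_add]
      exact M.isUnit_two_eta.neg.mul ((isUnit_two (F := F)).mul (M.isUnit_x_add a))
  · have hx : ∀ c : Idx m × Bool, M.x c ^ 2 =
        (M.gam c.1 + algebraMap Base F (halfHbar (2 * if c.2 then 0 else 1))) ^ 2 := by
      rintro ⟨p, _ | _⟩
      · rw [algebraMap_halfHbar]
        simp only [x_false, eta]
        push_cast; ring
      · rw [algebraMap_halfHbar]; simp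
    rw [hx, hx]
    exact IsUnit.of_mul_eq_one_right _ (M.invQuad_mul a.1 b.1
      ((mem_signed.1 ha).trans (mem_signed.1 hb).symm) (Ne.symm hp) _ _)

theorem bar_mem_signed {i : Fin n} {a : Idx m × Bool} (ha : a ∈ signed m i) :
    M.bar a ∈ signed m i := mem_signed.2 ((congrArg _ (M.fst_bar a)).trans (mem_signed.1 ha))

theorem prod_erase_signed {i : Fin n} {a : Idx m × Bool} (ha : a ∈ signed m i) :
    ∏ b ∈ (signed m i).erase a, (M.x a ^ 2 - M.x b ^ 2) =
      -(2 * M.eta) * (2 * M.x a + 2 * M.eta) * M.disc a := by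
  rw [← Finset.mul_prod_erase _ _
    (Finset.mem_erase.2 ⟨M.bar_ne a, M.bar_mem_signed ha⟩), x_sq_sub_x_bar_sq]
  congr 1
  -- With a and bar a gone, the remaining signed indices are both signs over each of the other
  -- points of the node.
  have : ((signed m i).erase a).erase (M.bar a) = others a.1 ×ˢ Finset.univ := by
    ext b
    simp only [Finset.mem_erase, mem_signed, Finset.mem_product, mem_others, Finset.mem_univ,
      and_true, ← mem_signed.1 ha]
    constructor
    · rintro ⟨h1, h2, h3⟩
      exact ⟨h3.symm, M.fst_ne h2 h1⟩
    · rintro ⟨h1, h2⟩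
      exact ⟨fun e => h2 (by rw [e, M.fst_bar]), fun e => h2 (by rw [e]), h1.symm⟩
  rw [this, Finset.prod_product, disc]
  simp

variable (I : ℂ)

/-- The coefficient of `E_a E_{bar a}`. -/
def rho (Q : Finset (Idx m)) (a : Idx m × Bool) : F :=
  M.coef I Q a * M.sh a (M.coef I Q (M.bar a))

/-- The factor ħ on the left absorbs the one in x_a² - x_{bar a}². The residues then follow from
`coef_sh_coef_bar`. -/
theorem exists_zUnit_eq (hI : I ^ 2 = -1) {i : Fin n} {Q : Finset (Idx m)}
    (hQ : ∀ q ∈ Q, |(i : ℤ) - q.1| = 1) :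
    ∃ G : Ser F, IsPoly G ∧ HahnSeries.C (2 * M.eta) * (M.zUnit i Q).val =
      G + ∑ a ∈ signed m i, HahnSeries.C (-((2 * M.x a - 2 * M.eta) * M.rho I Q a)) *
        (recip (M.x a) * recip (-M.x a)) := by
  set p : Polynomial F := Polynomial.C (2 * M.eta) *
    ((∏ l, (Polynomial.X - Polynomial.C (algebraMap Base F (Polynomial.C (r i l)) ^ 2))) *
      ∏ q ∈ Q, (Polynomial.X - Polynomial.C ((M.gam q + M.eta) ^ 2))) with hp
  obtain ⟨G, hG, h⟩ := exists_partial_fractions_series (signed m i) M.x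
    (fun a => -((2 * M.x a - 2 * M.eta) * M.rho I Q a))
    (fun a ha b hb h => M.isUnit_x_sq_sub ha hb h) p fun a ha => by
      have h := M.coef_sh_coef_bar I hI (Q := Q) (a := a) fun q hq => by
        have := hQ q hq
        rw [← mem_signed.1 ha] at this
        exact this
      rw [M.prod_erase_signed ha, hp, rho]
      simp only [Polynomial.eval_mul, Polynomial.eval_prod, Polynomial.eval_sub, Polynomial.eval_X,
        Polynomial.eval_C]
      rw [Rval, mem_signed.1 ha] at h
      simp only [map_pow] at h
      linear_combination 2 * M.eta * h
  refine ⟨G, hG, ?_⟩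
  rw [← h, zUnit, Runit_zero, Units.val_mul, Units.val_mul, Units.coe_prod, Units.coe_prod,
    ← Finset.prod_inv_distrib, Units.coe_prod, hp]
  simp only [Polynomial.eval₂_mul, Polynomial.eval₂_finsetProd, Polynomial.eval₂_sub,
    Polynomial.eval₂_X, Polynomial.eval₂_C, val_sqUnit, val_inv_sqUnit, mul_assoc]

theorem principal_zUnit (hI : I ^ 2 = -1) {i : Fin n} {Q : Finset (Idx m)}
    (hQ : ∀ q ∈ Q, |(i : ℤ) - q.1| = 1) :
    HahnSeries.C (2 * M.eta) * principal (M.zUnit i Q).val =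
      ∑ a ∈ signed m i, HahnSeries.C (-((2 * M.x a - 2 * M.eta) * M.rho I Q a)) *
        (recip (M.x a) * recip (-M.x a)) := by
  obtain ⟨G, hG, h⟩ := M.exists_zUnit_eq I hI hQ
  rw [← principal_C_mul, h, principal_add, hG.principal, zero_add, principal_sum]
  simp only [principal_C_mul, principal_recip_mul_recip]

/-- Each 1/(u² - x²) begins at u^(-2), so even after multiplication by u the sum of poles has only
negative powers. -/
theorem principal_X_mul_zUnit (hI : I ^ 2 = -1) {i : Fin n} {Q : Finset (Idx m)}
    (hQ : ∀ q ∈ Q, |(i : ℤ) - q.1| = 1) :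
    principal (HahnSeries.C (2 * M.eta) * (X * (M.zUnit i Q).val)) =
      X * ∑ a ∈ signed m i, HahnSeries.C (-((2 * M.x a - 2 * M.eta) * M.rho I Q a)) *
        (recip (M.x a) * recip (-M.x a)) := by
  obtain ⟨G, hG, h⟩ := M.exists_zUnit_eq I hI hQ
  rw [mul_left_comm, h, mul_add, principal_add, hG.X_mul.principal, zero_add, Finset.mul_sum,
    principal_sum]
  refine Finset.sum_congr rfl fun a _ => ?_
  rw [mul_left_comm X, principal_C_mul, principal_X_mul_recip_mul_recip]

end Model

namespace ShiftSystem

variable {S F A F' A' : Type*} [CommRing F] [Algebra Base F] [Ring A] [Algebra Base A]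
  [CommRing F'] [Algebra Base F'] [Ring A'] [Algebra Base A']

/-- Used along the inclusions of series rings: it keeps b_i(u), b_i(v) and the three-variable
versions in the form of operators with transported resolvents. -/
theorem map_op {M : ShiftSystem S F A} {M' : ShiftSystem S F' A'} (φ : F →ₐ[Base] F')
    (ψ : A →ₐ[Base] A') (hι : ∀ f, ψ (M.ι f) = M'.ι (φ f)) (hT : ∀ a, ψ (M.T a) = M'.T a)
    (s : Finset S) (r f : S → F) :
    ψ (M.op s r f) = M'.op s (fun a => φ (r a)) (fun a => φ (f a)) := by
  simp only [op, map_sum, map_mul, hι, hT]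

end ShiftSystem

namespace Model

variable {n : ℕ} {m : Fin n → ℕ} {d : Fin n → ℕ} {r : ∀ i, Fin (d i) → ℂ} {F A : Type*}
  [CommRing F] [Algebra Base F] [Ring A] [Algebra Base A] (M : Model m (Rpoly r) F A)
variable (I : ℂ) (e : ℕ)

/-! ### The images of the currents -/

/-- The image of `b_i(u)`. -/
def bSer (i : Fin n) : Ser A :=
  M.ser.op (signed m i) (fun a => recip (M.x a)) (fun a => HahnSeries.C (M.coef I (adj a.1) a))

/-- The images of the currents. -/
def images : Currents n A where
  h i := serMap M.ι (M.hUnit e i).val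
  th i := serMap M.ι (M.hUnit e i)⁻¹.val
  b i := M.bSer I i

theorem images_h (i : Fin (n + 1)) : (M.images I e).h i = serMap M.ι (M.hUnit e i).val := rfl
theorem images_th (i : Fin (n + 1)) : (M.images I e).th i = serMap M.ι (M.hUnit e i)⁻¹.val := rfl
theorem images_b (i : Fin n) : (M.images I e).b i = M.bSer I i := rfl

/-- The image of `z_i(u)`. -/
def zz (i : Fin n) : (Ser F)ˣ := M.zUnit i (indices m fun j => |(i : ℤ) - j| = 1)

theorem images_z (i : Fin n) : (M.images I e).z i = serMap M.ι (M.zz i).val := by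
  rw [Currents.z, images_h, images_th, ← serMap_shift, (M.shift_hUnit e i).shift_eq, ← map_mul,
    ← Units.val_mul, inv_mul_cancel_right, zz]

theorem inU_bSer (i : Fin n) : inU (M.bSer I i) = M.ser.ser.op (signed m i)
    (fun a => inU (recip (M.x a))) (fun a => inU (HahnSeries.C (M.coef I (adj a.1) a))) :=
  ShiftSystem.map_op (M' := M.ser.ser) (constAlg (Ser F)) (constAlg (Ser A))
    (fun f => (serMap_C _ f).symm) (fun _ => rfl) _ _ _

theorem inV_bSer (i : Fin n) : inV (M.bSer I i) = M.ser.ser.op (signed m i)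
    (fun a => inV (recip (M.x a))) (fun a => inU (HahnSeries.C (M.coef I (adj a.1) a))) := by
  have := ShiftSystem.map_op (M := M.ser) (M' := M.ser.ser) (serMap (constAlg F))
    (serMap (constAlg A)) (fun f => (serMap_inV M.ι f).symm) (fun a => by
      rw [ShiftSystem.ser, serMap_C]; rfl) (signed m i)
      (fun a => recip (M.x a)) (fun a => HahnSeries.C (M.coef I (adj a.1) a))
  simp only [serMap_C] at this
  exact this

theorem op_coeff (s : Finset (Idx m × Bool)) (r f : Idx m × Bool → Ser F) (k : ℤ) :
    (M.ser.op s r f).coeff k = ∑ a ∈ s, M.ι ((r a * f a).coeff k) * M.T a := by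
  rw [ShiftSystem.op, HahnSeries.coeff_sum]
  refine Finset.sum_congr rfl fun a _ => ?_
  change HahnSeries.coeff (_ * HahnSeries.C (M.T a)) k = _
  rw [mul_C_coeff]; rfl

theorem bSer_coeff (i : Fin n) (k : ℤ) : (M.bSer I i).coeff k = ∑ a ∈ signed m i,
    M.ι ((recip (M.x a)).coeff k * M.coef I (adj a.1) a) * M.T a := by
  rw [bSer, op_coeff]
  simp only [mul_C_coeff]

theorem inU_C_bSer_coeff_one (i : Fin n) :
    inU (HahnSeries.C ((M.bSer I i).coeff 1)) = M.ser.ser.op (signed m i) 1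
      (fun a => inU (HahnSeries.C (M.coef I (adj a.1) a))) := by
  have h : (M.bSer I i).coeff 1 = M.op (signed m i) 1 (fun a => M.coef I (adj a.1) a) := by
    rw [bSer_coeff, ShiftSystem.op]; simp
  rw [h]
  have := ShiftSystem.map_op (M := M.toShiftSystem) (M' := M.ser.ser)
    ((constAlg (Ser F)).comp (constAlg F)) ((constAlg (Ser A)).comp (constAlg A))
    (fun f => by
      change _ = serMap (serMap M.ι) (HahnSeries.C (HahnSeries.C f))
      rw [serMap_C, serMap_C]; rfl) (fun a => rfl) (signed m i) 1
      (fun a => M.coef I (adj a.1) a)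
  simp only [Pi.one_apply, map_one] at this
  exact this

theorem ser_op_eq (s : Finset (Idx m × Bool)) (r : Idx m × Bool → Ser F) (f : Idx m × Bool → F) :
    M.ser.op s r (fun a => HahnSeries.C (f a)) =
      ∑ a ∈ s, serMap M.ι (r a) * HahnSeries.C (M.ι (f a) * M.T a) := by
  rw [ShiftSystem.op]
  refine Finset.sum_congr rfl fun a _ => ?_
  change serMap M.ι _ * HahnSeries.C (M.T a) = _
  rw [map_mul, serMap_C, map_mul, mul_assoc]

theorem reflect_bSer (i : Fin n) : reflect (M.bSer I i) =
    M.ser.op (signed m i) (fun a => -recip (-M.x a))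
      (fun a => HahnSeries.C (M.coef I (adj a.1) a)) := by
  rw [bSer, ser_op_eq, ser_op_eq, reflect_sum]
  simp only [reflect_mul_C, ← serMap_reflect, reflect_recip]

theorem shift_bSer (i : Fin n) : shift (halfHbar 1) (M.bSer I i) =
    M.ser.op (signed m i) (fun a => recip (M.x a - M.eta))
      (fun a => HahnSeries.C (M.coef I (adj a.1) a)) := by
  rw [bSer, ser_op_eq, ser_op_eq, shift_sum]
  simp only [shift_mul_C, ← serMap_shift, shift_recip, eta]

theorem shift_reflect_bSer (i : Fin n) : shift (halfHbar 1) (reflect (M.bSer I i)) =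
    M.ser.op (signed m i) (fun a => -recip (-M.x a - M.eta))
      (fun a => HahnSeries.C (M.coef I (adj a.1) a)) := by
  rw [reflect_bSer, ser_op_eq, ser_op_eq, shift_sum]
  simp only [shift_mul_C, ← serMap_shift, shift_recip, shift_neg, eta]

theorem inU_op (i : Fin n) (r : Idx m × Bool → Ser F) :
    inU (M.ser.op (signed m i) r (fun a => HahnSeries.C (M.coef I (adj a.1) a))) =
    M.ser.ser.op (signed m i) (fun a => inU (r a))
      (fun a => inU (HahnSeries.C (M.coef I (adj a.1) a))) :=
  ShiftSystem.map_op (M' := M.ser.ser) (constAlg (Ser F)) (constAlg (Ser A))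
    (fun f => (serMap_C _ f).symm) (fun _ => rfl) _ _ _

/-! ### The relations in two variables -/

theorem ser_ser_ι (f : Ser₂ F) : M.ser.ser.ι f = serMap (serMap M.ι) f := rfl

theorem ser_ser_sh (a : Idx m × Bool) (f : Ser₂ F) :
    M.ser.ser.sh a f = serMap (serMap (M.sh a)) f := rfl

theorem ser_ser_bar (a : Idx m × Bool) : M.ser.ser.bar a = M.bar a := rfl

theorem inU_recip {B : Type*} [Ring B] (a : B) :
    (inU X - inU (HahnSeries.C a)) * inU (recip a) = 1 := by
  rw [inU, inU, inU, ← map_sub, ← map_mul, X_sub_C_mul_recip, map_one]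

theorem inV_recip {B : Type*} [Ring B] [Algebra Base B] (a : B) :
    (X - inU (HahnSeries.C a)) * inV (recip a) = 1 := by
  rw [inV_eq, serMap_recip, inU, constAlg_apply, X_sub_C_mul_recip]

/-- Constants, as series in two variables. -/
def const₂ (F : Type*) [CommRing F] [Algebra Base F] : F →ₐ[Base] Ser₂ F :=
  (constAlg (Ser F)).comp (constAlg F)

theorem const₂_apply (f : F) : const₂ F f = inU (HahnSeries.C f) := rfl

theorem sh_const₂ (a : Idx m × Bool) (f : F) :
    M.ser.ser.sh a (const₂ F f) = const₂ F (M.sh a f) := by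
  rw [const₂_apply, ser_ser_sh, serMap_inU, serMap_C, const₂_apply]

theorem sh_inU_X (a : Idx m × Bool) : M.ser.ser.sh a (inU X) = inU X := by
  rw [ser_ser_sh, serMap_inU, serMap_X]

theorem sh_X (a : Idx m × Bool) : M.ser.ser.sh a X = X := by
  rw [ser_ser_sh, serMap_X]

theorem ι_inU_X : M.ser.ser.ι (inU X) = inU X := by
  rw [ser_ser_ι, serMap_inU, serMap_X]

theorem ι_X : M.ser.ser.ι X = X := by
  rw [ser_ser_ι, serMap_X]

theorem ι_const₂_eta : M.ser.ser.ι (const₂ F M.eta) = algebraMap Base (Ser₂ A) (halfHbar 1) := by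
  rw [eta, AlgHom.commutes, AlgHom.commutes]

theorem hbar_smul_eq (y : Ser₂ A) : hbar • y = M.ser.ser.ι (2 * const₂ F M.eta) * y := by
  rw [map_mul, map_ofNat, ι_const₂_eta, ← algebraMap_hbar]
  exact Algebra.smul_def hbar y

theorem sh_x_of_ne {a b : Idx m × Bool} (h : b ≠ a) (h' : b ≠ M.bar a) :
    M.sh a (M.x b) = M.x b := M.sh_x_ne (M.fst_ne h h')

theorem inU_recip_mul_recip (y : F) :
    (inU X ^ 2 - const₂ F y ^ 2) * inU (recip y * recip (-y)) = 1 := by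
  have := congrArg (constAlg (Ser F)) (recip_mul_recip_neg y)
  rw [map_mul, map_sub, map_pow, map_one] at this
  rw [← this, ← map_pow, const₂_apply, inU_eq, inU_eq, inU_eq, map_pow]

theorem inV_recip_mul_recip (y : F) :
    (X ^ 2 - const₂ F y ^ 2) * inV (recip y * recip (-y)) = 1 := by
  have := congrArg (serMap (constAlg F)) (recip_mul_recip_neg y)
  rw [map_mul, map_sub, map_pow, map_one, serMap_X, serMap_C] at this
  rw [← this, ← map_pow, const₂_apply, inV_eq]
  rfl

theorem mem_adj_of {i : Fin n} {a : Idx m × Bool} (ha : a ∈ signed m i) :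
    adj a.1 = indices m fun j => |(i : ℤ) - j| = 1 := by
  rw [← mem_signed.1 ha]; rfl

theorem relBBSame_eq_zero (hI : I ^ 2 = -1) (i : Fin n) : (M.images I e).relBBSame i = 0 := by
  have h := ShiftSystem.bb_same_op (M := M.ser.ser) (s := signed m i)
    (x := fun a => const₂ F (M.x a)) (f := fun a => const₂ F (M.coef I (adj a.1) a))
    (r := fun a => inU (recip (M.x a))) (r' := fun a => inV (recip (M.x a)))
    (ρ := fun a => const₂ F (M.rho I (adj a.1) a))
    (R := fun a => inU (recip (M.x a) * recip (-M.x a)))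
    (R' := fun a => inV (recip (M.x a) * recip (-M.x a))) (u := inU X) (v := X)
    (η := const₂ F M.eta) (fun a ha => M.bar_mem_signed ha) M.sh_inU_X M.sh_X
    (AlgHom.commutes _ _) (fun a _ => inU_recip _) (fun a _ => inV_recip _)
    (fun a _ => inU_recip_mul_recip _) (fun a _ => inV_recip_mul_recip _)
    (fun a _ => by rw [sh_const₂, sh_x_self, map_sub, map_mul, map_ofNat])
    (fun a _ => by rw [ser_ser_bar, x_bar, map_sub, map_neg, map_mul, map_ofNat])
    (fun a _ b _ hb hb' => by rw [sh_const₂, M.sh_x_of_ne hb hb'])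
    (fun a ha b hb hab hab' => by
      have hi : a.1.1 = b.1.1 := (mem_signed.1 ha).trans (mem_signed.1 hb).symm
      have h := M.coef_star I (Q := adj a.1) (Q' := adj b.1) hi (M.fst_ne hab hab')
        (fun hh => (mem_adj.1 hh).fst_ne hi) (fun hh => (mem_adj.1 hh).fst_ne hi.symm)
      simpa only [sh_const₂, map_mul, map_sub, map_add, map_ofNat] using congrArg (const₂ F) h)
    (fun a _ => by rw [sh_const₂, ser_ser_bar, ← map_mul, rho, M.fst_bar])
  -- The function left over in `bb_same_op` is recognised as the z-term: 1/(v² - x²) - 1/(u² - x²)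
  -- is (u² - v²) times the product of the two fractions, and the residues of ħ z_i are -(2x_a - ħ)
  -- ρ_a.
  have hz : 2 * const₂ F M.eta * (inV (principal (M.zz i).val) - inU (principal (M.zz i).val)) =
      (inU X + X) * (X - inU X) * ∑ a ∈ signed m i,
        inU (recip (M.x a) * recip (-M.x a)) * inV (recip (M.x a) * recip (-M.x a)) *
        (2 * const₂ F (M.x a) - 2 * const₂ F M.eta) * const₂ F (M.rho I (adj a.1) a) := by
    have hp := M.principal_zUnit I hI (i := i) (Q := indices m fun j => |(i : ℤ) - j| = 1)
      fun q hq => mem_indices.1 hq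
    have e1 : 2 * const₂ F M.eta = constAlg (Ser F) (HahnSeries.C (2 * M.eta)) := by
      rw [← map_ofNat (const₂ F), ← map_mul]; rfl
    have e2 : 2 * const₂ F M.eta = serMap (constAlg F) (HahnSeries.C (2 * M.eta)) := by
      rw [serMap_C]; exact e1
    have hu := congrArg (constAlg (Ser F)) hp
    have hv := congrArg (serMap (constAlg F)) hp
    rw [map_mul, map_sum, ← e1, ← inU_eq] at hu
    rw [map_mul, map_sum, ← e2, ← inV_eq] at hv
    rw [mul_sub, zz, hu, hv, ← Finset.sum_sub_distrib, Finset.mul_sum]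
    refine Finset.sum_congr rfl fun a ha => ?_
    rw [map_mul (constAlg (Ser F)), map_mul (serMap (constAlg F)), serMap_C, ← inU_eq (_ * _),
      ← inV_eq (_ * _), mem_adj_of ha]
    change const₂ F _ * _ - const₂ F _ * _ = _
    rw [map_neg, map_mul, map_sub, map_mul, map_mul, map_ofNat]
    have k1 := inU_recip_mul_recip (M.x a)
    have k2 := inV_recip_mul_recip (M.x a)
    generalize inU (recip (M.x a) * recip (-M.x a)) = R at *
    generalize inV (recip (M.x a) * recip (-M.x a)) = R' at *
    linear_combination ((2 * const₂ F (M.x a) - 2 * const₂ F M.eta) *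
      const₂ F (M.rho I (indices m fun j => |(i : ℤ) - j| = 1) a)) * (R' * k1 - R * k2)
  have e0 : M.ser.ser.ι (X - inU X) = X - inU X := by rw [map_sub, ι_X, ι_inU_X]
  have e1 : M.ser.ser.ι (inU X + X) = inU X + X := by rw [map_add, ι_X, ι_inU_X]
  have hz' := congrArg M.ser.ser.ι (congrArg ((X - inU X) * ·) hz)
  rw [mul_left_comm, map_mul _ (2 * _), map_mul _ (X - inU X), map_sub _ (inV _), e0] at hz'
  rw [Currents.relBBSame, images_z, images_b, ← serMap_principal, ← serMap_inU, ← serMap_inV,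
    hbar_smul_eq M, hbar_smul_eq M, ← ser_ser_ι, ← ser_ser_ι, hz', inU_bSer, inV_bSer, ← e0, ← e1,
    ← map_mul, ← mul_assoc, ← map_mul]
  simp only [const₂_apply] at h ⊢
  rw [h, sub_eq_zero, add_right_inj]
  exact congrArg _ (by ring)

theorem inU_val_eq {f g y y' : (Ser F)ˣ} {a : Idx m × Bool} (h : unitMap (M.sh a) f * y = g * y') :
    M.ser.ser.sh a (inU f.val) * inU y.val = inU g.val * inU y'.val := by
  rw [ser_ser_sh, serMap_inU, inU_eq, inU_eq, inU_eq, inU_eq, ← map_mul, ← map_mul]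
  exact congrArg (fun f : (Ser F)ˣ => constAlg (Ser F) f.val) h

theorem inU_sqUnit (y : F) : inU (sqUnit y).val = inU X ^ 2 - const₂ F y ^ 2 := by
  rw [val_sqUnit, inU_eq, map_sub, map_pow, ← map_pow (const₂ F)]; rfl

theorem inU_linUnit (y : F) : inU (linUnit y).val = inU X - const₂ F y := by
  rw [val_linUnit, inU_eq, map_sub]; rfl

theorem relHBSame_eq_zero (i : Fin n) : (M.images I e).relHBSame i = 0 := by
  have h := ShiftSystem.hb_same_op (M := M.ser.ser) (s := signed m i)
    (x := fun a => const₂ F (M.x a)) (f := fun a => const₂ F (M.coef I (adj a.1) a))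
    (r := fun a => inV (recip (M.x a))) (r₁ := fun a => inU (recip (M.x a - M.eta)))
    (r₂ := fun a => inU (-recip (-M.x a - M.eta))) (u := inU X) (v := X)
    (h := inU (M.hUnit e i.castSucc).val) (η := const₂ F M.eta) (fun a _ => inV_recip _)
    (fun a _ => by
      rw [← inU_recip (M.x a - M.eta), ← const₂_apply, map_sub]; ring)
    (fun a _ => by
      rw [← inU_recip (-M.x a - M.eta), ← const₂_apply, map_sub, map_neg, inU_eq (-_), map_neg,
        ← inU_eq]
      ring)
    (fun a ha => by
      have h := M.inU_val_eq (M.sh_hUnit_same e a)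
      rwa [mem_signed.1 ha, inU_sqUnit, inU_sqUnit, map_add, map_sub] at h)
  rw [Currents.relHBSame, images_h, images_b, ← serMap_inU, shift_reflect_bSer, shift_bSer, inU_op,
    inU_op, inV_bSer, hbar_smul_eq M, hbar_smul_eq M, ← ser_ser_ι]
  simp only [map_mul, map_add, map_sub, ι_X, ι_inU_X, ι_const₂_eta] at h ⊢
  simp only [const₂_apply] at h
  rw [h]
  simp only [mul_assoc, sub_self]

theorem relHBNext_eq_zero (i : Fin n) : (M.images I e).relHBNext i = 0 := by
  have h := ShiftSystem.hb_next_op (M := M.ser.ser) (s := signed m i)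
    (x := fun a => const₂ F (M.x a)) (f := fun a => const₂ F (M.coef I (adj a.1) a))
    (r := fun a => inV (recip (M.x a))) (r₁ := fun a => inU (recip (M.x a)))
    (r₂ := fun a => inU (-recip (-M.x a))) (u := inU X) (v := X)
    (h := inU (M.hUnit e i.succ).val) (η := const₂ F M.eta) (fun a _ => inV_recip _)
    (fun a _ => inU_recip _)
    (fun a _ => by
      rw [← inU_recip (-M.x a), ← const₂_apply, map_neg, inU_eq (-_), map_neg, ← inU_eq]
      ring)
    (fun a ha => by
      have h := M.inU_val_eq (M.sh_hUnit_next e a)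
      rw [mem_signed.1 ha, Units.val_mul, Units.val_mul, inU_eq (_ * _), inU_eq (_ * _), map_mul,
        map_mul, ← inU_eq, ← inU_eq, ← inU_eq, ← inU_eq] at h
      simp only [inU_linUnit, map_sub, map_neg, map_mul, map_ofNat] at h
      linear_combination h)
  rw [Currents.relHBNext, images_h, images_b, ← serMap_inU, reflect_bSer, inU_op, inU_bSer,
    inV_bSer, hbar_smul_eq M, hbar_smul_eq M, ← ser_ser_ι]
  simp only [map_mul, map_add, map_sub, ι_X, ι_inU_X, ι_const₂_eta] at h ⊢
  simp only [const₂_apply] at h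
  rw [h]
  simp only [mul_assoc, sub_self]

theorem hb_far (i : Fin (n + 1)) (j : Fin n) (h₁ : i ≠ j.castSucc) (h₂ : i ≠ j.succ) :
    comm (inU ((M.images I e).h i)) (inV ((M.images I e).b j)) = 0 := by
  rw [images_h, images_b, inV_bSer, ← serMap_inU]
  refine ShiftSystem.hb_far_op (M := M.ser.ser) fun a ha => ?_
  rw [← mem_signed.1 ha] at h₁ h₂
  rw [ser_ser_sh, serMap_inU, ← val_unitMap, M.sh_hUnit_far h₁ h₂]

theorem hh_comm (i j : Fin (n + 1)) :
    comm (inU ((M.images I e).h i)) (inV ((M.images I e).h j)) = 0 := by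
  rw [images_h, images_h, ← serMap_inU, ← serMap_inV, comm, ← map_mul, ← map_mul, mul_comm,
    sub_self]

theorem sh_inU_recip {a b : Idx m × Bool} (h : a.1 ≠ b.1) :
    M.ser.ser.sh a (inU (recip (M.x b))) = inU (recip (M.x b)) := by
  rw [ser_ser_sh, serMap_inU, serMap_recip, M.sh_x_ne h]

theorem sh_inV_recip {a b : Idx m × Bool} (h : a.1 ≠ b.1) :
    M.ser.ser.sh a (inV (recip (M.x b))) = inV (recip (M.x b)) := by
  rw [ser_ser_sh, serMap_inV, serMap_recip, M.sh_x_ne h]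

theorem fst_ne_of_signed {i j : Fin n} (hij : i ≠ j) {a c : Idx m × Bool} (ha : a ∈ signed m i)
    (hc : c ∈ signed m j) : a.1 ≠ c.1 := fun h =>
  hij ((mem_signed.1 ha).symm.trans ((congrArg _ h).trans (mem_signed.1 hc)))

theorem bb_far (i j : Fin n) (hij : 1 < |(i : ℤ) - (j : ℤ)|) :
    comm (inU ((M.images I e).b i)) (inV ((M.images I e).b j)) = 0 := by
  have hne : i ≠ j := fun h => by simp [h] at hij
  rw [images_b, images_b, inU_bSer, inV_bSer]
  refine ShiftSystem.bb_far_op (M := M.ser.ser)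
    (fun a ha c hc => M.sh_inV_recip (fst_ne_of_signed hne ha hc))
    (fun a ha c hc => M.sh_inU_recip (fst_ne_of_signed hne ha hc).symm) fun a ha c hc => ?_
  have h := M.coef_sh_coef_far I (a := a) (c := c)
    (by rw [mem_signed.1 ha, mem_signed.1 hc]; exact hne)
    (by unfold Adj; rw [mem_signed.1 ha, mem_signed.1 hc]; exact hij.ne')
  have h' := congrArg (const₂ F) h
  rwa [map_mul, map_mul, ← sh_const₂, ← sh_const₂] at h'

theorem relBBNext_eq_zero (hI : I ^ 2 = -1) (i j : Fin n) (hij : (i : ℕ) + 1 = (j : ℕ)) :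
    (M.images I e).relBBNext i j = 0 := by
  have hne : i ≠ j := fun h => by subst h; omega
  have hadj : ∀ a ∈ signed m i, ∀ c ∈ signed m j, Adj a.1 c.1 := fun a ha c hc => by
    unfold Adj; rw [mem_signed.1 ha, mem_signed.1 hc, ← hij]; simp
  have h := ShiftSystem.bb_next_op (M := M.ser.ser) (s := signed m i) (t := signed m j)
    (x := fun a => const₂ F (M.x a)) (f := fun a => const₂ F (M.coef I (adj a.1) a))
    (r := fun a => inU (recip (M.x a))) (r' := fun a => inV (recip (M.x a)))
    (q := fun a c => const₂ F (M.pairCoef I a c)) (u := inU X) (v := X) (η := const₂ F M.eta)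
    (fun a _ => inU_recip _) (fun a _ => inV_recip _)
    (fun a ha c hc => M.sh_inV_recip (fst_ne_of_signed hne ha hc))
    (fun a ha c hc => M.sh_inU_recip (fst_ne_of_signed hne ha hc).symm)
    (fun a ha c hc => by
      have h := congrArg (const₂ F) (M.coef_sh_coef_adj I hI (hadj a ha c hc))
      simpa only [sh_const₂, map_mul, map_sub] using h)
    (fun a ha c hc => by
      have h := congrArg (const₂ F) (M.coef_sh_coef_adj' I hI (hadj a ha c hc))
      simpa only [sh_const₂, map_mul, map_sub, map_add] using h)
  have hs : ∀ y : Ser₂ A, halfHbar 1 • y = M.ser.ser.ι (const₂ F M.eta) * y := fun y => by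
    rw [ι_const₂_eta]; exact Algebra.smul_def _ y
  rw [Currents.relBBNext, Currents.bZero, Currents.bZero, images_b, images_b,
    inU_C_bSer_coeff_one, inU_C_bSer_coeff_one, inU_bSer, inV_bSer, hs]
  simp only [map_sub, ι_X, ι_inU_X, const₂_apply] at h ⊢
  rw [h, sub_self]

end Model

theorem principal₂_mul_C {A : Type*} [Ring A] (G : Ser₂ A) (a : A) :
    principal₂ (G * HahnSeries.C (HahnSeries.C a)) =
      principal₂ G * HahnSeries.C (HahnSeries.C a) := by
  ext s : 2
  rw [principal₂_coeff, mul_C_coeff, mul_C_coeff, principal₂_coeff]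
  split_ifs
  · rw [principal_mul_C]
  · rw [zero_mul]

theorem comm_sum {S ι : Type*} [Ring S] (s : Finset ι) (b : S) (f : ι → S) :
    comm b (∑ i ∈ s, f i) = ∑ i ∈ s, comm b (f i) := by
  simp only [comm, Finset.mul_sum, Finset.sum_mul, Finset.sum_sub_distrib]

section Hom

variable {F B : Type*} [CommRing F] [Algebra Base F] [CommRing B] [Algebra Base B]
  {φ : Ser F →ₐ[Base] B} {ψ : F →ₐ[Base] B}

theorem hom_recip (hφ : ∀ f, ψ f = φ (HahnSeries.C f)) (y : F) :
    (φ X - ψ y) * φ (recip y) = 1 := by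
  rw [hφ, ← map_sub, ← map_mul, X_sub_C_mul_recip, map_one]

theorem hom_recip_mul_recip (hφ : ∀ f, ψ f = φ (HahnSeries.C f)) (y : F) :
    (φ X ^ 2 - ψ y ^ 2) * φ (recip y * recip (-y)) = 1 := by
  rw [hφ, ← map_pow, ← map_pow, ← map_pow, ← map_sub, ← map_mul, recip_mul_recip_neg, map_one]

end Hom

namespace Model

variable {n : ℕ} {m : Fin n → ℕ} {d : Fin n → ℕ} {r : ∀ i, Fin (d i) → ℂ} {F A : Type*}
  [CommRing F] [Algebra Base F] [Ring A] [Algebra Base A] (M : Model m (Rpoly r) F A)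
variable (I : ℂ) (e : ℕ)

/-! ### The Serre relation -/

theorem sh_zUnit_erase (i : Fin n) {Q : Finset (Idx m)} {c : Idx m × Bool} (hc : c.1.1 ≠ i) :
    unitMap (M.sh c) (M.zUnit i (Q.erase c.1)) = M.zUnit i (Q.erase c.1) := by
  rw [zUnit, map_mul, map_mul, M.sh_Runit, map_inv, map_prod, map_prod]
  congr 2
  · exact Finset.prod_congr rfl fun q hq => M.sh_num_ne q (Finset.mem_erase.1 hq).1
  · refine Finset.prod_congr rfl fun a ha => ?_
    rw [unitMap_sqUnit, M.sh_x_ne fun h => hc ((congrArg _ h).trans (mem_signed.1 ha))]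

/-- The factor at the point of c is the only one that the shift T_c changes. It is even, so it can
be written through x_c. -/
theorem zUnit_eq (i : Fin n) {Q : Finset (Idx m)} {c : Idx m × Bool} (hc : c.1 ∈ Q) :
    M.zUnit i Q = sqUnit (M.x c + M.eta) * M.zUnit i (Q.erase c.1) := by
  have h : sqUnit (M.gam c.1 + M.eta) = sqUnit (M.x c + M.eta) := by
    rcases c with ⟨p, _ | _⟩
    · rw [← sqUnit_neg, x_false]; congr 1; ring
    · rfl
  rw [zUnit, ← Finset.mul_prod_erase _ _ hc, zUnit, h]
  simp only [mul_assoc, mul_left_comm (M.Runit i 0)]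

theorem principal₂_ι_mul_T (g k : Ser F) (c : Idx m × Bool) :
    principal₂ (M.ser.ser.ι (inU g * inV k) * M.ser.ser.T c) =
      M.ser.ser.ι (inU (principal g) * inV (principal k)) * M.ser.ser.T c := by
  change principal₂ (_ * HahnSeries.C (HahnSeries.C (M.T c))) =
    _ * HahnSeries.C (HahnSeries.C (M.T c))
  rw [principal₂_mul_C, ser_ser_ι, ← serMap_principal₂, principal₂_inU_mul_inV, ser_ser_ι]

/-- The coefficient of the shift `T_c` in the right hand side of the Serre relation. -/
def serreCoeff (i : Fin n) (c : Idx m × Bool) : Ser F :=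
  X * ∑ a ∈ signed m i, HahnSeries.C (4 * M.eta * ((2 * M.x a - 2 * M.eta) *
    (M.rho I ((adj a.1).erase c.1) a * M.coef I (adj c.1) c))) * (recip (M.x a) * recip (-M.x a))

theorem serreCoeff_eq (hI : I ^ 2 = -1) (i : Fin n) (c : Idx m × Bool) :
    principal (HahnSeries.C (-(4 * M.eta * M.coef I (adj c.1) c)) * (HahnSeries.C (2 * M.eta) *
      (X * (M.zUnit i ((indices m fun j => |(i : ℤ) - j| = 1).erase c.1)).val))) =
    M.serreCoeff I i c := by
  rw [principal_C_mul,
    M.principal_X_mul_zUnit I hI fun q hq => mem_indices.1 (Finset.mem_of_mem_erase hq),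
    serreCoeff, mul_left_comm, Finset.mul_sum]
  refine congrArg _ (Finset.sum_congr rfl fun a ha => ?_)
  rw [← mul_assoc, ← map_mul, mem_adj_of ha]
  refine congrArg (HahnSeries.C · * _) ?_
  ring

theorem inU_mul (f g : Ser F) : inU (f * g) = inU f * inU g := map_mul (constAlg (Ser F)) f g

theorem inU_C_mul (y : F) (f : Ser F) : inU (HahnSeries.C y * f) = const₂ F y * inU f :=
  inU_mul _ _

/-- A summand constant in t has no negative powers of t and is discarded, whatever its dependence on
u. -/
theorem principal₂_serre (hI : I ^ 2 = -1) (i : Fin n) (c : Idx m × Bool) (h : Ser F) :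
    principal₂ (M.ser.ser.ι (inU (HahnSeries.C (-(4 * M.eta * M.coef I (adj c.1) c)) *
      (HahnSeries.C (2 * M.eta) *
        (X * (M.zUnit i ((indices m fun j => |(i : ℤ) - j| = 1).erase c.1)).val))) *
        inV (recip (M.x c)) + inU h * inV 1) * M.ser.ser.T c) =
      M.ser.ser.ι (inU (M.serreCoeff I i c) * inV (recip (M.x c))) * M.ser.ser.T c := by
  have h0 : inV (0 : Ser F) = 0 := inVHom.map_zero
  rw [map_add, add_mul, principal₂_add, principal₂_ι_mul_T, principal₂_ι_mul_T,
    principal_eq_zero IsPoly.one, principal_recip, M.serreCoeff_eq I hI, h0, mul_zero, map_zero,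
    zero_mul, add_zero]

/-- Moving z_i past T_c replaces (x_c + η)² by (x_c - η)² in one factor. The bracket (t - ħ)(u² -
(x_c + η)²) - (t + ħ)(u² - (x_c - η)²) equals -4η((u² - η²) + x_c(t - x_c)). Division by u² - η² and
by t - x_c leaves a simple pole in t and a term independent of t. -/
theorem serreRHS_eq (hI : I ^ 2 = -1) (i j : Fin n) (hij : |(i : ℤ) - (j : ℤ)| = 1) :
    (M.images I e).serreRHS i j = ∑ c ∈ signed m j,
      M.ser.ser.ι (inU (M.serreCoeff I i c) * inV (recip (M.x c))) * M.ser.ser.T c := by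
  have hne : i ≠ j := fun h => by simp [h] at hij
  rw [Currents.serreRHS, images_z, images_b, inV_bSer, ← serMap_inU, ← ser_ser_ι,
    ShiftSystem.ι_mul_op, ShiftSystem.op_mul_ι, hbar_smul_eq M]
  have e1 : recip (algebraMap Base A (halfHbar 1)) * recip (algebraMap Base A (halfHbar (-1))) =
      serMap M.ι (recip M.eta * recip (-M.eta)) := by
    rw [map_mul, serMap_recip, serMap_recip, map_neg, eta, AlgHom.commutes,
      algebraMap_halfHbar (-1)]
    simp
  have e2 : algebraMap Base (Ser₂ A) hbar = M.ser.ser.ι (2 * const₂ F M.eta) := by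
    rw [map_mul, map_ofNat, ι_const₂_eta, ← algebraMap_hbar]
  rw [e1, e2, ← serMap_inU, ← ser_ser_ι, ← M.ι_X, ← M.ι_inU_X]
  rw [← map_sub, ← map_add, ← map_mul, ← map_mul, Finset.mul_sum, Finset.mul_sum,
    ← Finset.sum_sub_distrib, Finset.mul_sum, Finset.mul_sum, principal₂_sum]
  refine Finset.sum_congr rfl fun c hc => ?_
  have hcQ : c.1 ∈ indices m fun j => |(i : ℤ) - j| = 1 :=
    mem_indices.2 (by rw [mem_signed.1 hc]; exact hij)
  have hci : c.1.1 ≠ i := fun h => hne (h.symm.trans (mem_signed.1 hc))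
  set Q := (indices m fun j => |(i : ℤ) - j| = 1).erase c.1 with hQ
  have hz : inU (M.zz i).val = (inU X ^ 2 - const₂ F (M.x c + M.eta) ^ 2) * inU (M.zUnit i Q).val := by
    rw [zz, M.zUnit_eq i hcQ, Units.val_mul, inU_eq, map_mul, ← inU_eq, ← inU_eq, inU_sqUnit]
  have hz' : M.ser.ser.sh c (inU (M.zz i).val) =
      (inU X ^ 2 - const₂ F (M.x c - M.eta) ^ 2) * inU (M.zUnit i Q).val := by
    rw [hz, map_mul, map_sub, map_pow, map_pow, sh_const₂, sh_inU_X, map_add, sh_x_self, sh_eta,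
      M.ser_ser_sh c (inU (M.zUnit i Q).val), serMap_inU, ← val_unitMap, M.sh_zUnit_erase i hci]
    congr 5; ring
  rw [← mul_assoc (M.ser.ser.ι _) (M.ser.ser.ι _), ← mul_assoc (M.ser.ser.ι _) (M.ser.ser.ι _),
    ← mul_assoc (M.ser.ser.ι _) (M.ser.ser.ι _), ← map_mul, ← map_mul, ← map_mul, ← sub_mul,
    ← map_sub, ← mul_assoc, ← map_mul, hz', hz]
  -- The supplied series is the coefficient of the term without pole in t, which the principal part
  -- removes.
  rw [← M.principal₂_serre I hI i c (HahnSeries.C (-(8 * M.eta ^ 2 * M.x c * M.coef I (adj c.1) c)) *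
        (X * (M.zUnit i Q).val * (recip M.eta * recip (-M.eta))))]
  refine congrArg (fun y => principal₂ (M.ser.ser.ι y * M.ser.ser.T c)) ?_
  have k1 := inU_recip_mul_recip M.eta
  have k2 := inV_recip (M.x c)
  rw [← const₂_apply] at k2
  have h1 : inV (1 : Ser F) = 1 := map_one (serMap (constAlg F))
  rw [h1, inU_C_mul, inU_C_mul, inU_C_mul, inU_mul X, inU_mul (X * _), inU_mul X, ← const₂_apply]
  simp only [map_neg, map_mul, map_ofNat, map_pow, map_add, map_sub]
  generalize inU (recip M.eta * recip (-M.eta)) = R at *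
  generalize inV (recip (M.x c)) = t at *
  generalize inU (M.zUnit i Q).val = z at *
  generalize const₂ F (M.coef I (adj c.1) c) = f at *
  generalize const₂ F M.eta = η at *
  generalize const₂ F (M.x c) = x at *
  linear_combination (-8 * η ^ 2 * inU X * z * t * f) * k1 - 8 * η ^ 2 * x * inU X * z * R * f * k2

/-- Constants, as series in three variables. -/
def const₃ (F : Type*) [CommRing F] [Algebra Base F] : F →ₐ[Base] Ser₃ F :=
  (constAlg (Ser₂ F)).comp (const₂ F)

theorem ser₃_ι (f : Ser₃ F) : M.ser.ser.ser.ι f = serMap (serMap (serMap M.ι)) f := rfl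

theorem ser₃_sh (a : Idx m × Bool) (f : Ser₃ F) :
    M.ser.ser.ser.sh a f = serMap (serMap (serMap (M.sh a))) f := rfl

theorem sh_const₃ (a : Idx m × Bool) (f : F) :
    M.ser.ser.ser.sh a (const₃ F f) = const₃ F (M.sh a f) := by
  change serMap (serMap (serMap (M.sh a))) (HahnSeries.C (const₂ F f)) = _
  rw [serMap_C]
  exact congrArg _ (M.sh_const₂ a f)

theorem const₃_eq_inU₁ (f : F) : const₃ F f = inU₁ (HahnSeries.C f) := rfl

theorem const₃_eq_inU₂ (f : F) : const₃ F f = inU₂ (HahnSeries.C f) := by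
  rw [inU₂, inV_eq, serMap_C]; rfl

/-- `f(u₁)` as an algebra homomorphism. -/
def hom₁ (F : Type*) [CommRing F] [Algebra Base F] : Ser F →ₐ[Base] Ser₃ F :=
  (constAlg (Ser₂ F)).comp (constAlg (Ser F))

/-- `f(u₂)` as an algebra homomorphism. -/
def hom₂ (F : Type*) [CommRing F] [Algebra Base F] : Ser F →ₐ[Base] Ser₃ F :=
  (constAlg (Ser₂ F)).comp (serMap (constAlg F))

theorem hom₁_apply (f : Ser F) : hom₁ F f = inU₁ f := rfl
theorem hom₂_apply (f : Ser F) : hom₂ F f = inU₂ f := rfl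

theorem inU₁_bSer (i : Fin n) : inU₁ (M.bSer I i) = M.ser.ser.ser.op (signed m i)
    (fun a => inU₁ (recip (M.x a))) (fun a => const₃ F (M.coef I (adj a.1) a)) := by
  rw [inU₁, inU_bSer]
  exact ShiftSystem.map_op (M' := M.ser.ser.ser) (constAlg (Ser₂ F)) (constAlg (Ser₂ A))
    (fun f => (serMap_C _ f).symm) (fun _ => rfl) _ _ _

theorem inU₂_bSer (i : Fin n) : inU₂ (M.bSer I i) = M.ser.ser.ser.op (signed m i)
    (fun a => inU₂ (recip (M.x a))) (fun a => const₃ F (M.coef I (adj a.1) a)) := by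
  rw [inU₂, inV_bSer]
  exact ShiftSystem.map_op (M' := M.ser.ser.ser) (constAlg (Ser₂ F)) (constAlg (Ser₂ A))
    (fun f => (serMap_C _ f).symm) (fun _ => rfl) _ _ _

theorem inU₁T_ι_mul_T (f g : Ser F) (c : Idx m × Bool) :
    inU₁T (M.ser.ser.ι (inU f * inV g) * M.ser.ser.T c) =
      M.ser.ser.ser.ι (inU₁ f * inT g) * M.ser.ser.ser.T c := by
  rw [inU₁T_eq, map_mul, ser_ser_ι, ← inU₁T_eq, ← serMap_inU₁T, inU₁T_eq, map_mul]
  congr 1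
  · refine congrArg M.ser.ser.ser.ι (congrArg₂ _ ?_ ?_)
    · rw [inU, serMap_C]; rfl
    · rfl
  · change serMap _ (HahnSeries.C (HahnSeries.C _)) = HahnSeries.C (HahnSeries.C (HahnSeries.C _))
    rw [serMap_C]; rfl

theorem inU₂T_ι_mul_T (f g : Ser F) (c : Idx m × Bool) :
    inU₂T (M.ser.ser.ι (inU f * inV g) * M.ser.ser.T c) =
      M.ser.ser.ser.ι (inU₂ f * inT g) * M.ser.ser.ser.T c := by
  rw [inU₂T_eq, map_mul, ser_ser_ι, ← inU₂T_eq, ← serMap_inU₂T, inU₂T_eq, map_mul]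
  congr 1
  · refine congrArg M.ser.ser.ser.ι (congrArg₂ _ ?_ ?_)
    · rw [inU, serMap_C]; rfl
    · rw [inT_eq, inV_eq, serMap_serMap, serMap_serMap]
      congr 1
      refine congrArg serMap ?_
      ext y : 1
      exact serMap_C _ _
  · change serMap _ (HahnSeries.C (HahnSeries.C _)) = HahnSeries.C (HahnSeries.C (HahnSeries.C _))
    rw [serMap_C, serMap_C]; rfl

theorem inT_bSer (i : Fin n) : inT (M.bSer I i) = ∑ c ∈ signed m i,
    M.ser.ser.ser.ι (inT (recip (M.x c)) * const₃ F (M.coef I (adj c.1) c)) *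
      M.ser.ser.ser.T c := by
  rw [inT, inV_bSer, inV_eq]
  have := ShiftSystem.map_op (M := M.ser.ser) (M' := M.ser.ser.ser) (serMap (constAlg (Ser F)))
    (serMap (constAlg (Ser A))) (fun f => (serMap_inV (serMap M.ι) f).symm) (fun a => by
      change serMap _ (HahnSeries.C _) = _
      rw [serMap_C]; rfl) (signed m i)
      (fun a => inV (recip (M.x a))) (fun a => inU (HahnSeries.C (M.coef I (adj a.1) a)))
  rw [this, ShiftSystem.op]
  refine Finset.sum_congr rfl fun c _ => ?_
  rw [inU, serMap_C]
  rfl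

/-! ### The Serre relation with u₁ and u₂ entering through two homomorphisms that agree on
constants. -/

section Abstract

variable {B C : Type*} [CommRing B] [Algebra Base B] [Ring C] [Algebra Base C]
  (N : ShiftSystem (Idx m × Bool) B C) {φ₁ φ₂ : Ser F →ₐ[Base] B} {ψ : F →ₐ[Base] B}

/-- The double commutator is additive in b_j(t), so it may be computed for one summand T_c, where
`serre_op` applies with q given by `pairCoef`. -/
theorem serre_term (hI : I ^ 2 = -1) {i j : Fin n} (hij : |(i : ℤ) - (j : ℤ)| = 1)
    (hbar : N.bar = M.bar) (hφ₁ : ∀ f, ψ f = φ₁ (HahnSeries.C f))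
    (hφ₂ : ∀ f, ψ f = φ₂ (HahnSeries.C f)) (hψ : ∀ a f, N.sh a (ψ f) = ψ (M.sh a f))
    (hX₁ : ∀ a, N.sh a (φ₁ X) = φ₁ X) (hX₂ : ∀ a, N.sh a (φ₂ X) = φ₂ X)
    {c : Idx m × Bool} (hc : c ∈ signed m j) {t : B} (ht : ∀ a ∈ signed m i, N.sh a t = t) :
    N.ι (φ₁ X + φ₂ X) *
      (comm (N.op (signed m i) (fun a => φ₁ (recip (M.x a))) fun a => ψ (M.coef I (adj a.1) a))
        (comm (N.op (signed m i) (fun a => φ₂ (recip (M.x a))) fun a => ψ (M.coef I (adj a.1) a))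
          (N.ι (t * ψ (M.coef I (adj c.1) c)) * N.T c)) +
      comm (N.op (signed m i) (fun a => φ₂ (recip (M.x a))) fun a => ψ (M.coef I (adj a.1) a))
        (comm (N.op (signed m i) (fun a => φ₁ (recip (M.x a))) fun a => ψ (M.coef I (adj a.1) a))
          (N.ι (t * ψ (M.coef I (adj c.1) c)) * N.T c))) =
    N.ι (φ₁ (M.serreCoeff I i c) * t) * N.T c + N.ι (φ₂ (M.serreCoeff I i c) * t) * N.T c := by
  have hne : i ≠ j := fun h => by simp [h] at hij
  have hadj : ∀ a ∈ signed m i, Adj a.1 c.1 := fun a ha => by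
    unfold Adj; rw [mem_signed.1 ha, mem_signed.1 hc, hij]
  have h := ShiftSystem.serre_op (M := N) (s := signed m i) (c := c)
    (x := fun a => ψ (M.x a)) (f := fun a => ψ (M.coef I (adj a.1) a))
    (q := fun a => ψ (M.pairCoef I a c))
    (r₁ := fun a => φ₁ (recip (M.x a))) (r₂ := fun a => φ₂ (recip (M.x a)))
    (R₁ := fun a => φ₁ (recip (M.x a) * recip (-M.x a)))
    (R₂ := fun a => φ₂ (recip (M.x a) * recip (-M.x a)))
    (w := fun a => ψ (M.rho I ((adj a.1).erase c.1) a * M.coef I (adj c.1) c))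
    (u₁ := φ₁ X) (u₂ := φ₂ X) (t := t) (g := ψ (M.coef I (adj c.1) c)) (η := ψ M.eta)
    (fun a ha => by rw [hbar]; exact M.bar_mem_signed ha) hX₁ hX₂ ht (AlgHom.commutes _ _)
    (fun a _ => hom_recip hφ₁ _) (fun a _ => hom_recip hφ₂ _)
    (fun a _ => hom_recip_mul_recip hφ₁ _) (fun a _ => hom_recip_mul_recip hφ₂ _)
    (fun a _ => by rw [hψ, sh_x_self, map_sub, map_mul, map_ofNat])
    (fun a _ => by rw [hbar, x_bar, map_sub, map_neg, map_mul, map_ofNat])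
    (fun a _ b _ hb hb' => by rw [hψ, M.sh_x_of_ne hb (hbar ▸ hb')])
    (fun a ha => by rw [hψ, M.sh_x_ne (fst_ne_of_signed hne ha hc).symm])
    -- The two orders of composition differ by (x_a - x_c - η) - (x_a - x_c + η) = -ħ times the
    -- common function.
    (fun a ha => by
      have h := M.coef_sh_coef_adj I hI (hadj a ha)
      have h' := M.coef_sh_coef_adj' I hI (hadj a ha)
      rw [hψ, hψ, ← map_mul, ← map_mul, h, h', ← map_sub, ← map_ofNat ψ, ← map_mul, ← map_mul,
        ← map_neg]
      refine congrArg ψ ?_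
      ring)
    (fun a ha => by
      have h := congrArg ψ (M.coef_sh_pairCoef I hI (hadj a ha))
      simpa only [hψ, map_mul] using h)
    (fun a ha b hb hab hab' => by
      have h := congrArg ψ (M.coef_sh_pairCoef_ne I hI (hadj a ha)
        ((mem_signed.1 ha).trans (mem_signed.1 hb).symm) (M.fst_ne hab (hbar ▸ hab')))
      simpa only [hψ, map_mul, map_add, map_sub, map_zero] using h)
    -- The factor attached to c is fixed by the shifts of node i, so the surviving function is a
    -- residue of z_i with the factor of c removed, times the coefficient of c.
    (fun a ha => by
      have h := congrArg ψ (M.coef_sh_pairCoef_bar I hI (hadj a ha))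
      rw [hbar, M.fst_bar]
      simpa only [hψ, rho, map_mul, map_sub, map_neg, map_ofNat] using h)
  rw [h, ← add_mul, ← map_add, serreCoeff]
  refine congrArg (N.ι · * _) ?_
  rw [map_mul φ₁, map_mul φ₂, map_sum, map_sum, ← add_mul, Finset.mul_sum, Finset.mul_sum,
    Finset.mul_sum, ← Finset.sum_add_distrib, Finset.sum_mul]
  refine Finset.sum_congr rfl fun a _ => ?_
  rw [map_mul φ₁ (HahnSeries.C _), map_mul φ₂ (HahnSeries.C _), ← hφ₁, ← hφ₂]
  simp only [map_mul ψ, map_sub, map_ofNat]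
  ring

theorem serre_sum (hI : I ^ 2 = -1) {i j : Fin n} (hij : |(i : ℤ) - (j : ℤ)| = 1)
    (hbar : N.bar = M.bar) (hφ₁ : ∀ f, ψ f = φ₁ (HahnSeries.C f))
    (hφ₂ : ∀ f, ψ f = φ₂ (HahnSeries.C f)) (hψ : ∀ a f, N.sh a (ψ f) = ψ (M.sh a f))
    (hX₁ : ∀ a, N.sh a (φ₁ X) = φ₁ X) (hX₂ : ∀ a, N.sh a (φ₂ X) = φ₂ X) {t : Idx m × Bool → B}
    (ht : ∀ a ∈ signed m i, ∀ c ∈ signed m j, N.sh a (t c) = t c) {u₁ u₂ b₁ b₂ bt g₁ g₂ : C}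
    (hu₁ : u₁ = N.ι (φ₁ X)) (hu₂ : u₂ = N.ι (φ₂ X))
    (hb₁ : b₁ = N.op (signed m i) (fun a => φ₁ (recip (M.x a))) fun a => ψ (M.coef I (adj a.1) a))
    (hb₂ : b₂ = N.op (signed m i) (fun a => φ₂ (recip (M.x a))) fun a => ψ (M.coef I (adj a.1) a))
    (hbt : bt = N.op (signed m j) t fun a => ψ (M.coef I (adj a.1) a))
    (hg₁ : g₁ = ∑ c ∈ signed m j, N.ι (φ₁ (M.serreCoeff I i c) * t c) * N.T c)
    (hg₂ : g₂ = ∑ c ∈ signed m j, N.ι (φ₂ (M.serreCoeff I i c) * t c) * N.T c) :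
    (u₁ + u₂) * (comm b₁ (comm b₂ bt) + comm b₂ (comm b₁ bt)) - (g₁ + g₂) = 0 := by
  rw [hbt, ShiftSystem.op, comm_sum, comm_sum, comm_sum, comm_sum, ← Finset.sum_add_distrib, hg₁,
    hg₂, ← Finset.sum_add_distrib, Finset.mul_sum, sub_eq_zero, hu₁, hu₂, ← map_add, hb₁, hb₂]
  exact Finset.sum_congr rfl fun c hc =>
    M.serre_term I N hI hij hbar hφ₁ hφ₂ hψ hX₁ hX₂ hc fun a ha => ht a ha c hc

end Abstract

theorem relSerre_eq_zero (hI : I ^ 2 = -1) (i j : Fin n) (hij : |(i : ℤ) - (j : ℤ)| = 1) :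
    (M.images I e).relSerre i j = 0 := by
  have hne : i ≠ j := fun h => by simp [h] at hij
  refine M.serre_sum I M.ser.ser.ser (φ₁ := hom₁ F) (φ₂ := hom₂ F) (ψ := const₃ F)
    (t := fun c => inT (recip (M.x c))) hI hij rfl const₃_eq_inU₁ const₃_eq_inU₂ M.sh_const₃
    (fun a => ?_) (fun a => ?_) (fun a ha c hc => ?_) ?_ ?_ (M.inU₁_bSer I i) (M.inU₂_bSer I i)
    (M.inT_bSer I j) ?_ ?_
  · rw [hom₁_apply, ser₃_sh, serMap_inU₁, serMap_X]
  · rw [hom₂_apply, ser₃_sh, serMap_inU₂, serMap_X]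
  · rw [ser₃_sh, serMap_inT, serMap_recip, M.sh_x_ne (fst_ne_of_signed hne ha hc)]
  · rw [hom₁_apply, ser₃_ι, serMap_inU₁, serMap_X]
  · rw [hom₂_apply, ser₃_ι, serMap_inU₂, serMap_X]
  · rw [M.serreRHS_eq I e hI i j hij, inU₁T_eq, map_sum]
    exact Finset.sum_congr rfl fun c _ => M.inU₁T_ι_mul_T _ _ c
  · rw [M.serreRHS_eq I e hI i j hij, inU₂T_eq, map_sum]
    exact Finset.sum_congr rfl fun c _ => M.inU₂T_ι_mul_T _ _ c

end Model

/-! ### All defining relations together. -/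

namespace Model

variable {n : ℕ} {m : Fin n → ℕ} {d : Fin n → ℕ} {r : ∀ i, Fin (d i) → ℂ} {F A : Type*}
  [CommRing F] [Algebra Base F] [Ring A] [Algebra Base A] (M : Model m (Rpoly r) F A)
variable (I : ℂ) (e : ℕ)

theorem relator_eq_zero (hI : I ^ 2 = -1) {y : A} (hy : (M.images I e).Relator y) : y = 0 := by
  cases hy with
  | h_th i s =>
    rw [images_h, images_th, ← map_mul, Units.mul_inv, map_one, sub_self, HahnSeries.coeff_zero]
  | th_h i s =>
    rw [images_h, images_th, ← map_mul, Units.inv_mul, map_one, sub_self, HahnSeries.coeff_zero]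
  | z_even i s =>
    rw [images_z, ← serMap_reflect, zz, (M.isEven_zUnit i _).reflect_eq, sub_self,
      HahnSeries.coeff_zero]
  | hh i j s t => rw [hh_comm]; rfl
  | hb_same i s t => rw [relHBSame_eq_zero]; rfl
  | hb_next j s t => rw [relHBNext_eq_zero]; rfl
  | hb_far i j h₁ h₂ s t => rw [hb_far _ _ _ _ _ h₁ h₂]; rfl
  | bb_far i j hij s t => rw [bb_far _ _ _ _ _ hij]; rfl
  | bb_same i s t => rw [relBBSame_eq_zero _ _ _ hI]; rfl
  | bb_next i j hij s t => rw [relBBNext_eq_zero _ _ _ hI _ _ hij]; rfl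
  | serre i j hij s₁ s₂ t => rw [relSerre_eq_zero _ _ _ hI _ _ hij]; rfl

end Model

/-- The sum of the coefficients `⟨ε_i, ∑ m_j α_j⟩`. -/
theorem coroot_sum_apply {n : ℕ} (m : Fin n → ℕ) (i : Fin (n + 1)) :
    (∑ j, (m j : ℤ) • simpleCoroot j) i =
      (Model.indices m fun j => j.castSucc = i).card -
        (Model.indices m fun j => j.succ = i).card := by
  have hcard : ∀ (P : Fin n → Prop) [DecidablePred P],
      ((Model.indices m P).card : ℤ) = ∑ j, if P j then (m j : ℤ) else 0 := fun P _ => by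
    rw [Model.indices, Finset.card_filter, Fintype.sum_sigma]
    push_cast
    refine Finset.sum_congr rfl fun j _ => ?_
    split_ifs <;> simp
  rw [hcard, hcard, ← Finset.sum_sub_distrib, Finset.sum_apply]
  refine Finset.sum_congr rfl fun j _ => ?_
  simp only [simpleCoroot, Pi.smul_apply, Pi.sub_apply, Pi.single_apply, smul_eq_mul, mul_sub,
    mul_ite, mul_one, mul_zero, eq_comm]

theorem sum_rootPairing {n : ℕ} (lam : Fin (n + 1) → ℤ) (i : Fin (n + 1)) :
    ∑ j ∈ Finset.univ.filter (fun j : Fin n => j.castSucc < i), rootPairing lam j =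
      lam 0 - lam i := by
  induction i using Fin.induction with
  | zero => simp
  | succ i ih =>
    have : Finset.univ.filter (fun j : Fin n => j.castSucc < i.succ) =
        insert i (Finset.univ.filter (fun j : Fin n => j.castSucc < i.castSucc)) := by
      ext j
      simp only [Finset.mem_filter, Finset.mem_insert, Finset.mem_univ, true_and, Fin.lt_def,
        Fin.ext_iff, Fin.val_succ, Fin.val_castSucc]
      omega
    rw [this, Finset.sum_insert (by simp), ih, rootPairing]
    ring

/-- The first coordinate is the largest and the coordinates sum to zero. This allows the exponent
2ε_1(λ) to be treated as a natural number. -/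
theorem IsDominant.zero_le {n : ℕ} {lam : Fin (n + 1) → ℤ} (h : IsDominant lam) : 0 ≤ lam 0 := by
  have hle : ∀ i, lam i ≤ lam 0 := fun i => by
    have h1 := sum_rootPairing lam i
    have h2 := Finset.sum_nonneg fun j (_ : j ∈ Finset.univ.filter
      (fun j : Fin n => j.castSucc < i)) => h.nonneg j
    omega
  by_contra hneg
  have := Finset.sum_neg (s := Finset.univ) (f := lam) (fun i _ => (hle i).trans_lt (not_le.1 hneg))
    Finset.univ_nonempty
  exact this.ne h.sum_eq_zero

namespace Model

variable {n : ℕ} {lam mu : Fin (n + 1) → ℤ} {m : Fin n → ℕ}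
  {r : ∀ i : Fin n, Fin (rootPairing lam i).toNat → ℂ} {F A : Type*}
  [CommRing F] [Algebra Base F] [Ring A] [Algebra Base A] (M : Model m (Rpoly r) F A)

/-- The λ_j with j < i telescope to ε_1(λ) - ε_i(λ), and the numbers of points at the two nodes
beside i give ε_i(λ - μ). The exponent is therefore 2ε_i(λ) - 2ε_i(λ - μ). -/
theorem leadsWith_hUnit_mu (hlam : IsDominant lam)
    (hm : lam - mu = ∑ i, (m i : ℤ) • simpleCoroot i) (i : Fin (n + 1)) :
    UnitLeadsWith (2 * mu i) (M.hUnit (lam 0).toNat i) := by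
  convert M.leadsWith_hUnit (lam 0).toNat i using 1
  have h1 := congrFun hm i
  rw [coroot_sum_apply, Pi.sub_apply] at h1
  have h2 := sum_rootPairing lam i
  have h3 : ∑ j ∈ Finset.univ.filter (fun j : Fin n => j.castSucc < i),
      ((rootPairing lam j).toNat : ℤ) = lam 0 - lam i := by
    rw [← h2]
    exact Finset.sum_congr rfl fun j _ => Int.toNat_of_nonneg (hlam.nonneg j)
  rw [h3, Int.toNat_of_nonneg hlam.zero_le]
  linarith

theorem existsUnique_hom (hlam : IsDominant lam)
    (hm : lam - mu = ∑ i, (m i : ℤ) • simpleCoroot i) {I : ℂ} (hI : I ^ 2 = -1) :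
    ∃! Φ : ShiftedTwistedYangian mu →ₐ[Base] A,
      (∀ i, ((ShiftedTwistedYangian.cur mu).b i).map Φ = M.bSer I i) ∧
      (∀ i, ((ShiftedTwistedYangian.cur mu).h i).map Φ =
        serMap M.ι (M.hUnit (lam 0).toNat i).val) := by
  have hh := M.leadsWith_hUnit_mu hlam hm
  refine TwistedGKLO.existsUnique_hom mu ?_ (M.images I (lam 0).toNat)
    (fun y hy => M.relator_eq_zero I _ hI hy) (fun i => ?_) (fun i s hs => ?_) (fun i => ?_)
    (fun i s hs => ?_) (fun i s hs => ?_)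
  · rw [← M.ι.commutes]; exact M.isUnit_hbar.map M.ι
  · rw [images_h, serMap_coeff, (hh i).1.1, map_one]
  · rw [images_h, serMap_coeff, (hh i).1.2 s hs, map_zero]
  · rw [images_th, serMap_coeff, (hh i).2.1, map_one]
  · rw [images_th, serMap_coeff, (hh i).2.2 s hs, map_zero]
  · rw [images_b, bSer_coeff]
    refine Finset.sum_eq_zero fun a _ => ?_
    rw [recip_coeff, if_neg (by omega), zero_mul, map_zero, zero_mul]

end Model

/-! ## Functions inside the algebra of difference operators -/

namespace DiffAlg

variable {n : ℕ} {m : Fin n → ℕ} {R : Fin n → Polynomial Base} {A : Type*} [Ring A]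
  [Algebra Base A] (φ : DiffAlg m R →ₐ[Base] A)

/-- The images of the generators. -/
def img (x : DGen m) : A := φ (gen m R x)

variable (m R) in
/-- The quotient map. -/
def toDiffAlg : FreeAlgebra Base (DGen m) →ₐ[Base] DiffAlg m R := RingQuot.mkAlgHom Base (DRel m R)

theorem lift_eq_of_rel {x y : FreeAlgebra Base (DGen m)} (h : DRel m R x y) :
    FreeAlgebra.lift Base (img φ) x = FreeAlgebra.lift Base (img φ) y := by
  have e : FreeAlgebra.lift Base (img φ) = φ.comp (toDiffAlg m R) :=
    FreeAlgebra.hom_ext (funext fun z => FreeAlgebra.lift_ι_apply _ z)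
  rw [e]
  exact congrArg φ (RingQuot.mkAlgHom_rel Base h)

theorem img_comm {x y : DGen m} (hx : x.IsFunction) (hy : y.IsFunction) :
    img φ x * img φ y = img φ y * img φ x := by
  simpa using lift_eq_of_rel φ (DRel.function_comm x y hx hy)

/-- The invertible element `β_p`. -/
def betUnit (p : Idx m) : Aˣ :=
  ⟨img φ (.bet p), img φ (.betInv p), by simpa using lift_eq_of_rel φ (DRel.bet_betInv p),
    by simpa using lift_eq_of_rel φ (DRel.betInv_bet p)⟩

theorem betUnit_comm (p q : Idx m) : Commute (betUnit φ p) (betUnit φ q) := by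
  have h := lift_eq_of_rel φ (DRel.bet_bet p q)
  simp only [comm, map_sub, map_mul, FreeAlgebra.lift_ι_apply, map_zero, sub_eq_zero] at h
  exact Units.ext h

/-- Conjugation by an invertible element. -/
def conj (u : Aˣ) : A →ₐ[Base] A where
  toFun x := u * x * (u⁻¹ : Aˣ)
  map_one' := by simp
  map_mul' x y := by simp [mul_assoc]
  map_zero' := by simp
  map_add' x y := by simp [mul_add, add_mul]
  commutes' c := by rw [← Algebra.commutes, mul_assoc, Units.mul_inv, mul_one]

theorem conj_apply (u : Aˣ) (x : A) : conj u x = u * x * (u⁻¹ : Aˣ) := rfl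

theorem conj_eq {u : Aˣ} {x y : A} (h : u * x = y * u) : conj u x = y := by
  rw [conj_apply, h, mul_assoc, Units.mul_inv, mul_one]

theorem conj_mul (u v : Aˣ) (x : A) : conj (u * v) x = conj u (conj v x) := by
  simp [conj_apply, mul_assoc]

theorem conj_one (x : A) : conj 1 x = x := by simp [conj_apply]

theorem conj_inv_eq {u : Aˣ} {x y : A} (h : conj u x = y) : conj u⁻¹ y = x := by
  rw [← h, ← conj_mul, inv_mul_cancel, conj_one]

theorem conj_bet_gam (p q : Idx m) : conj (betUnit φ p) (img φ (.gam q)) =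
    img φ (.gam q) + algebraMap Base A (halfHbar (2 * dlt p q)) := by
  refine conj_eq ?_
  have h := lift_eq_of_rel φ (DRel.bet_gam p q)
  change img φ (.bet p) * _ = _ * img φ (.bet p)
  unfold dlt
  split_ifs at h ⊢ with hpq
  · simp [comm, sub_eq_iff_eq_add] at h
    rw [h, add_mul, add_comm, Algebra.smul_def]
    congr 3
    simp [hbar, halfHbar]
  · simp [comm, sub_eq_zero] at h
    rw [h]; simp [halfHbar]

theorem conj_bet_sqrtSub (x p q : Idx m) (h : (p.1 : ℕ) + 1 = q.1) (k : ℤ) :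
    conj (betUnit φ x) (img φ (.sqrtSub p q h k)) =
      img φ (.sqrtSub p q h (k + 2 * dlt x p - 2 * dlt x q)) :=
  conj_eq (u := betUnit φ x) (by
    change img φ (.bet x) * _ = _ * img φ (.bet x)
    simpa using lift_eq_of_rel φ (DRel.bet_sqrtSub x p q h k))

theorem conj_bet_sqrtAdd (x p q : Idx m) (h : (p.1 : ℕ) + 1 = q.1) (k : ℤ) :
    conj (betUnit φ x) (img φ (.sqrtAdd p q h k)) =
      img φ (.sqrtAdd p q h (k + 2 * dlt x p + 2 * dlt x q)) :=
  conj_eq (u := betUnit φ x) (by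
    change img φ (.bet x) * _ = _ * img φ (.bet x)
    simpa using lift_eq_of_rel φ (DRel.bet_sqrtAdd x p q h k))

theorem conj_bet_sqrtR (x p : Idx m) (k : ℤ) :
    conj (betUnit φ x) (img φ (.sqrtR p k)) = img φ (.sqrtR p (k + dlt x p)) :=
  conj_eq (u := betUnit φ x) (by
    change img φ (.bet x) * _ = _ * img φ (.bet x)
    simpa using lift_eq_of_rel φ (DRel.bet_sqrtR x p k))

/-- The shift operators: `β_p⁻¹` and `β_p`. -/
def shiftUnit (a : Idx m × Bool) : Aˣ := if a.2 then (betUnit φ a.1)⁻¹ else betUnit φ a.1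

theorem conj_shift_gam (a : Idx m × Bool) (q : Idx m) : conj (shiftUnit φ a) (img φ (.gam q)) =
    img φ (.gam q) - algebraMap Base A (halfHbar (2 * (sgn a.2 * dlt a.1 q))) := by
  rcases a with ⟨p, _ | _⟩
  · change conj (betUnit φ p) _ = _
    rw [conj_bet_gam, algebraMap_halfHbar, algebraMap_halfHbar (2 * (_ * _))]
    simp only [sgn]; push_cast; simp
  · change conj (betUnit φ p)⁻¹ _ = _
    refine conj_inv_eq ?_
    rw [map_sub, conj_bet_gam, AlgHom.commutes]
    simp [sgn]

theorem conj_shift_sqrtSub (a : Idx m × Bool) (p q : Idx m) (h : (p.1 : ℕ) + 1 = q.1) (k : ℤ) :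
    conj (shiftUnit φ a) (img φ (.sqrtSub p q h k)) =
      img φ (.sqrtSub p q h (k - 2 * (sgn a.2 * (dlt a.1 p - dlt a.1 q)))) := by
  rcases a with ⟨x, _ | _⟩
  · change conj (betUnit φ x) _ = _
    rw [conj_bet_sqrtSub]
    congr 2; simp [sgn]; ring
  · change conj (betUnit φ x)⁻¹ _ = _
    refine conj_inv_eq ?_
    rw [conj_bet_sqrtSub]
    congr 2; simp [sgn]; ring

theorem conj_shift_sqrtAdd (a : Idx m × Bool) (p q : Idx m) (h : (p.1 : ℕ) + 1 = q.1) (k : ℤ) :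
    conj (shiftUnit φ a) (img φ (.sqrtAdd p q h k)) =
      img φ (.sqrtAdd p q h (k - 2 * (sgn a.2 * (dlt a.1 p + dlt a.1 q)))) := by
  rcases a with ⟨x, _ | _⟩
  · change conj (betUnit φ x) _ = _
    rw [conj_bet_sqrtAdd]
    congr 2; simp [sgn]; ring
  · change conj (betUnit φ x)⁻¹ _ = _
    refine conj_inv_eq ?_
    rw [conj_bet_sqrtAdd]
    congr 2; simp [sgn]; ring

theorem conj_shift_sqrtR (a : Idx m × Bool) (p : Idx m) (k : ℤ) :
    conj (shiftUnit φ a) (img φ (.sqrtR p k)) = img φ (.sqrtR p (k - sgn a.2 * dlt a.1 p)) := by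
  rcases a with ⟨x, _ | _⟩
  · change conj (betUnit φ x) _ = _
    rw [conj_bet_sqrtR]
    congr 2; simp [sgn]
  · change conj (betUnit φ x)⁻¹ _ = _
    refine conj_inv_eq ?_
    rw [conj_bet_sqrtR]
    congr 2; simp [sgn]

theorem img_invLin (p : Idx m) (k : ℤ) :
    img φ (.invLin p k) * (img φ (.gam p) + algebraMap Base A (halfHbar k)) = 1 := by
  simpa using lift_eq_of_rel φ (DRel.invLin_mul p k)

theorem img_invQuad (p q : Idx m) (h : p.1 = q.1) (hne : p ≠ q) (k l : ℤ) :
    img φ (.invQuad p q h hne k l) *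
      ((img φ (.gam p) + algebraMap Base A (halfHbar (2 * k))) ^ 2 -
        (img φ (.gam q) + algebraMap Base A (halfHbar (2 * l))) ^ 2) = 1 := by
  simpa using lift_eq_of_rel φ (DRel.invQuad_mul p q h hne k l)

/-- An inverse of a conjugate is the conjugate of the inverse. -/
theorem conj_eq_of_mul_eq_one {u : Aˣ} {x y z w : A} (h : x * y = 1) (hy : conj u y = w)
    (h' : z * w = 1) (hc : z * w = w * z) : conj u x = z := by
  have h1 : conj u x * w = 1 := by rw [← hy, ← map_mul, h, map_one]
  calc conj u x = conj u x * (w * z) := by rw [← hc, h', mul_one]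
    _ = z := by rw [← mul_assoc, h1, one_mul]

theorem img_gam_comm {x : DGen m} (hx : x.IsFunction) (q : Idx m) (c : Base) :
    Commute (img φ x) (img φ (.gam q) + algebraMap Base A c) :=
  Commute.add_right (img_comm φ hx trivial) (Algebra.commutes c _).symm

/-- The presentation does not say how β passes an inverse. Uniqueness of inverses forces it from the
action on γ. -/
theorem conj_shift_invLin (a : Idx m × Bool) (p : Idx m) (k : ℤ) :
    conj (shiftUnit φ a) (img φ (.invLin p k)) =
      img φ (.invLin p (k - 2 * (sgn a.2 * dlt a.1 p))) := by
  refine conj_eq_of_mul_eq_one (img_invLin φ p k) ?_ (img_invLin φ p _)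
    (img_gam_comm φ (x := .invLin p _) trivial p _)
  rw [map_add, conj_shift_gam, AlgHom.commutes, algebraMap_halfHbar k,
    algebraMap_halfHbar (k - _), algebraMap_halfHbar (2 * _)]
  push_cast
  noncomm_ring

theorem conj_shift_invQuad (a : Idx m × Bool) (p q : Idx m) (h : p.1 = q.1) (hne : p ≠ q)
    (k l : ℤ) : conj (shiftUnit φ a) (img φ (.invQuad p q h hne k l)) =
      img φ (.invQuad p q h hne (k - sgn a.2 * dlt a.1 p) (l - sgn a.2 * dlt a.1 q)) := by
  refine conj_eq_of_mul_eq_one (img_invQuad φ p q h hne k l) ?_ (img_invQuad φ p q h hne _ _)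
    (((img_gam_comm φ (x := .invQuad p q h hne _ _) trivial p _).pow_right 2).sub_right
      ((img_gam_comm φ (x := .invQuad p q h hne _ _) trivial q _).pow_right 2))
  rw [map_sub, map_pow, map_pow, map_add, map_add, conj_shift_gam, conj_shift_gam,
    AlgHom.commutes, AlgHom.commutes, algebraMap_halfHbar (2 * k), algebraMap_halfHbar (2 * l),
    algebraMap_halfHbar (2 * (k - _)), algebraMap_halfHbar (2 * (l - _)),
    algebraMap_halfHbar (2 * (_ * dlt a.1 p)), algebraMap_halfHbar (2 * (_ * dlt a.1 q))]
  push_cast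
  congr 2 <;> noncomm_ring

theorem shiftUnit_comm (a b : Idx m × Bool) : Commute (shiftUnit φ a) (shiftUnit φ b) := by
  rcases a with ⟨p, _ | _⟩ <;> rcases b with ⟨q, _ | _⟩
  · exact betUnit_comm φ p q
  · exact (betUnit_comm φ p q).inv_right
  · exact (betUnit_comm φ p q).inv_left
  · exact (betUnit_comm φ p q).inv_inv

theorem shiftUnit_bar (a : Idx m × Bool) :
    shiftUnit φ (a.1, !a.2) = (shiftUnit φ a)⁻¹ := by
  rcases a with ⟨p, _ | _⟩
  · rfl
  · exact (inv_inv _).symm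

end DiffAlg

/-! ## The model attached to a representation of the algebra of difference operators -/

namespace DiffAlg

universe w

variable {n : ℕ} {m : Fin n → ℕ} {R : Fin n → Polynomial Base} {A : Type w} [Ring A]
  [Algebra Base A] (φ : DiffAlg m R →ₐ[Base] A) (hh : IsUnit (algebraMap Base A hbar))

/-- The functions, together with `ħ⁻¹`. -/
def functionSet : Set A := insert ((hh.unit⁻¹ : Aˣ) : A) {a | ∃ x : DGen m, x.IsFunction ∧ img φ x = a}

theorem commute_hbar_inv (a : A) : Commute ((hh.unit⁻¹ : Aˣ) : A) a :=
  Commute.units_inv_left (u := hh.unit) (Algebra.commutes hbar a)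

theorem functionSet_comm : ∀ a ∈ functionSet φ hh, ∀ b ∈ functionSet φ hh, a * b = b * a := by
  rintro a (rfl | ⟨x, hx, rfl⟩) b (rfl | ⟨y, hy, rfl⟩)
  · rfl
  · exact commute_hbar_inv hh _
  · exact (commute_hbar_inv hh _).symm
  · exact img_comm φ hx hy

/-- The subalgebra of functions. -/
def functions : Subalgebra Base A := Algebra.adjoin Base (functionSet φ hh)

theorem img_mem {x : DGen m} (hx : x.IsFunction) : img φ x ∈ functions φ hh :=
  Algebra.subset_adjoin (Or.inr ⟨x, hx, rfl⟩)

/-- It is enough to treat generators: each function generator goes to one of the same kind with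
shifted parameters (γ to γ plus a scalar), and ħ⁻¹ is central. -/
theorem conj_mem (a : Idx m × Bool) {y : A} (hy : y ∈ functions φ hh) :
    conj (shiftUnit φ a) y ∈ functions φ hh := by
  suffices functions φ hh ≤ (functions φ hh).comap (conj (shiftUnit φ a)) from this hy
  refine Algebra.adjoin_le ?_
  rintro _ (rfl | ⟨x, hx, rfl⟩)
  · change conj (shiftUnit φ a) _ ∈ functions φ hh
    rw [conj_eq (commute_hbar_inv hh _).symm]
    exact Algebra.subset_adjoin (Or.inl rfl)
  · change conj (shiftUnit φ a) _ ∈ functions φ hh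
    cases x with
    | gam p =>
      rw [conj_shift_gam]
      exact sub_mem (img_mem φ hh trivial) (algebraMap_mem _ _)
    | bet p => exact hx.elim
    | betInv p => exact hx.elim
    | invQuad p q h hne k l => rw [conj_shift_invQuad]; exact img_mem φ hh trivial
    | invLin p k => rw [conj_shift_invLin]; exact img_mem φ hh trivial
    | sqrtSub p q h k => rw [conj_shift_sqrtSub]; exact img_mem φ hh trivial
    | sqrtAdd p q h k => rw [conj_shift_sqrtAdd]; exact img_mem φ hh trivial
    | sqrtR p k => rw [conj_shift_sqrtR]; exact img_mem φ hh trivial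

section Generic

variable {F : Type*} [CommRing F] [Algebra Base F] (ι : F →ₐ[Base] A)
  (hι : Function.Injective ι) (hr : ι.range = functions φ hh)

/-- The action of a shift operator on functions. -/
def shiftHom (a : Idx m × Bool) : F →ₐ[Base] F :=
  ((AlgEquiv.ofInjective ι hι).symm : ι.range →ₐ[Base] F).comp
    (((conj (shiftUnit φ a)).comp ι).codRestrict ι.range fun f => by
      rw [hr]
      exact conj_mem φ hh a (hr ▸ ι.mem_range_self f))

theorem ι_shiftHom (a : Idx m × Bool) (f : F) :
    ι (shiftHom φ hh ι hι hr a f) = conj (shiftUnit φ a) (ι f) :=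
  congrArg Subtype.val ((AlgEquiv.ofInjective ι hι).apply_symm_apply
    (((conj (shiftUnit φ a)).comp ι).codRestrict ι.range _ f))

open Classical in
/-- The generators that are functions. -/
def fnGen (x : DGen m) : F := if h : ∃ f, ι f = img φ x then h.choose else 0

include hr in
theorem ι_fnGen {x : DGen m} (hx : x.IsFunction) : ι (fnGen φ ι x) = img φ x := by
  have h : ∃ f, ι f = img φ x := by
    have := img_mem φ hh hx
    rwa [← hr] at this
  rw [fnGen, dif_pos h]
  exact h.choose_spec

include hι hr in
-- This is why ħ⁻¹ is adjoined to the functions: the poles of z_i must be separated inside F, not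
-- only in A.
theorem isUnit_hbar_of_range : IsUnit (algebraMap Base F hbar) := by
  obtain ⟨g, hg⟩ : ((hh.unit⁻¹ : Aˣ) : A) ∈ ι.range :=
    hr ▸ Algebra.subset_adjoin (Or.inl rfl)
  refine IsUnit.of_mul_eq_one g (hι ?_)
  rw [map_mul, AlgHom.commutes, map_one]
  change _ * ι g = 1
  erw [hg]
  exact hh.unit.mul_inv

/-- The model attached to a representation of the algebra of difference operators. -/
def model : Model m R F A where
  ι := ι
  sh := shiftHom φ hh ι hι hr
  T a := shiftUnit φ a
  bar a := (a.1, !a.2)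
  T_mul a f := by
    rw [ι_shiftHom, conj_apply, mul_assoc, Units.inv_mul, mul_one]
  T_comm a b := congrArg Units.val (shiftUnit_comm φ a b)
  T_bar a := by rw [shiftUnit_bar, Units.mul_inv]
  sh_comm a b f := hι (by
    simp only [ι_shiftHom, ← conj_mul]
    rw [(shiftUnit_comm φ a b).eq])
  sh_bar a f := hι (by
    simp only [ι_shiftHom, ← conj_mul]
    rw [shiftUnit_bar, mul_inv_cancel, conj_one])
  bar_bar a := by simp
  bar_ne a := by
    rcases a with ⟨p, _ | _⟩ <;> simp
  fn := fnGen φ ι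
  bar_eq a := rfl
  isUnit_hbar := isUnit_hbar_of_range φ hh ι hι hr
  invQuad_mul p q h hne k l := hι (by
    simp only [map_mul, map_sub, map_pow, map_add, AlgHom.commutes, map_one]
    rw [ι_fnGen φ hh ι hr (x := .invQuad p q h hne k l) trivial,
      ι_fnGen φ hh ι hr (x := .gam p) trivial, ι_fnGen φ hh ι hr (x := .gam q) trivial,
      img_invQuad])
  invLin_mul p k := hι (by
    simp only [map_mul, map_add, AlgHom.commutes, map_one]
    rw [ι_fnGen φ hh ι hr (x := .invLin p k) trivial,
      ι_fnGen φ hh ι hr (x := .gam p) trivial, img_invLin])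
  sqrtSub_sq p q h k := hι (by
    simp only [map_sub, map_pow, map_add, AlgHom.commutes]
    rw [ι_fnGen φ hh ι hr (x := .sqrtSub p q h k) trivial,
      ι_fnGen φ hh ι hr (x := .gam p) trivial, ι_fnGen φ hh ι hr (x := .gam q) trivial]
    simpa using lift_eq_of_rel φ (DRel.sqrtSub_sq p q h k))
  sqrtAdd_sq p q h k := hι (by
    simp only [map_pow, map_add, AlgHom.commutes]
    rw [ι_fnGen φ hh ι hr (x := .sqrtAdd p q h k) trivial,
      ι_fnGen φ hh ι hr (x := .gam p) trivial, ι_fnGen φ hh ι hr (x := .gam q) trivial]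
    simpa using lift_eq_of_rel φ (DRel.sqrtAdd_sq p q h k))
  sqrtR_sq p k := hι (by
    rw [← Polynomial.aeval_algHom_apply]
    simp only [map_pow, map_add, AlgHom.commutes]
    rw [ι_fnGen φ hh ι hr (x := .sqrtR p k) trivial, ι_fnGen φ hh ι hr (x := .gam p) trivial]
    have h := lift_eq_of_rel φ (DRel.sqrtR_sq p k)
    rw [← Polynomial.aeval_algHom_apply] at h
    simpa using h)
  sh_gam a q := hι (by
    simp only [ι_shiftHom, map_sub, AlgHom.commutes]
    rw [ι_fnGen φ hh ι hr (x := .gam q) trivial, conj_shift_gam])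
  sh_sqrtSub a p q h k := hι (by
    rw [ι_shiftHom, ι_fnGen φ hh ι hr (x := .sqrtSub p q h k) trivial, conj_shift_sqrtSub,
      ι_fnGen φ hh ι hr (x := .sqrtSub p q h _) trivial])
  sh_sqrtAdd a p q h k := hι (by
    rw [ι_shiftHom, ι_fnGen φ hh ι hr (x := .sqrtAdd p q h k) trivial, conj_shift_sqrtAdd,
      ι_fnGen φ hh ι hr (x := .sqrtAdd p q h _) trivial])
  sh_sqrtR a p k := hι (by
    rw [ι_shiftHom, ι_fnGen φ hh ι hr (x := .sqrtR p k) trivial, conj_shift_sqrtR,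
      ι_fnGen φ hh ι hr (x := .sqrtR p _) trivial])

end Generic

include hh in
/-- Every representation in which `ħ` is invertible comes from a model. -/
theorem exists_model : ∃ (F : Type w) (_ : CommRing F) (_ : Algebra Base F) (M : Model m R F A),
    (∀ x : DGen m, x.IsFunction → M.ι (M.fn x) = img φ x) ∧ ∀ a, M.T a = shiftUnit φ a := by
  -- The generating set commutes elementwise, so the subalgebra it generates is commutative.
  let : CommRing (functions φ hh) :=
    { (functions φ hh).toRing with
      mul_comm := (Algebra.isMulCommutative_adjoin Base
        (functionSet_comm φ hh)).is_comm.comm }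
  have hr : (functions φ hh).val.range = functions φ hh := Subalgebra.range_val _
  exact ⟨functions φ hh, inferInstance, inferInstance,
    model φ hh (functions φ hh).val Subtype.val_injective hr,
    fun x hx => ι_fnGen φ hh _ hr hx, fun a => rfl⟩

end DiffAlg

/-! ## Comparison of the currents -/

theorem map_listProd_ofFn {S S' : Type*} [Monoid S] [Monoid S'] (f : S →* S') {k : ℕ}
    (g : Fin k → S) : f (List.ofFn g).prod = (List.ofFn fun i => f (g i)).prod := by
  rw [map_list_prod, List.map_ofFn]; rfl

section

variable {n : ℕ} {m : Fin n → ℕ}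

theorem map_nodeProd {S S' : Type*} [Ring S] [Ring S'] (f : S →+* S') (P : Fin n → Prop)
    [DecidablePred P] (g : Idx m → S) : f (nodeProd P g) = nodeProd P fun p => f (g p) := by
  rw [nodeProd, nodeProd]
  refine (map_listProd_ofFn (f : S →* S') _).trans ?_
  congr 2
  funext j
  split_ifs
  · exact map_listProd_ofFn (f : S →* S') _
  · exact map_one f

theorem nodeProd_eq_prod {S : Type*} [CommRing S] (P : Fin n → Prop) [DecidablePred P]
    (g : Idx m → S) : nodeProd P g = ∏ p ∈ Model.indices m P, g p := by
  rw [nodeProd, List.prod_ofFn, Model.indices, Finset.prod_filter, Fintype.prod_sigma]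
  refine Finset.prod_congr rfl fun j _ => ?_
  split_ifs
  · exact List.prod_ofFn
  · simp

theorem sum_signed {S : Type*} [AddCommMonoid S] (i : Fin n) (f : Idx m × Bool → S) :
    ∑ a ∈ Model.signed m i, f a = ∑ k : Fin (m i), (f (⟨i, k⟩, true) + f (⟨i, k⟩, false)) := by
  rw [Model.signed, Finset.sum_filter, Fintype.sum_prod_type, Fintype.sum_sigma,
    Finset.sum_eq_single i]
  · simp
  · intro j _ hj
    simp [hj]
  · simp

end

namespace DiffAlg

open Model

variable {n : ℕ} {m : Fin n → ℕ} {d : Fin n → ℕ} {r : ∀ i, Fin (d i) → ℂ} {F A : Type*}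
  [CommRing F] [Algebra Base F] [Ring A] [Algebra Base A]
  (φ : DiffAlg m (Rpoly r) →ₐ[Base] A) (M : Model m (Rpoly r) F A)
  (hfn : ∀ x : DGen m, x.IsFunction → M.ι (M.fn x) = img φ x)
  (hT : ∀ a, M.T a = shiftUnit φ a) (I : ℂ)

include hfn

theorem ι_gam (p : Idx m) : M.ι (M.gam p) = φ (gam (Rpoly r) p) := hfn _ trivial

omit hfn in
theorem ι_eta (k : ℤ) : M.ι (k * M.eta) = φ (sc (Rpoly r) k) := by
  rw [sc, AlgHom.commutes, eta, ← algebraMap_halfHbar, AlgHom.commutes]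

theorem ι_neg_gam_sub (p : Idx m) :
    M.ι (-M.gam p - 2 * M.eta) = φ (-gam (Rpoly r) p - sc (Rpoly r) 2) := by
  rw [map_sub, map_sub, map_neg, map_neg, ι_gam φ M hfn, ← ι_eta φ M, Int.cast_ofNat]

theorem ι_rootSub (p q : Idx m) (k : ℤ) :
    M.ι (M.rootSub I p q k) = φ (rootSub (Rpoly r) I p q k) := by
  rw [Model.rootSub, rootSub]
  split_ifs
  · exact hfn (.sqrtSub p q _ k) trivial
  · rw [map_smul, map_smul]
    exact congrArg _ (hfn (.sqrtSub q p _ (-k)) trivial)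
  · simp

theorem ι_rootAdd (p q : Idx m) (k : ℤ) :
    M.ι (M.rootAdd p q k) = φ (rootAdd (Rpoly r) p q k) := by
  rw [Model.rootAdd, rootAdd]
  split_ifs
  · exact hfn (.sqrtAdd p q _ k) trivial
  · exact hfn (.sqrtAdd q p _ k) trivial
  · simp

theorem ι_quad (p : Idx m) (σ : Bool) :
    M.ι (∏ q ∈ others p, M.quad (p, σ) q) = φ (invProd (Rpoly r) p (if σ then 0 else 1)) := by
  have h : ∏ q ∈ others p, M.quad (p, σ) q =
      ∏ l : Fin (m p.1), M.quad (p, σ) ⟨p.1, l⟩ := by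
    rw [others, Finset.prod_filter, Fintype.prod_sigma, Finset.prod_eq_single p.1]
    · refine Finset.prod_congr rfl fun l _ => ?_
      split_ifs with h
      · rfl
      · rw [quad, dif_neg h]
    · intro j _ hj
      exact Finset.prod_eq_one fun l _ => if_neg fun e => hj e.1.symm
    · exact fun e => (e (Finset.mem_univ _)).elim
  rw [h, invProd, ← List.prod_ofFn]
  refine (map_listProd_ofFn (M.ι : F →* A) _).trans
    (Eq.trans ?_ (map_listProd_ofFn (φ : DiffAlg m (Rpoly r) →* A) _).symm)
  congr 2
  funext l
  change M.ι _ = φ _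
  rw [quad]
  by_cases h : p ≠ ⟨p.1, l⟩
  · rw [dif_pos h, dif_pos ⟨rfl, h⟩]
    exact hfn (.invQuad p ⟨p.1, l⟩ rfl h _ _) trivial
  · rw [dif_neg h, dif_neg fun e => h e.2, map_one, map_one]

include hT

/-- For the two signs the uniform coefficient specialises to ϰ and ϰ': the root offsets -sgn and 2 -
sgn become -1, 1 and 1, 3. -/
theorem ι_coef_mul_T (p : Idx m) (σ : Bool) :
    M.ι (M.coef I (adj p) (p, σ)) * M.T (p, σ) =
      φ (if σ then kap (Rpoly r) I p else kapPrime (Rpoly r) I p) := by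
  have hroot : M.ι (∏ q ∈ adj p, M.root I (p, σ) q) =
      φ (nodeProd (fun j => |(p.1 : ℤ) - (j : ℤ)| = 1) fun q =>
        rootSub (Rpoly r) I p q (-sgn σ) * rootAdd (Rpoly r) p q (2 - sgn σ)) := by
    have e : adj p = indices m fun j => |(p.1 : ℤ) - (j : ℤ)| = 1 := rfl
    rw [e, ← nodeProd_eq_prod]
    refine (map_nodeProd (M.ι : F →+* A) _ _).trans
      (Eq.trans ?_ (map_nodeProd (φ : DiffAlg m (Rpoly r) →+* A) _ _).symm)
    congr 1
    funext q
    change M.ι _ = φ _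
    rw [root, map_mul, map_mul, ι_rootSub φ M hfn, ι_rootAdd φ M hfn]
  rw [coef, map_mul, map_mul, map_mul, hroot, ι_quad φ M hfn, hT, rt, lin, map_smul,
    hfn (.sqrtR _ _) trivial, hfn (.invLin _ _) trivial]
  cases σ
  · change _ = φ (kapPrime (Rpoly r) I p)
    simp only [kapPrime, map_mul, map_smul]
    rfl
  · change _ = φ (kap (Rpoly r) I p)
    simp only [kap, map_mul, map_smul]
    rfl

theorem bSer_eq (i : Fin n) : M.bSer I i = serMap φ (bImage (Rpoly r) I i) := by
  rw [bSer, ser_op_eq, sum_signed, bImage, map_sum]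
  refine Finset.sum_congr rfl fun k _ => ?_
  have e : M.ι (M.coef I (adj ⟨i, k⟩) (⟨i, k⟩, true)) * M.T (⟨i, k⟩, true) =
      φ (kap (Rpoly r) I ⟨i, k⟩) := ι_coef_mul_T φ M hfn hT I ⟨i, k⟩ true
  have e' : M.ι (M.coef I (adj ⟨i, k⟩) (⟨i, k⟩, false)) * M.T (⟨i, k⟩, false) =
      φ (kapPrime (Rpoly r) I ⟨i, k⟩) := ι_coef_mul_T φ M hfn hT I ⟨i, k⟩ false
  rw [e, e', x_true, x_false, map_add, map_mul, map_mul, serMap_C, serMap_C, serMap_recip,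
    serMap_recip, serMap_recip, serMap_recip, ι_gam φ M hfn, ι_neg_gam_sub φ M hfn]

omit hT

omit hfn in
theorem val_Runit (i : Fin n) (k : ℤ) :
    (M.Runit i k).val = Polynomial.aeval (X - HahnSeries.C (k * M.eta)) (Rpoly r i) := by
  rw [Runit, Units.coe_prod, Rpoly, map_prod]
  refine Finset.prod_congr rfl fun l _ => ?_
  have e : algebraMap Base (Ser F) (Polynomial.C (r i l ^ 2)) =
      HahnSeries.C (algebraMap Base F (Polynomial.C (r i l))) ^ 2 := by
    rw [← map_pow, ← map_pow, ← map_pow]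
    rfl
  rw [map_sub, map_pow, Polynomial.aeval_X, Polynomial.aeval_C, e]
  simp only [Units.val_mul, val_linUnit, map_add, map_sub]
  ring

theorem hUnit_eq (e : ℕ) (i : Fin (n + 1)) :
    serMap M.ι (M.hUnit e i).val = serMap φ (hImage (Rpoly r) e i) := by
  have hR : serMap M.ι (∏ j ∈ Finset.univ.filter (fun j : Fin n => j.castSucc < i),
      M.Runit j ((i : ℤ) - j - 1)).val = serMap φ (List.ofFn fun j : Fin n =>
      if j.castSucc < i then Polynomial.aeval
        (X - HahnSeries.C (sc (Rpoly r) ((i : ℤ) - (j : ℤ) - 1)) : Ser (DiffAlg m (Rpoly r)))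
        (Rpoly r j) else 1).prod := by
    rw [Units.coe_prod, Finset.prod_filter, ← List.prod_ofFn]
    refine (map_listProd_ofFn (serMap M.ι : Ser F →* Ser A) _).trans
      (Eq.trans ?_ (map_listProd_ofFn (serMap φ : Ser (DiffAlg m (Rpoly r)) →* Ser A) _).symm)
    congr 2
    funext j
    change serMap M.ι _ = serMap φ _
    split_ifs
    · rw [val_Runit, ← Polynomial.aeval_algHom_apply, ← Polynomial.aeval_algHom_apply, map_sub,
        map_sub, serMap_X, serMap_X, serMap_C, serMap_C, ι_eta]
    · rw [map_one, map_one]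
  have hprod : ∀ (P : Fin n → Prop) [DecidablePred P] (f : Idx m → (Ser F)ˣ)
      (g : Idx m → Ser (DiffAlg m (Rpoly r))), (∀ p, serMap M.ι (f p).val = serMap φ (g p)) →
      serMap M.ι (∏ p ∈ indices m P, f p).val = serMap φ (nodeProd P g) := fun P _ f g h => by
    rw [Units.coe_prod, ← nodeProd_eq_prod]
    refine (map_nodeProd (serMap M.ι : Ser F →+* Ser A) _ _).trans
      (Eq.trans ?_ (map_nodeProd (serMap φ : Ser (DiffAlg m (Rpoly r)) →+* Ser A) _ _).symm)
    congr 1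
    funext p
    exact h p
  rw [hUnit, ← Finset.prod_inv_distrib, hImage]
  simp only [Units.val_mul, map_mul]
  rw [hR]
  refine congrArg₂ (· * ·) (congrArg₂ (· * ·) (congrArg₂ (· * ·) ?_ rfl) (hprod _ _ _ fun p => ?_))
    (hprod _ _ _ fun p => ?_)
  · rw [Units.val_pow_eq_pow_val, val_inv_linUnit, map_pow, map_pow, serMap_recip, serMap_recip,
      ι_eta]
  · have h1 := ι_eta φ M 1
    rw [Int.cast_one, one_mul] at h1
    have h2 : M.ι ((M.gam p + M.eta) ^ 2) = φ ((gam (Rpoly r) p + sc (Rpoly r) 1) ^ 2) := by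
      rw [map_pow, map_pow, map_add, map_add, ι_gam φ M hfn, h1]
    rw [val_sqUnit, map_sub, map_sub, serMap_C, serMap_C, h2, map_pow (serMap M.ι),
      map_pow (serMap φ), serMap_X, serMap_X]
  · rw [mul_inv, Units.val_mul, val_inv_linUnit, val_inv_linUnit, map_mul, map_mul, serMap_recip,
      serMap_recip, serMap_recip, serMap_recip, ι_gam φ M hfn, ι_neg_gam_sub φ M hfn]

end DiffAlg

theorem isUnit_hbar_diffAlgLoc {n : ℕ} (m : Fin n → ℕ) (R : Fin n → Polynomial Base) :
    IsUnit (algebraMap Base (DiffAlgLoc m R) hbar) := by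
  have h : IsUnit (algebraMap Base (Localization.Away hbar) hbar) :=
    IsLocalization.Away.algebraMap_isUnit hbar
  have := h.map (Algebra.TensorProduct.includeLeft :
    Localization.Away hbar →ₐ[Base] DiffAlgLoc m R)
  rwa [AlgHom.commutes] at this

end TwistedGKLO

end

/-! ### The homomorphism into the localised algebra of difference operators. -/

theorem mainTheorem8 {n : ℕ} (lam mu : Fin (n + 1) → ℤ)
    (hlam : TwistedGKLO.IsDominant lam) (hmu : TwistedGKLO.IsDominant mu)
    (m : Fin n → ℕ) (hm : lam - mu = ∑ i, (m i : ℤ) • TwistedGKLO.simpleCoroot i)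
    (r : ∀ i : Fin n, Fin (TwistedGKLO.rootPairing lam i).toNat → ℂ)
    (I : ℂ) (hI : I ^ 2 = -1) :
    ∃! Φ : TwistedGKLO.ShiftedTwistedYangian mu →ₐ[TwistedGKLO.Base]
        TwistedGKLO.DiffAlgLoc m (TwistedGKLO.Rpoly r),
      (∀ i : Fin n,
        ((TwistedGKLO.ShiftedTwistedYangian.cur mu).b i).map Φ =
          (TwistedGKLO.bImage (m := m) (TwistedGKLO.Rpoly r) I i).map
            (TwistedGKLO.toLoc m (TwistedGKLO.Rpoly r))) ∧
      (∀ i : Fin (n + 1),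
        ((TwistedGKLO.ShiftedTwistedYangian.cur mu).h i).map Φ =
          (TwistedGKLO.hImage (m := m) (TwistedGKLO.Rpoly r) (lam 0).toNat i).map
            (TwistedGKLO.toLoc m (TwistedGKLO.Rpoly r))) := by
  -- The model is built inside the localisation itself, so injectivity of the map from the algebra
  -- of difference operators plays no role.
  obtain ⟨F, _, _, M, hfn, hT⟩ := TwistedGKLO.DiffAlg.exists_model
    (TwistedGKLO.toLoc m (TwistedGKLO.Rpoly r))
    (TwistedGKLO.isUnit_hbar_diffAlgLoc m (TwistedGKLO.Rpoly r))
  have h := M.existsUnique_hom (mu := mu) hlam hm hI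
  simp only [TwistedGKLO.DiffAlg.bSer_eq _ M hfn hT, TwistedGKLO.DiffAlg.hUnit_eq _ M hfn] at h
  exact h
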